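/- **Conventions.** Let $p$ be a prime, $R$ a perfect field of characteristic $p$, $R'=W_2(R)$ the ring of $p$-typical Witt vectors of length two, and $q:R'\to R$ the projection, so that $p\operatorname{Ker}q=0$. Complexes are homologically indexed by $\mathbb Z$, with differential of degree $-1$. For a commutative ring $S$, $C_\bullet(S)$ is the category of complexes of $S$-modules and $C^{pf}_\bullet(S)\subset C_\bullet(S)$ the full subcategory of bounded complexes of finitely generated projective $S$-modules. Let $q^*:C^{pf}_\bullet(R')\to C^{pf}_\bullet(R)$ be the functor $V\mapsto V/p=R\otimes_{R'}V$; complexes of $R$-modules are also regarded as complexes of $R'$-modules via $q$. *Filtered truncations.* For a complex $E$ with a decreasing filtration $F^\bullet$ by subcomplexes put $$(\tau^F_{\ge n}E)_i=d^{-1}(F^{n+1-i}E_{i-1})\cap F^{n-i}E_i,\qquad (\tau^F_{\le n}E)_i=E_i/\bigl(F^{n+1-i}E_i+d(F^{n-i}E_{i+1})\bigr),$$ with the induced filtrations, and $\tau^F_{[0,1]}=\tau^F_{\ge0}\tau^F_{\le1}$. *Multiplicative resolution data.* Let $G=\mathbb Z/p\mathbb Z$. Fix $\nu=\langle P_\bullet,I^\bullet\rangle$,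 where $P_\bullet\to\mathbb Z$ is a resolution of the trivial $\mathbb Z[G]$-module $\mathbb Z$ by projective $\mathbb Z[G]$-modules, $\mathbb Z\to I^\bullet$ is a right resolution of $\mathbb Z$ by $\mathbb Z[G]$-modules that are $\mathbb Z$-free and injective relative to $\mathbb Z$ (equivalently, projective over $\mathbb Z[G]$), and both $I^\bullet$ and $\overline P_\bullet=\operatorname{Cone}(P_\bullet\to\mathbb Z)$ (so $\overline P_0=\mathbb Z$ and $\overline P_i=P_{i-1}$ for $i\ge1$) are equipped with structures of unital associative $G$-equivariant DG algebras over $\mathbb Z$. The term $I^n$ has homological degree $-n$. *The complex $C(V)$.* For $V\in C_\bullet(S)$ let $G$ act on $V^{\otimes_S p}$ by cyclic permutations with the Koszul signs, and let $F^iV^{\otimes p}$ be the part of $V^{\otimes p}$ of degrees $\le -ip$. Put $$\check C(V)=\bigl(V^{\otimes_Sp}\otimes_{\mathbb Z}\overline P_\bullet\otimes_{\mathbb Z}I^\bullet\bigr)^{G}$$ (direct-sum total complex), with the filtration induced by $F^\bullet V^{\otimes p}$, and $C(V)=\tau^F_{[0,1]}\check C(V)$, with its induced filtration. For $V\in C^{pf}_\bullet(R')$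 the quotient map $V\to V/p$ induces $q:C(V)\to C(V/p)$, and the map $(V/p)^{\otimes p}=V^{\otimes p}/p\xrightarrow{\ p\ }V^{\otimes p}$ induces $p:C(V/p)\to C(V)$, where $q\circ p=0$. For $W\in C^{pf}_\bullet(R)$ let $\overline C^r(W)=\operatorname{Ker}\bigl(C(W)\to\tau^F_{\le0}C(W)\bigr)$ and $\overline C^l(W)=C(W)/\tau^F_{\ge1}C(W)$. Define functors $C^l,C^r:C^{pf}_\bullet(R')\to C_\bullet(R')$ by $$C^l(V)=C(V)/p\bigl(\overline C^r(V/p)\bigr),\qquad C^r(V)=\operatorname{Ker}\bigl(C(V)\xrightarrow{\ q\ }C(V/p)\to\overline C^l(V/p)\bigr).$$ The maps $q$ and $p$ induce natural structure maps $l_V:C^l(V)\to C(V/p)$ and $r_V:C(V/p)\to C^r(V)$ (these make $C^l$ and $C^r$ the left and the right DG splitting of the DG elementary extension $C$). **Proposition.** The functors $C^l$ and $C^r$, with their structure maps, depend only on $V/p$; that is, they factor through $q^*:C^{pf}_\bullet(R')\to C^{pf}_\bullet(R)$. Precisely, for any multiplicative resolution data $\nu$ as above: 1. there are a functor $\mathcal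 C^l:C^{pf}_\bullet(R)\to C_\bullet(R')$, an isomorphism of functors $e:\mathcal C^l\circ q^*\cong C^l$, and a natural transformation $l:\mathcal C^l\to C$ of functors on $C^{pf}_\bullet(R)$, such that $l_V\circ e_V=l_{V/p}$ for all $V\in C^{pf}_\bullet(R')$ (here $l_{V/p}$ is the component of the natural transformation $l$ at $q^*V$); 2. there are a functor $\mathcal C^r:C^{pf}_\bullet(R)\to C_\bullet(R')$, an isomorphism of functors $e:\mathcal C^r\circ q^*\cong C^r$, and a natural transformation $r:C\to\mathcal C^r$ of functors on $C^{pf}_\bullet(R)$, such that $e_V\circ r_{V/p}=r_V$ for all $V\in C^{pf}_\bullet(R')$ (here $r_{V/p}$ is the component of the natural transformation $r$ at $q^*V$). -/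

import Mathlib

open CategoryTheory TensorProduct

universe u

noncomputable section

namespace CyclicPowers

/-! ### Filtered complexes and filtered truncations -/

/-- Chain complexes of `S`-modules, indexed by all integers, with differential `K_{n+1} → K_n`. -/
abbrev Ch (S : Type u) [CommRing S] := ChainComplex (ModuleCat.{u} S) ℤ

/-- The subcomplex of `K` with terms `A n`. -/
def subCh {S : Type u} [CommRing S] (K : Ch S) (A : ∀ n : ℤ, Submodule S (K.X n))
    (hA : ∀ n m, A n ≤ (A m).comap (K.d n m).hom) : Ch S where
  X n := ModuleCat.of S (A n)
  d n m := ModuleCat.ofHom ((K.d n m).hom.restrict (hA n m))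
  shape n m h := by
    ext x
    have : K.d n m = 0 := K.shape n m h
    simp [LinearMap.restrict_apply, this]
  d_comp_d' i j k _ _ := by
    apply ModuleCat.hom_ext
    refine LinearMap.ext fun x => Subtype.ext ?_
    exact congrArg (fun f => f.hom x.1) (K.d_comp_d i j k)

/-- The quotient complex of `K` by the subcomplex with terms `A n`. -/
def quotCh {S : Type u} [CommRing S] (K : Ch S) (A : ∀ n : ℤ, Submodule S (K.X n))
    (hA : ∀ n m, A n ≤ (A m).comap (K.d n m).hom) : Ch S where
  X n := ModuleCat.of S (K.X n ⧸ A n)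
  d n m := ModuleCat.ofHom ((A n).mapQ (A m) (K.d n m).hom (hA n m))
  shape n m h := by
    have : K.d n m = 0 := K.shape n m h
    apply ModuleCat.hom_ext
    apply Submodule.linearMap_qext
    ext x
    simp [this]
  d_comp_d' i j k _ _ := by
    apply ModuleCat.hom_ext
    apply Submodule.linearMap_qext
    ext x
    have := congrArg (fun f => f.hom (x : K.X i)) (K.d_comp_d i j k)
    simp only [ModuleCat.hom_comp, LinearMap.comp_apply] at this
    simp [this]

/-- The map of subcomplexes induced by a map of complexes. -/
def subChMap {S : Type u} [CommRing S] {K L : Ch S} {A : ∀ n : ℤ, Submodule S (K.X n)}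
    {hA : ∀ n m, A n ≤ (A m).comap (K.d n m).hom} {B : ∀ n : ℤ, Submodule S (L.X n)}
    {hB : ∀ n m, B n ≤ (B m).comap (L.d n m).hom} (f : K ⟶ L)
    (hf : ∀ n, A n ≤ (B n).comap (f.f n).hom) : subCh K A hA ⟶ subCh L B hB where
  f n := ModuleCat.ofHom ((f.f n).hom.restrict (hf n))
  comm' n m _ := by
    apply ModuleCat.hom_ext
    refine LinearMap.ext fun x => Subtype.ext ?_
    exact congrArg (fun g => g.hom x.1) (f.comm n m)

/-- The map of quotient complexes induced by a map of complexes. -/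
def quotChMap {S : Type u} [CommRing S] {K L : Ch S} {A : ∀ n : ℤ, Submodule S (K.X n)}
    {hA : ∀ n m, A n ≤ (A m).comap (K.d n m).hom} {B : ∀ n : ℤ, Submodule S (L.X n)}
    {hB : ∀ n m, B n ≤ (B m).comap (L.d n m).hom} (f : K ⟶ L)
    (hf : ∀ n, A n ≤ (B n).comap (f.f n).hom) : quotCh K A hA ⟶ quotCh L B hB where
  f n := ModuleCat.ofHom ((A n).mapQ (B n) (f.f n).hom (hf n))
  comm' n m _ := by
    apply ModuleCat.hom_ext
    apply Submodule.linearMap_qext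
    ext x
    exact congrArg (fun g => (B m).mkQ (g.hom (x : K.X n))) (f.comm n m)

/-- A complex of `S`-modules with a decreasing filtration by subcomplexes `F^i`, `i ∈ ℤ`. -/
structure FiltCh (S : Type u) [CommRing S] where
  /-- the underlying complex -/
  K : Ch S
  /-- `F i n` is the degree `n` term of `F^i` -/
  F : ℤ → ∀ n : ℤ, Submodule S (K.X n)
  anti : ∀ i j n, i ≤ j → F j n ≤ F i n
  d_mem : ∀ i n m, F i n ≤ (F i m).comap (K.d n m).hom

namespace FiltCh

/-- Morphisms of filtered complexes. -/
@[ext]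
structure Hom {S : Type u} [CommRing S] (E E' : FiltCh S) where
  f : E.K ⟶ E'.K
  mem : ∀ i n, E.F i n ≤ (E'.F i n).comap (f.f n).hom

instance (S : Type u) [CommRing S] : Category (FiltCh S) where
  Hom := Hom
  id E := ⟨𝟙 _, fun i n x hx => by simpa using hx⟩
  comp f g := ⟨f.f ≫ g.f, fun i n x hx => by
    simpa using g.mem i n (f.mem i n hx)⟩

@[ext]
lemma hom_ext {S : Type u} [CommRing S] {E E' : FiltCh S} {f g : E ⟶ E'} (h : f.f = g.f) :
    f = g := Hom.ext h

@[simp] lemma id_f {S : Type u} [CommRing S] (E : FiltCh S) : Hom.f (𝟙 E) = 𝟙 E.K := rfl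

@[simp] lemma comp_f {S : Type u} [CommRing S] {E E' E'' : FiltCh S} (f : E ⟶ E') (g : E' ⟶ E'') :
    Hom.f (f ≫ g) = f.f ≫ g.f := rfl

/-- Forgetting the filtration. -/
@[simps]
def forget (S : Type u) [CommRing S] : FiltCh S ⥤ Ch S where
  obj E := E.K
  map f := f.f

/-- `τ^F_{≥ n} E_i = d⁻¹(F^{n+1-i} E_{i-1}) ∩ F^{n-i} E_i`, as a submodule of `E_i`. -/
def geSub {S : Type u} [CommRing S] (E : FiltCh S) (n i : ℤ) : Submodule S (E.K.X i) :=
  (E.F (n + 1 - i) (i - 1)).comap (E.K.d i (i - 1)).hom ⊓ E.F (n - i) i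

/-- `F^{n+1-i} E_i + d(F^{n-i} E_{i+1})`, the kernel of the projection `E_i → τ^F_{≤ n} E_i`. -/
def leSub {S : Type u} [CommRing S] (E : FiltCh S) (n i : ℤ) : Submodule S (E.K.X i) :=
  E.F (n + 1 - i) i ⊔ (E.F (n - i) (i + 1)).map (E.K.d (i + 1) i).hom

lemma geSub_d {S : Type u} [CommRing S] (E : FiltCh S) (n i j : ℤ) :
    E.geSub n i ≤ (E.geSub n j).comap (E.K.d i j).hom := by
  intro x hx
  by_cases h : j + 1 = i
  · obtain rfl : j = i - 1 := by omega
    refine ⟨?_, ?_⟩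
    · have := congrArg (fun f => f.hom x) (E.K.d_comp_d i (i - 1) (i - 1 - 1))
      change (E.K.d (i - 1) (i - 1 - 1)).hom ((E.K.d i (i - 1)).hom x) ∈
        E.F (n + 1 - (i - 1)) (i - 1 - 1)
      replace this : (E.K.d (i - 1) (i - 1 - 1)).hom ((E.K.d i (i - 1)).hom x) = 0 := this
      rw [this]
      exact zero_mem _
    · have := hx.1
      rw [show n + 1 - i = n - (i - 1) by ring] at this
      exact this
  · have : E.K.d i j = 0 := E.K.shape i j h
    simp [this]

lemma leSub_d {S : Type u} [CommRing S] (E : FiltCh S) (n i j : ℤ) :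
    E.leSub n i ≤ (E.leSub n j).comap (E.K.d i j).hom := by
  by_cases h : j + 1 = i
  · subst h
    refine sup_le ?_ ?_
    · intro x hx
      refine Submodule.mem_sup_right ⟨x, ?_, rfl⟩
      rw [show n + 1 - (j + 1) = n - j by ring] at hx
      exact hx
    · rintro _ ⟨x, hx, rfl⟩
      have : (E.K.d (j + 1) j).hom ((E.K.d (j + 1 + 1) (j + 1)).hom x) = 0 :=
        congrArg (fun f => f.hom x) (E.K.d_comp_d (j + 1 + 1) (j + 1) j)
      rw [Submodule.mem_comap, this]
      exact zero_mem _
  · have : E.K.d i j = 0 := E.K.shape i j h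
    intro x _
    simp [this]

lemma geSub_map {S : Type u} [CommRing S] {E E' : FiltCh S} (f : E ⟶ E') (n i : ℤ) :
    E.geSub n i ≤ (E'.geSub n i).comap (f.f.f i).hom := by
  intro x hx
  refine ⟨?_, f.mem _ _ hx.2⟩
  have := congrArg (fun g => g.hom x) (f.f.comm i (i - 1))
  simp only [ModuleCat.hom_comp, LinearMap.comp_apply] at this
  rw [SetLike.mem_coe, Submodule.mem_comap, this]
  exact f.mem _ _ hx.1

lemma leSub_map {S : Type u} [CommRing S] {E E' : FiltCh S} (f : E ⟶ E') (n i : ℤ) :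
    E.leSub n i ≤ (E'.leSub n i).comap (f.f.f i).hom := by
  refine sup_le (fun x hx => Submodule.mem_sup_left (f.mem _ _ hx)) ?_
  rintro _ ⟨x, hx, rfl⟩
  refine Submodule.mem_sup_right ⟨_, f.mem _ _ hx, ?_⟩
  have := congrArg (fun g => g.hom x) (f.f.comm (i + 1) i)
  simpa only [ModuleCat.hom_comp, LinearMap.comp_apply] using this

/-- The filtered truncation functor `τ^F_{≥ n}`. -/
def ge (S : Type u) [CommRing S] (n : ℤ) : FiltCh S ⥤ FiltCh S where
  obj E :=
    { K := subCh E.K (E.geSub n) (E.geSub_d n)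
      F := fun i m => (E.F i m).comap (E.geSub n m).subtype
      anti := fun i j m h x hx => E.anti i j m h hx
      d_mem := fun i n m x hx => E.d_mem i n m hx }
  map f := ⟨subChMap f.f (geSub_map f n), fun i m x hx => f.mem i m hx⟩

/-- The filtered truncation functor `τ^F_{≤ n}`. -/
def le (S : Type u) [CommRing S] (n : ℤ) : FiltCh S ⥤ FiltCh S where
  obj E :=
    { K := quotCh E.K (E.leSub n) (E.leSub_d n)
      F := fun i m => (E.F i m).map (E.leSub n m).mkQ
      anti := fun i j m h => Submodule.map_mono (E.anti i j m h)
      d_mem := by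
        rintro i n m _ ⟨x, hx, rfl⟩
        exact ⟨_, E.d_mem i n m hx, rfl⟩ }
  map f := ⟨quotChMap f.f (leSub_map f n), by
    rintro i m _ ⟨x, hx, rfl⟩
    exact ⟨_, f.mem i m hx, rfl⟩⟩
  map_id E := by
    apply hom_ext
    apply HomologicalComplex.hom_ext
    intro m
    apply ModuleCat.hom_ext
    apply Submodule.linearMap_qext
    rfl
  map_comp f g := by
    apply hom_ext
    apply HomologicalComplex.hom_ext
    intro m
    apply ModuleCat.hom_ext
    apply Submodule.linearMap_qext
    rfl

/-- `τ^F_{[0,1]} = τ^F_{≥ 0} τ^F_{≤ 1}`. -/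
def trunc01 (S : Type u) [CommRing S] : FiltCh S ⥤ FiltCh S := le S 1 ⋙ ge S 0

end FiltCh

/-! ### The `p`-th tensor power of a complex, with its cyclic permutation -/

section Tensor

/-- The total module `⨁ V_n` of a complex. -/
abbrev Tot {S : Type u} [CommRing S] (V : Ch S) : Type u := DirectSum ℤ fun n => V.X n

/-- The inclusion `V_n → ⨁ V_n`. -/
abbrev inc {S : Type u} [CommRing S] (V : Ch S) (n : ℤ) : V.X n →ₗ[S] Tot V :=
  DirectSum.lof S ℤ (fun n => V.X n) n

/-- The differential on the total module. -/
def dTot {S : Type u} [CommRing S] (V : Ch S) : Tot V →ₗ[S] Tot V :=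
  DirectSum.toModule S ℤ _ fun n => inc V (n - 1) ∘ₗ (V.d n (n - 1)).hom

/-- The sign operator `v ↦ (-1)^{|v|} v`. -/
def sgnTot {S : Type u} [CommRing S] (V : Ch S) : Tot V →ₗ[S] Tot V :=
  DirectSum.toModule S ℤ _ fun n => if Even n then inc V n else - inc V n

/-- The projection to the even part. -/
def evenTot {S : Type u} [CommRing S] (V : Ch S) : Tot V →ₗ[S] Tot V :=
  DirectSum.toModule S ℤ _ fun n => if Even n then inc V n else 0

/-- The projection to the odd part. -/
def oddTot {S : Type u} [CommRing S] (V : Ch S) : Tot V →ₗ[S] Tot V :=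
  DirectSum.toModule S ℤ _ fun n => if Even n then 0 else inc V n

/-- The map of total modules induced by a map of complexes. -/
def mapTot {S : Type u} [CommRing S] {V W : Ch S} (f : V ⟶ W) : Tot V →ₗ[S] Tot W :=
  DirectSum.toModule S ℤ _ fun n => inc W n ∘ₗ (f.f n).hom

section
variable {S : Type u} [CommRing S] (V W : Ch S)

lemma tot_ext {M : Type*} [AddCommMonoid M] [Module S M] {f g : Tot V →ₗ[S] M}
    (h : ∀ n (v : V.X n), f (inc V n v) = g (inc V n v)) : f = g :=
  DirectSum.linearMap_ext S fun n => LinearMap.ext fun v => h n v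

@[simp] lemma dTot_inc (n : ℤ) (v : V.X n) :
    dTot V (inc V n v) = inc V (n - 1) ((V.d n (n - 1)).hom v) := by
  simp [dTot, DirectSum.toModule_lof]

@[simp] lemma sgnTot_inc (n : ℤ) (v : V.X n) :
    sgnTot V (inc V n v) = if Even n then inc V n v else - inc V n v := by
  simp only [sgnTot, DirectSum.toModule_lof]; split_ifs <;> rfl

@[simp] lemma evenTot_inc (n : ℤ) (v : V.X n) :
    evenTot V (inc V n v) = if Even n then inc V n v else 0 := by
  simp only [evenTot, DirectSum.toModule_lof]; split_ifs <;> rfl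

@[simp] lemma oddTot_inc (n : ℤ) (v : V.X n) :
    oddTot V (inc V n v) = if Even n then 0 else inc V n v := by
  simp only [oddTot, DirectSum.toModule_lof]; split_ifs <;> rfl

@[simp] lemma mapTot_inc {V W : Ch S} (f : V ⟶ W) (n : ℤ) (v : V.X n) :
    mapTot f (inc V n v) = inc W n ((f.f n).hom v) := by
  simp [mapTot, DirectSum.toModule_lof]

lemma dTot_dTot : dTot V ∘ₗ dTot V = 0 := by
  apply tot_ext
  intro n v
  have : (V.d (n - 1) (n - 1 - 1)).hom ((V.d n (n - 1)).hom v) = 0 :=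
    congrArg (fun f => f.hom v) (V.d_comp_d n (n - 1) (n - 1 - 1))
  simp only [LinearMap.comp_apply, dTot_inc, this, map_zero, LinearMap.zero_apply]

lemma sgnTot_sgnTot : sgnTot V ∘ₗ sgnTot V = LinearMap.id := by
  apply tot_ext
  intro n v
  by_cases h : Even n <;> simp [h]

lemma sgnTot_dTot : sgnTot V ∘ₗ dTot V = - (dTot V ∘ₗ sgnTot V) := by
  apply tot_ext
  intro n v
  by_cases h : Even n <;> simp [h]

lemma evenTot_dTot : evenTot V ∘ₗ dTot V = dTot V ∘ₗ oddTot V := by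
  apply tot_ext
  intro n v
  by_cases h : Even n <;> simp [h]

lemma oddTot_dTot : oddTot V ∘ₗ dTot V = dTot V ∘ₗ evenTot V := by
  apply tot_ext
  intro n v
  by_cases h : Even n <;> simp [h]

lemma sgnTot_evenTot : sgnTot V ∘ₗ evenTot V = evenTot V := by
  apply tot_ext
  intro n v
  by_cases h : Even n <;> simp [h]

lemma sgnTot_oddTot : sgnTot V ∘ₗ oddTot V = - oddTot V := by
  apply tot_ext
  intro n v
  by_cases h : Even n <;> simp [h]

lemma evenTot_sgnTot : evenTot V ∘ₗ sgnTot V = evenTot V := by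
  apply tot_ext
  intro n v
  by_cases h : Even n <;> simp [h]

lemma oddTot_sgnTot : oddTot V ∘ₗ sgnTot V = - oddTot V := by
  apply tot_ext
  intro n v
  by_cases h : Even n <;> simp [h]

variable {V W}

lemma mapTot_dTot (f : V ⟶ W) : mapTot f ∘ₗ dTot V = dTot W ∘ₗ mapTot f := by
  apply tot_ext
  intro n v
  have : (f.f (n - 1)).hom ((V.d n (n - 1)).hom v) = (W.d n (n - 1)).hom ((f.f n).hom v) :=
    congrArg (fun g => g.hom v) (f.comm n (n - 1)).symm
  simp only [LinearMap.comp_apply, dTot_inc, mapTot_inc, this]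

lemma mapTot_sgnTot (f : V ⟶ W) : mapTot f ∘ₗ sgnTot V = sgnTot W ∘ₗ mapTot f := by
  apply tot_ext
  intro n v
  by_cases h : Even n <;> simp [h]

lemma mapTot_evenTot (f : V ⟶ W) : mapTot f ∘ₗ evenTot V = evenTot W ∘ₗ mapTot f := by
  apply tot_ext
  intro n v
  by_cases h : Even n <;> simp [h]

lemma mapTot_oddTot (f : V ⟶ W) : mapTot f ∘ₗ oddTot V = oddTot W ∘ₗ mapTot f := by
  apply tot_ext
  intro n v
  by_cases h : Even n <;> simp [h]

lemma mapTot_surjective (f : V ⟶ W) (hf : ∀ n, Function.Surjective (f.f n).hom) :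
    Function.Surjective (mapTot f) := by
  intro w
  induction w using DirectSum.induction_on with
  | zero => exact ⟨0, map_zero _⟩
  | of n w =>
    obtain ⟨v, rfl⟩ := hf n w
    exact ⟨inc V n v, mapTot_inc f n v⟩
  | add x y hx hy =>
    obtain ⟨a, rfl⟩ := hx
    obtain ⟨b, rfl⟩ := hy
    exact ⟨a + b, map_add _ _ _⟩

end

/-- The `p`-fold tensor power over `S` of the total module of `V`. -/
def TensPow (p : ℕ) {S : Type u} [CommRing S] (V : Ch S) : Type u :=
  PiTensorProduct S fun _ : Fin p => Tot V

instance (p : ℕ) {S : Type u} [CommRing S] (V : Ch S) : AddCommGroup (TensPow p V) :=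
  inferInstanceAs (AddCommGroup (PiTensorProduct S fun _ : Fin p => Tot V))

instance (p : ℕ) {S : Type u} [CommRing S] (V : Ch S) : Module S (TensPow p V) :=
  inferInstanceAs (Module S (PiTensorProduct S fun _ : Fin p => Tot V))

/-- The pure tensor `v_0 ⊗ ⋯ ⊗ v_{p-1}`. -/
def pureTens (p : ℕ) {S : Type u} [CommRing S] (V : Ch S) :
    MultilinearMap S (fun _ : Fin p => Tot V) (TensPow p V) :=
  PiTensorProduct.tprod S

/-- `f_0 ⊗ ⋯ ⊗ f_{p-1}`. -/
def mapTens (p : ℕ) {S : Type u} [CommRing S] {V W : Ch S} (f : Fin p → Tot V →ₗ[S] Tot W) :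
    TensPow p V →ₗ[S] TensPow p W :=
  PiTensorProduct.map f

/-- `V^{⊗ p}` in degree `j`: spanned by `v_0 ⊗ ⋯ ⊗ v_{p-1}` with `v_t` homogeneous and
`|v_0| + ⋯ + |v_{p-1}| = j`. -/
def degTens (p : ℕ) {S : Type u} [CommRing S] (V : Ch S) (j : ℤ) : Submodule S (TensPow p V) :=
  Submodule.span S {x | ∃ (k : Fin p → ℤ) (v : ∀ t, V.X (k t)), ∑ t, k t = j ∧
    pureTens p V (fun t => inc V (k t) (v t)) = x}

/-- The differential on `V^{⊗ p}`:
`d(v_0 ⊗ ⋯ ⊗ v_{p-1}) = ∑_t (-1)^{|v_0| + ⋯ + |v_{t-1}|} v_0 ⊗ ⋯ ⊗ d v_t ⊗ ⋯ ⊗ v_{p-1}`. -/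
def dTens (p : ℕ) {S : Type u} [CommRing S] (V : Ch S) : TensPow p V →ₗ[S] TensPow p V :=
  ∑ t : Fin p, mapTens p fun s =>
    if s < t then sgnTot V else if s = t then dTot V else LinearMap.id

/-- The sign operator `x ↦ (-1)^{|x|} x` on `V^{⊗ p}`. -/
def sgnTens (p : ℕ) {S : Type u} [CommRing S] (V : Ch S) : TensPow p V →ₗ[S] TensPow p V :=
  mapTens p fun _ => sgnTot V

/-- The cyclic permutation without signs, `v_0 ⊗ ⋯ ⊗ v_{p-1} ↦ v_{p-1} ⊗ v_0 ⊗ ⋯ ⊗ v_{p-2}`. -/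
def reTens (p : ℕ) {S : Type u} [CommRing S] (V : Ch S) : TensPow p V →ₗ[S] TensPow p V :=
  (PiTensorProduct.reindex S (fun _ : Fin p => Tot V) (finRotate p)).toLinearMap

/-- The cyclic permutation with Koszul sign,
`σ(v_0 ⊗ ⋯ ⊗ v_{p-1}) = (-1)^{|v_{p-1}| (|v_0| + ⋯ + |v_{p-2}|)} v_{p-1} ⊗ v_0 ⊗ ⋯ ⊗ v_{p-2}`:
there is no sign if `v_{p-1}` is even, and the sign operator is applied to the other factors if
`v_{p-1}` is odd. -/
def rotTens (p : ℕ) {S : Type u} [CommRing S] (V : Ch S) : TensPow p V →ₗ[S] TensPow p V :=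
  reTens p V ∘ₗ
    ((mapTens p fun s => if (s : ℕ) + 1 = p then evenTot V else LinearMap.id) +
      mapTens p fun s => if (s : ℕ) + 1 = p then oddTot V else sgnTot V)

section
variable {p : ℕ} {S : Type u} [CommRing S] {V W U : Ch S}

@[simp] lemma mapTens_pure (f : Fin p → Tot V →ₗ[S] Tot W) (v : Fin p → Tot V) :
    mapTens p f (pureTens p V v) = pureTens p W fun t => f t (v t) :=
  PiTensorProduct.map_tprod f v

lemma tens_ext {M : Type*} [AddCommMonoid M] [Module S M] {f g : TensPow p V →ₗ[S] M}
    (h : ∀ v, f (pureTens p V v) = g (pureTens p V v)) : f = g :=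
  PiTensorProduct.ext (MultilinearMap.ext h)

lemma mapTens_comp (g : Fin p → Tot W →ₗ[S] Tot U) (f : Fin p → Tot V →ₗ[S] Tot W) :
    mapTens p g ∘ₗ mapTens p f = mapTens p fun t => g t ∘ₗ f t :=
  tens_ext fun v => by simp

@[simp] lemma reTens_pure (v : Fin p → Tot V) :
    reTens p V (pureTens p V v) = pureTens p V fun t => v ((finRotate p).symm t) :=
  PiTensorProduct.reindex_tprod _ _

lemma comp_sum_aux {A B C : Type*} [AddCommGroup A] [AddCommGroup B] [AddCommGroup C] [Module S A]
    [Module S B] [Module S C] (g : B →ₗ[S] C) (f : Fin p → A →ₗ[S] B) :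
    g ∘ₗ (∑ t, f t) = ∑ t, g ∘ₗ f t :=
  LinearMap.ext fun x => by simp

lemma sum_comp_aux {A B C : Type*} [AddCommGroup A] [AddCommGroup B] [AddCommGroup C] [Module S A]
    [Module S B] [Module S C] (g : A →ₗ[S] B) (f : Fin p → B →ₗ[S] C) :
    (∑ t, f t) ∘ₗ g = ∑ t, f t ∘ₗ g :=
  LinearMap.ext fun x => by simp

lemma mapTens_neg (f g : Fin p → Tot V →ₗ[S] Tot W) (s : Fin p) (hs : f s = - g s)
    (h : ∀ t, t ≠ s → f t = g t) : mapTens p f = - mapTens p g := by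
  apply tens_ext
  intro v
  rw [mapTens_pure, LinearMap.neg_apply, mapTens_pure]
  have : (fun t => f t (v t)) = Function.update (fun t => g t (v t)) s (-(g s (v s))) := by
    funext t
    by_cases ht : t = s
    · subst ht; simp [hs]
    · simp [ht, h t ht]
  rw [this, MultilinearMap.map_update_neg, Function.update_eq_self]

lemma mapTens_rot (f : Fin p → Tot V →ₗ[S] Tot W) :
    mapTens p f ∘ₗ reTens p V = reTens p W ∘ₗ mapTens p fun s => f (finRotate p s) :=
  tens_ext fun v => by simp [-finRotate_apply, -finRotate_symm_apply]

lemma val_finRotate (s : Fin p) :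
    (finRotate p s : ℕ) = if (s : ℕ) + 1 = p then 0 else (s : ℕ) + 1 := by
  obtain _ | n := p
  · exact s.elim0
  · rw [coe_finRotate]
    simp [Fin.ext_iff]

lemma dTens_dTens : dTens p V ∘ₗ dTens p V = 0 := by
  have key : ∀ s t : Fin p, s < t →
      (mapTens p fun r => if r < s then sgnTot V else if r = s then dTot V else LinearMap.id) ∘ₗ
      (mapTens p fun r => if r < t then sgnTot V else if r = t then dTot V else LinearMap.id) =
      - ((mapTens p fun r => if r < t then sgnTot V else if r = t then dTot V else LinearMap.id) ∘ₗ
      (mapTens p fun r => if r < s then sgnTot V else if r = s then dTot V else LinearMap.id)) := by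
    intro s t hst
    rw [mapTens_comp, mapTens_comp]
    apply mapTens_neg _ _ s
    · simp [hst, sgnTot_dTot]
    · intro r hr
      rcases lt_trichotomy r s with h | h | h
      · simp [h, h.trans hst]
      · exact absurd h hr
      · simp [hr, h.not_gt]
  have diag : ∀ t : Fin p,
      (mapTens p fun r => if r < t then sgnTot V else if r = t then dTot V else LinearMap.id) ∘ₗ
      (mapTens p fun r => if r < t then sgnTot V else if r = t then dTot V else LinearMap.id)
        = 0 := by
    intro t
    rw [mapTens_comp]
    apply tens_ext
    intro v
    rw [mapTens_pure]
    refine (pureTens p V).map_coord_zero t ?_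
    simpa using congrArg (fun f => f (v t)) (dTot_dTot V)
  have e : dTens p V ∘ₗ dTens p V = ∑ x : Fin p × Fin p,
      (mapTens p fun r => if r < x.1 then sgnTot V else if r = x.1 then dTot V
        else LinearMap.id) ∘ₗ
      (mapTens p fun r => if r < x.2 then sgnTot V else if r = x.2 then dTot V
        else LinearMap.id) := by
    rw [Fintype.sum_prod_type]
    apply LinearMap.ext
    intro x
    simp only [dTens, LinearMap.comp_apply, LinearMap.sum_apply, map_sum]
    rw [Finset.sum_comm]
  rw [e]
  refine Finset.sum_involution (fun x _ => (x.2, x.1)) ?_ ?_ (fun _ _ => Finset.mem_univ _)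
    (fun _ _ => rfl)
  · rintro ⟨s, t⟩ -
    rcases lt_trichotomy s t with h | h | h
    · simp [key s t h]
    · subst h; simp [diag]
    · simp [key t s h]
  · rintro ⟨s, t⟩ - h h'
    obtain rfl : t = s := congrArg Prod.fst h'
    exact h (diag t)

lemma sgnTens_sgnTens : sgnTens p V ∘ₗ sgnTens p V = LinearMap.id := by
  rw [sgnTens, mapTens_comp]
  apply tens_ext
  intro v
  simp [sgnTot_sgnTot]

lemma sgnTens_dTens : sgnTens p V ∘ₗ dTens p V = - (dTens p V ∘ₗ sgnTens p V) := by
  simp only [dTens, comp_sum_aux, sum_comp_aux, ← Finset.sum_neg_distrib]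
  refine Finset.sum_congr rfl fun t _ => ?_
  rw [sgnTens, mapTens_comp, mapTens_comp]
  apply mapTens_neg _ _ t
  · simp [sgnTot_dTot]
  · intro r hr
    rcases lt_trichotomy r t with h | h | h
    · simp [h]
    · exact absurd h hr
    · simp [hr, h.not_gt]

lemma sgnTens_rotTens : sgnTens p V ∘ₗ rotTens p V = rotTens p V ∘ₗ sgnTens p V := by
  rw [sgnTens, rotTens, ← LinearMap.comp_assoc, mapTens_rot, LinearMap.comp_assoc,
    LinearMap.comp_assoc, LinearMap.comp_add, LinearMap.add_comp]
  simp only [mapTens_comp]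
  congr 3
  · funext s
    split_ifs
    · rw [sgnTot_evenTot, evenTot_sgnTot]
    · simp
  · funext s
    split_ifs
    · rw [sgnTot_oddTot, oddTot_sgnTot]
    · rfl

lemma dTens_rotTens : dTens p V ∘ₗ rotTens p V = rotTens p V ∘ₗ dTens p V := by
  have e : dTens p V = ∑ t : Fin p, mapTens p fun s =>
      if s < finRotate p t then sgnTot V else if s = finRotate p t then dTot V
        else LinearMap.id := by
    rw [dTens]
    exact (Equiv.sum_comp (finRotate p) fun t => mapTens p fun s =>
      if s < t then sgnTot V else if s = t then dTot V else LinearMap.id).symm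
  conv_lhs => rw [e]
  rw [dTens, sum_comp_aux, comp_sum_aux]
  refine Finset.sum_congr rfl fun t _ => ?_
  rw [rotTens, ← LinearMap.comp_assoc, mapTens_rot, LinearMap.comp_assoc, LinearMap.comp_assoc]
  congr 1
  rw [LinearMap.comp_add, LinearMap.add_comp]
  simp only [mapTens_comp, Equiv.apply_eq_iff_eq]
  by_cases ht : (t : ℕ) + 1 = p
  · rw [add_comm]
    congr 1
    · congr 1
      funext s
      by_cases hs : (s : ℕ) + 1 = p
      · obtain rfl : s = t := Fin.ext (by omega)
        simp [-finRotate_apply, hs, evenTot_dTot]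
      · have h1 : s < t := Fin.lt_def.2 (by have := s.2; omega)
        have h2 : ¬ finRotate p s < finRotate p t := by
          rw [Fin.lt_def, val_finRotate, val_finRotate]; simp [-finRotate_apply, ht]
        simp [-finRotate_apply, hs, h1, h2, h1.ne]
    · congr 1
      funext s
      by_cases hs : (s : ℕ) + 1 = p
      · obtain rfl : s = t := Fin.ext (by omega)
        simp [-finRotate_apply, hs, oddTot_dTot]
      · have h1 : s < t := Fin.lt_def.2 (by have := s.2; omega)
        have h2 : ¬ finRotate p s < finRotate p t := by
          rw [Fin.lt_def, val_finRotate, val_finRotate]; simp [-finRotate_apply, ht]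
        simp [-finRotate_apply, hs, h1, h2, h1.ne, sgnTot_sgnTot]
  · congr 1
    · congr 1
      funext s
      by_cases hs : (s : ℕ) + 1 = p
      · have h1 : ¬ s < t := by rw [Fin.lt_def]; have := t.2; omega
        have h0 : s ≠ t := by rintro rfl; exact ht hs
        have h2 : finRotate p s < finRotate p t := by
          rw [Fin.lt_def, val_finRotate, val_finRotate]; simp [-finRotate_apply, ht, hs]
        simp [-finRotate_apply, hs, h1, h2, h0, sgnTot_evenTot]
      · have h2 : finRotate p s < finRotate p t ↔ s < t := by
          rw [Fin.lt_def, val_finRotate, val_finRotate, Fin.lt_def]; simp [-finRotate_apply, ht, hs]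
        simp [-finRotate_apply, hs, h2]
    · have htp : ∃ l : Fin p, (l : ℕ) + 1 = p := ⟨⟨p - 1, by have := t.2; omega⟩, by
        have := t.2; simp only; omega⟩
      obtain ⟨l, hl⟩ := htp
      have h1 : ¬ l < t := by rw [Fin.lt_def]; have := t.2; omega
      have h0 : l ≠ t := by rintro rfl; exact ht hl
      have h2 : finRotate p l < finRotate p t := by
        rw [Fin.lt_def, val_finRotate, val_finRotate]; simp [-finRotate_apply, ht, hl]
      have h3 : ∀ s : Fin p, s ≠ l → (s : ℕ) + 1 ≠ p := fun s hs h =>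
        hs (Fin.ext (by omega))
      have h4 : ∀ s : Fin p, s ≠ l → (finRotate p s < finRotate p t ↔ s < t) := by
        intro s hs
        rw [Fin.lt_def, val_finRotate, val_finRotate, Fin.lt_def]; simp [-finRotate_apply, ht, h3 s hs]
      rw [mapTens_neg _ (fun s => if s = l then oddTot V else
        if s < t then LinearMap.id else if s = t then dTot V ∘ₗ sgnTot V else sgnTot V) l,
        eq_comm, mapTens_neg _ (fun s => if s = l then oddTot V else
        if s < t then LinearMap.id else if s = t then dTot V ∘ₗ sgnTot V else sgnTot V) t]
      · simp [-finRotate_apply, ht, h0.symm, sgnTot_dTot]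
      · intro s hs
        by_cases hsl : s = l
        · subst hsl; simp [-finRotate_apply, hl, h1, h0]
        · by_cases hst : s < t
          · simp [-finRotate_apply, h3 s hsl, hsl, hst, sgnTot_sgnTot]
          · simp [-finRotate_apply, h3 s hsl, hsl, hst, hs]
      · simp [-finRotate_apply, hl, h2, sgnTot_oddTot]
      · intro s hs
        by_cases hst : s < t
        · simp [-finRotate_apply, h3 s hs, hs, hst, h4 s hs, sgnTot_sgnTot]
        · by_cases hst' : s = t
          · subst hst'; simp [-finRotate_apply, ht, hs]
          · simp [-finRotate_apply, h3 s hs, hs, hst, hst', h4 s hs]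

/-! #### Degrees -/

lemma pure_mem_degTens {j : ℤ} (k : Fin p → ℤ) (hk : ∑ t, k t = j) (w : Fin p → Tot V)
    (hw : ∀ t, ∃ v, inc V (k t) v = w t) : pureTens p V w ∈ degTens p V j := by
  choose v hv using hw
  exact Submodule.subset_span ⟨k, v, hk, by congr 1; funext t; exact hv t⟩

lemma sgnTot_inc_mem (n : ℤ) (v : V.X n) : ∃ w, inc V n w = sgnTot V (inc V n v) := by
  by_cases h : Even n
  · exact ⟨v, by simp [h]⟩
  · exact ⟨-v, by simp [h]⟩

lemma inc_congr {n m : ℤ} (h : n = m) {x : Tot V} (hx : ∃ v, inc V m v = x) :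
    ∃ v, inc V n v = x := by
  subst h; exact hx

lemma dTens_deg (j : ℤ) : degTens p V j ≤ (degTens p V (j - 1)).comap (dTens p V) := by
  refine Submodule.span_le.2 ?_
  rintro _ ⟨k, v, rfl, rfl⟩
  simp only [dTens, SetLike.mem_coe, Submodule.mem_comap, LinearMap.sum_apply, mapTens_pure]
  refine sum_mem fun t _ => ?_
  refine pure_mem_degTens (Function.update k t (k t - 1)) ?_ _ ?_
  · rw [Finset.sum_update_of_mem (Finset.mem_univ t),
      ← Finset.add_sum_erase Finset.univ k (Finset.mem_univ t), Finset.sdiff_singleton_eq_erase]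
    ring
  · intro s
    rcases lt_trichotomy s t with h | h | h
    · refine inc_congr (Function.update_of_ne h.ne _ _) ?_
      simpa only [h, if_true] using sgnTot_inc_mem (k s) (v s)
    · subst h
      refine inc_congr (Function.update_self _ _ _) ?_
      simp only [lt_irrefl, if_false, if_true, dTot_inc]
      exact ⟨_, rfl⟩
    · refine inc_congr (Function.update_of_ne h.ne' _ _) ?_
      simp only [h.not_gt, h.ne', if_false]
      exact ⟨_, rfl⟩

lemma sgnTens_deg (j : ℤ) : degTens p V j ≤ (degTens p V j).comap (sgnTens p V) := by
  refine Submodule.span_le.2 ?_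
  rintro _ ⟨k, v, rfl, rfl⟩
  simp only [sgnTens, SetLike.mem_coe, Submodule.mem_comap, mapTens_pure]
  exact pure_mem_degTens k rfl _ fun t => sgnTot_inc_mem (k t) (v t)

end

/-- Maps of `p`-fold tensor powers that respect the grading, the differential and the cyclic
permutation. -/
@[ext]
structure TensHom (p : ℕ) {S : Type u} [CommRing S] (V W : Ch S) where
  /-- the underlying linear map -/
  toLin : TensPow p V →ₗ[S] TensPow p W
  deg : ∀ j, degTens p V j ≤ (degTens p W j).comap toLin
  comm_d : toLin ∘ₗ dTens p V = dTens p W ∘ₗ toLin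
  comm_sgn : toLin ∘ₗ sgnTens p V = sgnTens p W ∘ₗ toLin
  comm_rot : toLin ∘ₗ rotTens p V = rotTens p W ∘ₗ toLin

section
variable {p : ℕ} {S : Type u} [CommRing S] {V W U : Ch S}

/-- The identity. -/
@[simps]
def TensHom.id (p : ℕ) {S : Type u} [CommRing S] (V : Ch S) : TensHom p V V :=
  ⟨LinearMap.id, fun _ => le_rfl, rfl, rfl, rfl⟩

/-- Composition. -/
@[simps]
def TensHom.comp (f : TensHom p V W) (g : TensHom p W U) : TensHom p V U where
  toLin := g.toLin ∘ₗ f.toLin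
  deg j x hx := g.deg j (f.deg j hx)
  comm_d := by rw [LinearMap.comp_assoc, f.comm_d, ← LinearMap.comp_assoc, g.comm_d]; rfl
  comm_sgn := by rw [LinearMap.comp_assoc, f.comm_sgn, ← LinearMap.comp_assoc, g.comm_sgn]; rfl
  comm_rot := by rw [LinearMap.comp_assoc, f.comm_rot, ← LinearMap.comp_assoc, g.comm_rot]; rfl

lemma mapTens_comm (f : Tot V →ₗ[S] Tot W) (g : Fin p → Tot V →ₗ[S] Tot V)
    (g' : Fin p → Tot W →ₗ[S] Tot W) (h : ∀ t, f ∘ₗ g t = g' t ∘ₗ f) :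
    (mapTens p fun _ => f) ∘ₗ mapTens p g = mapTens p g' ∘ₗ mapTens p fun _ => f := by
  rw [mapTens_comp, mapTens_comp]
  congr 1
  funext t
  exact h t

/-- `f^{⊗ p}` for a map of complexes `f`. -/
@[simps]
def TensHom.ofMap (p : ℕ) {S : Type u} [CommRing S] {V W : Ch S} (f : V ⟶ W) : TensHom p V W where
  toLin := mapTens p fun _ => mapTot f
  deg j := by
    refine Submodule.span_le.2 ?_
    rintro _ ⟨k, v, rfl, rfl⟩
    simp only [SetLike.mem_coe, Submodule.mem_comap, mapTens_pure]
    exact pure_mem_degTens k rfl _ fun t => ⟨_, (mapTot_inc f _ _).symm⟩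
  comm_d := by
    rw [dTens, dTens, comp_sum_aux, sum_comp_aux]
    refine Finset.sum_congr rfl fun t _ => mapTens_comm _ _ _ fun s => ?_
    split_ifs
    · exact mapTot_sgnTot f
    · exact mapTot_dTot f
    · rfl
  comm_sgn := mapTens_comm _ _ _ fun _ => mapTot_sgnTot f
  comm_rot := by
    rw [rotTens, rotTens, ← LinearMap.comp_assoc, mapTens_rot, LinearMap.comp_assoc,
      LinearMap.comp_assoc, LinearMap.comp_add, LinearMap.add_comp]
    congr 2
    · refine mapTens_comm _ _ _ fun s => ?_
      split_ifs
      · exact mapTot_evenTot f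
      · rfl
    · refine mapTens_comm _ _ _ fun s => ?_
      split_ifs
      · exact mapTot_oddTot f
      · exact mapTot_sgnTot f

lemma mapTot_id : mapTot (𝟙 V) = LinearMap.id := tot_ext _ fun n v => by simp

lemma mapTot_comp (f : V ⟶ W) (g : W ⟶ U) : mapTot (f ≫ g) = mapTot g ∘ₗ mapTot f :=
  tot_ext _ fun n v => by simp

lemma TensHom.ofMap_id : TensHom.ofMap p (𝟙 V) = TensHom.id p V := by
  apply TensHom.ext
  apply tens_ext
  intro v
  simp [mapTot_id]

lemma TensHom.ofMap_comp (f : V ⟶ W) (g : W ⟶ U) :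
    TensHom.ofMap p (f ≫ g) = (TensHom.ofMap p f).comp (TensHom.ofMap p g) := by
  apply TensHom.ext
  apply tens_ext
  intro v
  simp [mapTot_comp]

/-! #### Multiplication by `p` as a map `V^{⊗ p}/p → V^{⊗ p}` -/

/-- A map of complexes that looks like a quotient map `V → V/p`, in the weak sense needed below:
it is surjective, and `p` kills its kernel. -/
structure IsPQuot (p : ℕ) {S : Type u} [CommRing S] {V W : Ch S} (η : V ⟶ W) : Prop where
  surj : ∀ n, Function.Surjective (η.f n).hom
  ker : ∀ n (v : V.X n), (η.f n).hom v = 0 → (p : S) • v = 0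

lemma mapTot_apply (f : V ⟶ W) (x : Tot V) (n : ℤ) : mapTot f x n = (f.f n).hom (x n) := by
  induction x using DirectSum.induction_on with
  | zero => simp
  | of m v =>
    change mapTot f (inc V m v) n = (f.f n).hom (inc V m v n)
    rw [mapTot_inc]
    by_cases h : m = n
    · subst h
      rw [DirectSum.lof_apply, DirectSum.lof_apply]
    · rw [DirectSum.lof_eq_of, DirectSum.lof_eq_of, DirectSum.of_eq_of_ne _ _ _ (Ne.symm h),
        DirectSum.of_eq_of_ne _ _ _ (Ne.symm h), map_zero]
  | add x y hx hy => simp only [map_add, DirectSum.add_apply, hx, hy]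

lemma IsPQuot.ker_tot {η : V ⟶ W} (h : IsPQuot p η) (x : Tot V) (hx : mapTot η x = 0) :
    (p : S) • x = 0 := by
  refine DFinsupp.ext fun n => ?_
  refine h.ker n (x n) ?_
  rw [← mapTot_apply, hx]
  rfl

lemma IsPQuot.smul_update {η : V ⟶ W} (h : IsPQuot p η) (v : Fin p → Tot V) (t : Fin p)
    (x y : Tot V) (hxy : mapTot η x = mapTot η y) :
    (p : S) • pureTens p V (Function.update v t x) =
      (p : S) • pureTens p V (Function.update v t y) := by
  rw [← MultilinearMap.map_update_smul, ← MultilinearMap.map_update_smul, ← sub_eq_zero,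
    ← MultilinearMap.map_update_sub, ← smul_sub, h.ker_tot (x - y) (by rw [map_sub, hxy, sub_self])]
  exact (pureTens p V).map_coord_zero t (by simp)

lemma IsPQuot.smul_congr {η : V ⟶ W} (h : IsPQuot p η) (v w : Fin p → Tot V)
    (hvw : ∀ t, mapTot η (v t) = mapTot η (w t)) :
    (p : S) • pureTens p V v = (p : S) • pureTens p V w := by
  have key : ∀ s : Finset (Fin p),
      (p : S) • pureTens p V (s.piecewise w v) = (p : S) • pureTens p V v := by
    intro s
    induction s using Finset.induction_on with
    | empty => simp
    | insert j s hj ih =>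
      rw [Finset.piecewise_insert, ← ih]
      conv_rhs => rw [← Function.update_eq_self j (s.piecewise w v)]
      refine h.smul_update _ _ _ _ ?_
      rw [Finset.piecewise_eq_of_notMem _ _ _ hj, hvw]
  have := key Finset.univ
  rw [Finset.piecewise_univ] at this
  exact this.symm

/-- A set-theoretic section of `mapTot η`. -/
def IsPQuot.sec {η : V ⟶ W} (h : IsPQuot p η) : Tot W → Tot V :=
  Function.surjInv (mapTot_surjective η h.surj)

lemma IsPQuot.mapTot_sec {η : V ⟶ W} (h : IsPQuot p η) (w : Tot W) :
    mapTot η (h.sec w) = w := Function.surjInv_eq _ w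

/-- The multilinear map underlying `IsPQuot.pLin`. -/
def IsPQuot.pMulti {η : V ⟶ W} (h : IsPQuot p η) :
    MultilinearMap S (fun _ : Fin p => Tot W) (TensPow p V) where
  toFun w := (p : S) • pureTens p V fun t => h.sec (w t)
  map_update_add' := by
    intro _ w t x y
    obtain rfl : ‹DecidableEq (Fin p)› = instDecidableEqFin p := Subsingleton.elim _ _
    have key : ∀ (z : Tot W) (z' : Tot V), mapTot η z' = z →
        (p : S) • pureTens p V (fun s => h.sec (Function.update w t z s)) =
        (p : S) • pureTens p V (Function.update (fun s => h.sec (w s)) t z') := by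
      intro z z' hz
      refine h.smul_congr _ _ fun s => ?_
      by_cases hs : s = t
      · subst hs; simp [h.mapTot_sec, hz]
      · simp [hs, h.mapTot_sec]
    rw [key _ (h.sec x + h.sec y) (by simp [h.mapTot_sec]), key _ _ (h.mapTot_sec x),
      key _ _ (h.mapTot_sec y), MultilinearMap.map_update_add, smul_add]
  map_update_smul' := by
    intro _ w t c x
    obtain rfl : ‹DecidableEq (Fin p)› = instDecidableEqFin p := Subsingleton.elim _ _
    have key : ∀ (z : Tot W) (z' : Tot V), mapTot η z' = z →
        (p : S) • pureTens p V (fun s => h.sec (Function.update w t z s)) =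
        (p : S) • pureTens p V (Function.update (fun s => h.sec (w s)) t z') := by
      intro z z' hz
      refine h.smul_congr _ _ fun s => ?_
      by_cases hs : s = t
      · subst hs; simp [h.mapTot_sec, hz]
      · simp [hs, h.mapTot_sec]
    rw [key _ (c • h.sec x) (by simp [h.mapTot_sec]), key _ _ (h.mapTot_sec x),
      MultilinearMap.map_update_smul, smul_comm]

/-- The map `η(v_0) ⊗ ⋯ ⊗ η(v_{p-1}) ↦ p (v_0 ⊗ ⋯ ⊗ v_{p-1})`. -/
def IsPQuot.pLin {η : V ⟶ W} (h : IsPQuot p η) : TensPow p W →ₗ[S] TensPow p V :=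
  PiTensorProduct.lift h.pMulti

lemma IsPQuot.pLin_comp {η : V ⟶ W} (h : IsPQuot p η) :
    h.pLin ∘ₗ (TensHom.ofMap p η).toLin = (p : S) • LinearMap.id := by
  apply tens_ext
  intro v
  simp only [TensHom.ofMap_toLin, LinearMap.comp_apply, mapTens_pure, LinearMap.smul_apply,
    LinearMap.id_apply]
  refine (PiTensorProduct.lift.tprod _).trans ?_
  exact h.smul_congr _ _ fun t => h.mapTot_sec _

lemma IsPQuot.tens_surj {η : V ⟶ W} (h : IsPQuot p η) :
    Function.Surjective (TensHom.ofMap p η).toLin := by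
  rw [← LinearMap.range_eq_top, eq_top_iff]
  have : Submodule.span S (Set.range (pureTens p W)) = ⊤ := PiTensorProduct.span_tprod_eq_top
  rw [← this, Submodule.span_le]
  rintro _ ⟨w, rfl⟩
  exact ⟨pureTens p V fun t => h.sec (w t), by simp [h.mapTot_sec]⟩

lemma IsPQuot.cancel {η : V ⟶ W} (h : IsPQuot p η) {M : Type*} [AddCommGroup M] [Module S M]
    {f g : TensPow p W →ₗ[S] M}
    (hfg : f ∘ₗ (TensHom.ofMap p η).toLin = g ∘ₗ (TensHom.ofMap p η).toLin) : f = g :=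
  LinearMap.ext fun x => by
    obtain ⟨y, rfl⟩ := h.tens_surj x
    exact congrArg (fun f => f y) hfg

/-- Multiplication by `p`, as a map `(V/p)^{⊗ p} = V^{⊗ p}/p → V^{⊗ p}`. -/
@[simps]
def IsPQuot.pHom {η : V ⟶ W} (h : IsPQuot p η) : TensHom p W V where
  toLin := h.pLin
  deg j := by
    refine Submodule.span_le.2 ?_
    rintro _ ⟨k, w, rfl, rfl⟩
    choose v hv using fun t => h.surj (k t) (w t)
    have e : pureTens p W (fun t => inc W (k t) (w t)) =
        (TensHom.ofMap p η).toLin (pureTens p V fun t => inc V (k t) (v t)) := by simp [hv]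
    have e' := congrArg (fun f => f (pureTens p V fun t => inc V (k t) (v t))) h.pLin_comp
    rw [SetLike.mem_coe, Submodule.mem_comap, e]
    simp only [LinearMap.comp_apply] at e'
    rw [e']
    exact Submodule.smul_mem _ _ (pure_mem_degTens k rfl _ fun t => ⟨_, rfl⟩)
  comm_d := h.cancel <| by
    rw [LinearMap.comp_assoc, ← (TensHom.ofMap p η).comm_d, ← LinearMap.comp_assoc, h.pLin_comp,
      LinearMap.comp_assoc, h.pLin_comp]
    ext; simp
  comm_sgn := h.cancel <| by
    rw [LinearMap.comp_assoc, ← (TensHom.ofMap p η).comm_sgn, ← LinearMap.comp_assoc, h.pLin_comp,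
      LinearMap.comp_assoc, h.pLin_comp]
    ext; simp
  comm_rot := h.cancel <| by
    rw [LinearMap.comp_assoc, ← (TensHom.ofMap p η).comm_rot, ← LinearMap.comp_assoc, h.pLin_comp,
      LinearMap.comp_assoc, h.pLin_comp]
    ext; simp

lemma IsPQuot.pHom_natural {V' W' : Ch S} {η : V ⟶ W} {η' : V' ⟶ W'} (h : IsPQuot p η)
    (h' : IsPQuot p η') (f : V ⟶ V') (g : W ⟶ W') (e : η ≫ g = f ≫ η') :
    (TensHom.ofMap p g).comp h'.pHom = h.pHom.comp (TensHom.ofMap p f) := by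
  apply TensHom.ext
  refine h.cancel ?_
  have e1 : (TensHom.ofMap p g).toLin ∘ₗ (TensHom.ofMap p η).toLin =
      (TensHom.ofMap p η').toLin ∘ₗ (TensHom.ofMap p f).toLin := by
    have := congrArg TensHom.toLin (congrArg (TensHom.ofMap p) e)
    rw [TensHom.ofMap_comp, TensHom.ofMap_comp] at this
    exact this
  simp only [TensHom.comp_toLin, IsPQuot.pHom_toLin]
  rw [LinearMap.comp_assoc, e1, ← LinearMap.comp_assoc, h'.pLin_comp, LinearMap.comp_assoc,
    h.pLin_comp]
  ext; simp

/-- `W` is killed by `p`, so the composition `V^{⊗ p}/p → V^{⊗ p} → V^{⊗ p}/p` vanishes. -/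
lemma IsPQuot.pHom_comp_ofMap {η : V ⟶ W} (h : IsPQuot p η)
    (hW : ∀ n (w : W.X n), (p : S) • w = 0) (hp : 0 < p) :
    (TensHom.ofMap p η).toLin ∘ₗ h.pLin = 0 := by
  refine h.cancel ?_
  rw [LinearMap.comp_assoc, h.pLin_comp]
  apply tens_ext
  intro v
  have h0 : (p : S) • mapTot η (v ⟨0, hp⟩) = 0 :=
    DFinsupp.ext fun n => hW n _
  simp only [TensHom.ofMap_toLin, LinearMap.comp_apply, LinearMap.smul_apply, LinearMap.id_apply,
    map_smul, mapTens_pure, LinearMap.zero_apply]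
  rw [← Function.update_eq_self (⟨0, hp⟩ : Fin p) (fun t => mapTot η (v t)),
    ← MultilinearMap.map_update_smul, h0]
  exact (pureTens p W).map_coord_zero ⟨0, hp⟩ (by simp)

end
end Tensor

/-! ### Multiplicative resolution data for `ℤ/p` -/

/-- The cyclic group `ℤ/p`, written multiplicatively. -/
abbrev Cyc (p : ℕ) := Multiplicative (ZMod p)

/-- A unital associative DG ring (with homological grading: the differential has degree `-1`)
with an action of `ℤ/p` by automorphisms of DG rings. -/
structure EquivariantDGRing (p : ℕ) where
  /-- the underlying ring, the direct sum of the terms -/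
  A : Type u
  [ring : Ring A]
  [action : MulSemiringAction (Cyc p) A]
  /-- the terms -/
  gr : ℤ → AddSubgroup A
  [graded : GradedRing gr]
  /-- the differential -/
  d : A →+ A
  d_mem : ∀ i x, x ∈ gr i → d x ∈ gr (i - 1)
  d_d : ∀ x, d (d x) = 0
  leibniz : ∀ i x y, x ∈ gr i → d (x * y) = d x * y + i.negOnePow • (x * d y)
  smul_mem : ∀ (g : Cyc p) i x, x ∈ gr i → g • x ∈ gr i
  d_smul : ∀ (g : Cyc p) x, d (g • x) = g • d x

namespace EquivariantDGRing

attribute [instance] ring action graded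

/-- The degree `i` term as a representation of `ℤ/p`, that is, a `ℤ[ℤ/p]`-module. -/
def rep {p : ℕ} (D : EquivariantDGRing.{u} p) (i : ℤ) : Representation ℤ (Cyc p) (D.gr i) where
  toFun g := AddMonoidHom.toIntLinearMap
    { toFun := fun x => ⟨g • x.1, D.smul_mem g i x.1 x.2⟩
      map_zero' := Subtype.ext (smul_zero g)
      map_add' := fun x y => Subtype.ext (smul_add g x.1 y.1) }
  map_one' := LinearMap.ext fun x => Subtype.ext (one_smul _ x.1)
  map_mul' g h := LinearMap.ext fun x => Subtype.ext (mul_smul g h x.1)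

/-- The degree `i` term is a projective `ℤ[ℤ/p]`-module. -/
def IsProjectiveTerm {p : ℕ} (D : EquivariantDGRing.{u} p) (i : ℤ) : Prop :=
  Module.Projective (MonoidAlgebra ℤ (Cyc p)) (D.rep i).asModule

/-- The sign operator `x ↦ (-1)^{|x|} x`. -/
def sgn {p : ℕ} (D : EquivariantDGRing.{u} p) : D.A →ₗ[ℤ] D.A :=
  AddMonoidHom.toIntLinearMap <|
    (DirectSum.toAddMonoid fun i => i.negOnePow • (D.gr i).subtype).comp
      (DirectSum.decomposeAddEquiv D.gr).toAddMonoidHom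

/-- The differential as a `ℤ`-linear map. -/
def dLin {p : ℕ} (D : EquivariantDGRing.{u} p) : D.A →ₗ[ℤ] D.A := D.d.toIntLinearMap

/-- The action of the generator of `ℤ/p`. -/
def gen {p : ℕ} (D : EquivariantDGRing.{u} p) : D.A →ₗ[ℤ] D.A :=
  (DistribSMul.toAddMonoidHom D.A (Multiplicative.ofAdd (1 : ZMod p))).toIntLinearMap

section
variable {p : ℕ} (D : EquivariantDGRing.{u} p)

lemma sgn_of_mem {i : ℤ} {x : D.A} (hx : x ∈ D.gr i) : D.sgn x = i.negOnePow • x := by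
  lift x to D.gr i using hx
  simp [sgn, DirectSum.decompose_coe]

lemma hom_ext {M : Type*} [AddCommGroup M] {f g : D.A →ₗ[ℤ] M}
    (h : ∀ i, ∀ x ∈ D.gr i, f x = g x) : f = g := by
  refine LinearMap.ext fun x => ?_
  induction x using DirectSum.Decomposition.inductionOn D.gr with
  | zero => simp
  | homogeneous m => exact h _ m m.2
  | add a b ha hb => rw [map_add, map_add, ha, hb]

lemma dLin_mem {i : ℤ} {x : D.A} (hx : x ∈ D.gr i) : D.dLin x ∈ D.gr (i - 1) := D.d_mem i x hx

lemma sgn_mem {i : ℤ} {x : D.A} (hx : x ∈ D.gr i) : D.sgn x ∈ D.gr i := by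
  rw [D.sgn_of_mem hx]
  exact zsmul_mem hx _

lemma gen_mem {i : ℤ} {x : D.A} (hx : x ∈ D.gr i) : D.gen x ∈ D.gr i := D.smul_mem _ i x hx

lemma dLin_dLin : D.dLin ∘ₗ D.dLin = 0 := LinearMap.ext D.d_d

lemma dLin_gen : D.dLin ∘ₗ D.gen = D.gen ∘ₗ D.dLin := LinearMap.ext (D.d_smul _)

lemma sgn_gen : D.sgn ∘ₗ D.gen = D.gen ∘ₗ D.sgn := D.hom_ext fun i x hx => by
  rw [LinearMap.comp_apply, LinearMap.comp_apply, D.sgn_of_mem hx, D.sgn_of_mem (D.gen_mem hx)]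
  exact (map_zsmul D.gen _ x).symm

lemma dLin_sgn : D.dLin ∘ₗ D.sgn = - (D.sgn ∘ₗ D.dLin) := D.hom_ext fun i x hx => by
  rw [LinearMap.neg_apply, LinearMap.comp_apply, LinearMap.comp_apply, D.sgn_of_mem hx,
    D.sgn_of_mem (D.dLin_mem hx), Int.negOnePow_sub, Int.negOnePow_one]
  have := map_zsmul D.dLin (i.negOnePow : ℤ) x
  rw [Units.smul_def, this, mul_neg, mul_one, Units.smul_def, Units.val_neg, neg_smul, neg_neg]

end

end EquivariantDGRing

/-- Multiplicative resolution data for `ℤ/p`: a projective resolution `P → ℤ` and a resolution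
`ℤ → I^0 → I^1 → ⋯` of the trivial `ℤ[ℤ/p]`-module `ℤ`, with DG ring structures on the cone `P̄` of
`P → ℤ` (so that `P̄_0 = ℤ`, `P̄_i = P_{i-1}` for `i ≥ 1`, and `P̄` is acyclic) and on `I` (with `I^n`
placed in homological degree `-n`).  The terms of `I` are projective `ℤ[ℤ/p]`-modules (equivalently,
`ℤ`-free and injective relative to `ℤ`). -/
structure MulResolutionData (p : ℕ) where
  /-- the cone `P̄` of `P → ℤ` -/
  P : EquivariantDGRing.{u} p
  /-- the resolution `I` -/
  I : EquivariantDGRing.{u} p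
  P_neg : ∀ i < 0, P.gr i = ⊥
  P_zero : ∀ x ∈ P.gr 0, ∃ n : ℤ, x = n
  P_char : Function.Injective (Int.cast : ℤ → P.A)
  P_proj : ∀ i > 0, P.IsProjectiveTerm i
  P_acyclic : ∀ x, P.d x = 0 → ∃ y, P.d y = x
  I_pos : ∀ i > 0, I.gr i = ⊥
  I_proj : ∀ i ≤ 0, I.IsProjectiveTerm i
  I_char : Function.Injective (Int.cast : ℤ → I.A)
  I_zero : ∀ x ∈ I.gr 0, I.d x = 0 → ∃ n : ℤ, x = n
  I_exact : ∀ i < 0, ∀ x ∈ I.gr i, I.d x = 0 → ∃ y, I.d y = x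

/-! ### The Tate complex -/

namespace MulResolutionData

section Coefficients
variable {p : ℕ} (ν : MulResolutionData.{u} p)

/-- `P̄ ⊗ I`. -/
def B : Type u := ν.P.A ⊗[ℤ] ν.I.A

instance : AddCommGroup ν.B := inferInstanceAs (AddCommGroup (ν.P.A ⊗[ℤ] ν.I.A))

/-- The element `x ⊗ y` of `P̄ ⊗ I`. -/
def tmulB (x : ν.P.A) (y : ν.I.A) : ν.B := x ⊗ₜ[ℤ] y

/-- The endomorphism `f ⊗ g` of `P̄ ⊗ I`. -/
def mapB (f : ν.P.A →ₗ[ℤ] ν.P.A) (g : ν.I.A →ₗ[ℤ] ν.I.A) : ν.B →ₗ[ℤ] ν.B :=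
  AddMonoidHom.toIntLinearMap (M := ν.B) (M₂ := ν.B) (TensorProduct.map f g).toAddMonoidHom

/-- The degree `m` term of `P̄ ⊗ I`. -/
def degB (m : ℤ) : Submodule ℤ ν.B :=
  Submodule.span ℤ {z | ∃ a b, a + b = m ∧ ∃ x ∈ ν.P.gr a, ∃ y ∈ ν.I.gr b, ν.tmulB x y = z}

/-- The differential on `P̄ ⊗ I`, `d(x ⊗ y) = dx ⊗ y + (-1)^{|x|} x ⊗ dy`. -/
def dB : ν.B →ₗ[ℤ] ν.B := ν.mapB ν.P.dLin LinearMap.id + ν.mapB ν.P.sgn ν.I.dLin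

/-- The diagonal action of the generator of `ℤ/p` on `P̄ ⊗ I`. -/
def genB : ν.B →ₗ[ℤ] ν.B := ν.mapB ν.P.gen ν.I.gen

lemma mapB_tmulB (f : ν.P.A →ₗ[ℤ] ν.P.A) (g : ν.I.A →ₗ[ℤ] ν.I.A) (x : ν.P.A) (y : ν.I.A) :
    ν.mapB f g (ν.tmulB x y) = ν.tmulB (f x) (g y) := rfl

lemma B_ext {f g : ν.B →ₗ[ℤ] ν.B} (h : ∀ x y, f (ν.tmulB x y) = g (ν.tmulB x y)) : f = g := by
  refine LinearMap.ext fun z => ?_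
  refine TensorProduct.induction_on (motive := fun z : ν.P.A ⊗[ℤ] ν.I.A =>
    f (show ν.B from z) = g (show ν.B from z)) z ?_ h ?_
  · exact (map_zero f).trans (map_zero g).symm
  · intro a b ha hb
    exact (map_add f a b).trans ((congrArg₂ (· + ·) ha hb).trans (map_add g a b).symm)

lemma tmulB_neg (x : ν.P.A) (y : ν.I.A) : ν.tmulB (-x) y = - ν.tmulB x y :=
  TensorProduct.neg_tmul x y

lemma tmulB_zero (x : ν.P.A) : ν.tmulB x 0 = 0 := TensorProduct.tmul_zero _ x

lemma zero_tmulB (y : ν.I.A) : ν.tmulB 0 y = 0 := TensorProduct.zero_tmul _ y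

lemma dB_dB : ν.dB ∘ₗ ν.dB = 0 := by
  apply ν.B_ext
  intro x y
  have h1 : ν.P.dLin (ν.P.dLin x) = 0 := ν.P.d_d x
  have h2 : ν.I.dLin (ν.I.dLin y) = 0 := ν.I.d_d y
  have h3 : ν.P.dLin (ν.P.sgn x) = - ν.P.sgn (ν.P.dLin x) :=
    congrArg (fun f => f x) ν.P.dLin_sgn
  simp [dB, mapB_tmulB, h1, h2, h3, tmulB_neg, tmulB_zero, zero_tmulB]

lemma dB_genB : ν.dB ∘ₗ ν.genB = ν.genB ∘ₗ ν.dB := by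
  apply ν.B_ext
  intro x y
  have h1 : ν.P.dLin (ν.P.gen x) = ν.P.gen (ν.P.dLin x) := congrArg (fun f => f x) ν.P.dLin_gen
  have h2 : ν.I.dLin (ν.I.gen y) = ν.I.gen (ν.I.dLin y) := congrArg (fun f => f y) ν.I.dLin_gen
  have h3 : ν.P.sgn (ν.P.gen x) = ν.P.gen (ν.P.sgn x) := congrArg (fun f => f x) ν.P.sgn_gen
  simp [dB, genB, mapB_tmulB, h1, h2, h3]

lemma dB_mem (m : ℤ) : ν.degB m ≤ (ν.degB (m - 1)).comap ν.dB := by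
  refine Submodule.span_le.2 ?_
  rintro _ ⟨a, b, rfl, x, hx, y, hy, rfl⟩
  rw [SetLike.mem_coe, Submodule.mem_comap, dB, LinearMap.add_apply, mapB_tmulB, mapB_tmulB]
  exact add_mem (Submodule.subset_span ⟨a - 1, b, by ring, _, ν.P.dLin_mem hx, y, hy, rfl⟩)
    (Submodule.subset_span ⟨a, b - 1, by ring, _, ν.P.sgn_mem hx, _, ν.I.dLin_mem hy, rfl⟩)

end Coefficients

section Tate
variable {p : ℕ} (ν : MulResolutionData.{u} p) {S : Type u} [CommRing S]

/-- `V^{⊗ p} ⊗ P̄ ⊗ I`. -/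
abbrev X (V : Ch S) : Type u := TensPow p V ⊗[ℤ] ν.B

/-- `f ⊗ g`. -/
def act {V W : Ch S} (f : TensPow p V →ₗ[S] TensPow p W) (g : ν.B →ₗ[ℤ] ν.B) :
    ν.X V →ₗ[S] ν.X W :=
  TensorProduct.AlgebraTensorModule.map f g

/-- The differential on `V^{⊗ p} ⊗ P̄ ⊗ I`. -/
def dX (V : Ch S) : ν.X V →ₗ[S] ν.X V :=
  ν.act (dTens p V) LinearMap.id + ν.act (sgnTens p V) ν.dB

/-- The diagonal action of the generator of `ℤ/p` on `V^{⊗ p} ⊗ P̄ ⊗ I`. -/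
def genX (V : Ch S) : ν.X V →ₗ[S] ν.X V := ν.act (rotTens p V) ν.genB

/-- The degree `n` term of `V^{⊗ p} ⊗ P̄ ⊗ I`. -/
def degX (V : Ch S) (n : ℤ) : Submodule S (ν.X V) :=
  Submodule.span S {z | ∃ j m, j + m = n ∧ ∃ e ∈ degTens p V j, ∃ b ∈ ν.degB m, e ⊗ₜ b = z}

/-- The degree `n` term of `F^i V^{⊗ p} ⊗ P̄ ⊗ I`, where `F^i V^{⊗ p}` is the part of `V^{⊗ p}` of
degrees `≤ - i p` (the `p`-th rescaling of the stupid filtration). -/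
def filX (V : Ch S) (i n : ℤ) : Submodule S (ν.X V) :=
  Submodule.span S {z | ∃ j m, j + m = n ∧ j ≤ - (i * p) ∧
    ∃ e ∈ degTens p V j, ∃ b ∈ ν.degB m, e ⊗ₜ b = z}

/-- The degree `n` term of the `ℤ/p`-invariants `(V^{⊗ p} ⊗ P̄ ⊗ I)^{ℤ/p}`. -/
def invX (V : Ch S) (n : ℤ) : Submodule S (ν.X V) :=
  ν.degX V n ⊓ LinearMap.ker (ν.genX V - LinearMap.id)

@[simp] lemma act_tmul {V W : Ch S} (f : TensPow p V →ₗ[S] TensPow p W) (g : ν.B →ₗ[ℤ] ν.B)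
    (e : TensPow p V) (b : ν.B) : ν.act f g (e ⊗ₜ b) = f e ⊗ₜ g b := rfl

lemma act_comp {V W U : Ch S} (f : TensPow p V →ₗ[S] TensPow p W) (g : ν.B →ₗ[ℤ] ν.B)
    (f' : TensPow p W →ₗ[S] TensPow p U) (g' : ν.B →ₗ[ℤ] ν.B) :
    ν.act f' g' ∘ₗ ν.act f g = ν.act (f' ∘ₗ f) (g' ∘ₗ g) :=
  (TensorProduct.AlgebraTensorModule.map_comp f' f g' g).symm

lemma X_ext {V W : Ch S} {f g : ν.X V →ₗ[S] ν.X W} (h : ∀ e b, f (e ⊗ₜ b) = g (e ⊗ₜ b)) : f = g :=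
  TensorProduct.AlgebraTensorModule.ext h

lemma dX_dX (V : Ch S) : ν.dX V ∘ₗ ν.dX V = 0 := by
  rw [dX, LinearMap.add_comp, LinearMap.comp_add, LinearMap.comp_add]
  simp only [act_comp, dTens_dTens, sgnTens_dTens, dB_dB, LinearMap.id_comp, LinearMap.comp_id]
  apply ν.X_ext
  intro e b
  simp [TensorProduct.neg_tmul]

lemma dX_genX (V : Ch S) : ν.dX V ∘ₗ ν.genX V = ν.genX V ∘ₗ ν.dX V := by
  rw [dX, genX, LinearMap.add_comp, LinearMap.comp_add]
  simp only [act_comp, dTens_rotTens, sgnTens_rotTens, dB_genB, LinearMap.id_comp,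
    LinearMap.comp_id]

lemma dX_degX (V : Ch S) (n : ℤ) : ν.degX V n ≤ (ν.degX V (n - 1)).comap (ν.dX V) := by
  refine Submodule.span_le.2 ?_
  rintro _ ⟨j, m, rfl, e, he, b, hb, rfl⟩
  simp only [SetLike.mem_coe, Submodule.mem_comap, dX, LinearMap.add_apply, act_tmul,
    LinearMap.id_apply]
  exact add_mem (Submodule.subset_span ⟨j - 1, m, by ring, _, dTens_deg j he, _, hb, rfl⟩)
    (Submodule.subset_span ⟨j, m - 1, by ring, _, sgnTens_deg j he, _, ν.dB_mem m hb, rfl⟩)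

lemma dX_filX (V : Ch S) (i n : ℤ) : ν.filX V i n ≤ (ν.filX V i (n - 1)).comap (ν.dX V) := by
  refine Submodule.span_le.2 ?_
  rintro _ ⟨j, m, rfl, hj, e, he, b, hb, rfl⟩
  simp only [SetLike.mem_coe, Submodule.mem_comap, dX, LinearMap.add_apply, act_tmul,
    LinearMap.id_apply]
  exact add_mem
    (Submodule.subset_span ⟨j - 1, m, by ring, by omega, _, dTens_deg j he, _, hb, rfl⟩)
    (Submodule.subset_span ⟨j, m - 1, by ring, hj, _, sgnTens_deg j he, _, ν.dB_mem m hb, rfl⟩)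

lemma dX_invX (V : Ch S) (n m : ℤ) (h : m + 1 = n) : ∀ x ∈ ν.invX V n, ν.dX V x ∈ ν.invX V m := by
  obtain rfl : m = n - 1 := by omega
  rintro x ⟨hx, hx'⟩
  refine ⟨ν.dX_degX V n hx, ?_⟩
  rw [SetLike.mem_coe, LinearMap.mem_ker, LinearMap.sub_apply, sub_eq_zero] at hx' ⊢
  have := congrArg (fun f => f x) (ν.dX_genX V)
  simp only [LinearMap.comp_apply, hx', LinearMap.id_apply] at this
  exact this.symm

/-- The Tate complex `(V^{⊗ p} ⊗ P̄ ⊗ I)^{ℤ/p}`. -/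
def tateCh (V : Ch S) : Ch S where
  X n := ModuleCat.of S (ν.invX V n)
  d n m := if h : m + 1 = n then ModuleCat.ofHom ((ν.dX V).restrict (ν.dX_invX V n m h)) else 0
  shape n m h := dif_neg h
  d_comp_d' n m l h h' := by
    rw [dif_pos (show m + 1 = n from h), dif_pos (show l + 1 = m from h')]
    apply ModuleCat.hom_ext
    refine LinearMap.ext fun x => Subtype.ext ?_
    exact congrArg (fun f => f x.1) (ν.dX_dX V)

lemma tateCh_d (V : Ch S) (n m : ℤ) (h : m + 1 = n) :
    (ν.tateCh V).d n m = ModuleCat.ofHom ((ν.dX V).restrict (ν.dX_invX V n m h)) :=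
  dif_pos h

/-- The Tate complex with its filtration. -/
def tateObj (V : Ch S) : FiltCh S where
  K := ν.tateCh V
  F i n := (ν.filX V i n).comap (ν.invX V n).subtype
  anti i j n h := by
    refine Submodule.comap_mono (Submodule.span_mono ?_)
    rintro _ ⟨k, m, hk, hj, e⟩
    refine ⟨k, m, hk, hj.trans ?_, e⟩
    have := mul_le_mul_of_nonneg_right h (Int.natCast_nonneg p)
    omega
  d_mem i n m x hx := by
    by_cases h : m + 1 = n
    · rw [Submodule.mem_comap, ν.tateCh_d V n m h]
      obtain rfl : m = n - 1 := by omega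
      exact ν.dX_filX V i n hx
    · have : (ν.tateCh V).d n m = 0 := (ν.tateCh V).shape n m h
      rw [Submodule.mem_comap, this]
      exact zero_mem _

/-- The map `f ⊗ 1` on `V^{⊗ p} ⊗ P̄ ⊗ I`. -/
def mapX {V W : Ch S} (f : TensHom p V W) : ν.X V →ₗ[S] ν.X W := ν.act f.toLin LinearMap.id

lemma mapX_dX {V W : Ch S} (f : TensHom p V W) :
    ν.mapX f ∘ₗ ν.dX V = ν.dX W ∘ₗ ν.mapX f := by
  rw [mapX, dX, dX, LinearMap.add_comp, LinearMap.comp_add]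
  simp only [act_comp, f.comm_d, f.comm_sgn, LinearMap.id_comp, LinearMap.comp_id]

lemma mapX_genX {V W : Ch S} (f : TensHom p V W) :
    ν.mapX f ∘ₗ ν.genX V = ν.genX W ∘ₗ ν.mapX f := by
  rw [mapX, genX, genX]
  simp only [act_comp, f.comm_rot, LinearMap.id_comp, LinearMap.comp_id]

lemma mapX_filX {V W : Ch S} (f : TensHom p V W) (i n : ℤ) :
    ν.filX V i n ≤ (ν.filX W i n).comap (ν.mapX f) := by
  refine Submodule.span_le.2 ?_
  rintro _ ⟨j, m, rfl, hj, e, he, b, hb, rfl⟩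
  exact Submodule.subset_span ⟨j, m, rfl, hj, _, f.deg j he, _, hb, rfl⟩

lemma mapX_invX {V W : Ch S} (f : TensHom p V W) (n : ℤ) :
    ∀ x ∈ ν.invX V n, ν.mapX f x ∈ ν.invX W n := by
  rintro x ⟨hx, hx'⟩
  constructor
  · revert x
    have : ν.degX V n ≤ (ν.degX W n).comap (ν.mapX f) := by
      refine Submodule.span_le.2 ?_
      rintro _ ⟨j, m, rfl, e, he, b, hb, rfl⟩
      exact Submodule.subset_span ⟨j, m, rfl, _, f.deg j he, _, hb, rfl⟩
    exact fun x hx _ => this hx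
  · rw [SetLike.mem_coe, LinearMap.mem_ker, LinearMap.sub_apply, sub_eq_zero] at hx' ⊢
    have := congrArg (fun f => f x) (ν.mapX_genX f)
    simp only [LinearMap.comp_apply, hx', LinearMap.id_apply] at this
    exact this.symm

/-- The map of Tate complexes induced by a map of tensor powers. -/
def tateMap {V W : Ch S} (f : TensHom p V W) : ν.tateObj V ⟶ ν.tateObj W where
  f :=
    { f := fun n => ModuleCat.ofHom ((ν.mapX f).restrict (ν.mapX_invX f n))
      comm' := fun n m h => by
        change _ ≫ (ν.tateCh W).d n m = (ν.tateCh V).d n m ≫ _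
        rw [ν.tateCh_d V n m h, ν.tateCh_d W n m h]
        apply ModuleCat.hom_ext
        refine LinearMap.ext fun x => Subtype.ext ?_
        exact congrArg (fun f => f x.1) (ν.mapX_dX f).symm }
  mem i n x hx := ν.mapX_filX f i n hx

lemma tateMap_id (V : Ch S) : ν.tateMap (TensHom.id p V) = 𝟙 (ν.tateObj V) := by
  apply FiltCh.hom_ext
  apply HomologicalComplex.hom_ext
  intro n
  apply ModuleCat.hom_ext
  refine LinearMap.ext fun x => Subtype.ext ?_
  exact congrArg (fun f => f x.1) (TensorProduct.AlgebraTensorModule.map_id (R := ℤ) (A := S))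

lemma tateMap_comp {V W U : Ch S} (f : TensHom p V W) (g : TensHom p W U) :
    ν.tateMap (f.comp g) = ν.tateMap f ≫ ν.tateMap g := by
  apply FiltCh.hom_ext
  apply HomologicalComplex.hom_ext
  intro n
  apply ModuleCat.hom_ext
  refine LinearMap.ext fun x => Subtype.ext ?_
  exact congrArg (fun f => f x.1) (ν.act_comp f.toLin LinearMap.id g.toLin LinearMap.id).symm

lemma tateMap_comp_zero {V W U : Ch S} (f : TensHom p V W) (g : TensHom p W U)
    (h : g.toLin ∘ₗ f.toLin = 0) : (ν.tateMap f ≫ ν.tateMap g).f = 0 := by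
  apply HomologicalComplex.hom_ext
  intro n
  apply ModuleCat.hom_ext
  refine LinearMap.ext fun x => Subtype.ext ?_
  have e : ν.mapX g ∘ₗ ν.mapX f = 0 := by
    rw [mapX, mapX, act_comp, h]
    exact ν.X_ext fun e b => by simp
  exact congrArg (fun f => f x.1) e

end Tate

/-- The complex `C(V) = τ^F_{[0,1]} (V^{⊗ p} ⊗ P̄ ⊗ I)^{ℤ/p}` with its filtration. -/
def C {p : ℕ} (ν : MulResolutionData.{u} p) {S : Type u} [CommRing S] (V : Ch S) : FiltCh S :=
  (FiltCh.trunc01 S).obj (ν.tateObj V)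

/-- The map of complexes `C(V)` induced by a map of tensor powers. -/
def CMap {p : ℕ} (ν : MulResolutionData.{u} p) {S : Type u} [CommRing S] {V W : Ch S}
    (f : TensHom p V W) : ν.C V ⟶ ν.C W :=
  (FiltCh.trunc01 S).map (ν.tateMap f)

section
variable {p : ℕ} (ν : MulResolutionData.{u} p) {S : Type u} [CommRing S]

lemma CMap_id (V : Ch S) : ν.CMap (TensHom.id p V) = 𝟙 (ν.C V) := by
  rw [CMap, tateMap_id, CategoryTheory.Functor.map_id]
  rfl

lemma CMap_comp {V W U : Ch S} (f : TensHom p V W) (g : TensHom p W U) :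
    ν.CMap (f.comp g) = ν.CMap f ≫ ν.CMap g := by
  rw [CMap, tateMap_comp, Functor.map_comp]
  rfl

lemma CMap_comp_zero {V W U : Ch S} (f : TensHom p V W) (g : TensHom p W U)
    (h : g.toLin ∘ₗ f.toLin = 0) : (ν.CMap f ≫ ν.CMap g).f = 0 := by
  have e := ν.tateMap_comp_zero f g h
  apply HomologicalComplex.hom_ext
  intro n
  apply ModuleCat.hom_ext
  refine LinearMap.ext fun x => Subtype.ext ?_
  obtain ⟨x, hx⟩ := x
  induction x using Submodule.Quotient.induction_on with
  | _ y =>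
    have e' := congrArg (fun f => (f.f n).hom y) e
    exact (congrArg (Submodule.Quotient.mk) e').trans (Submodule.Quotient.mk_zero _)

end

end MulResolutionData

/-! ### Reduction modulo `p` for complexes over `W_2(R)` -/

section Witt
variable (p : ℕ) [Fact p.Prime] (R : Type u) [CommRing R]

/-- The ring `W_2(R)` of Witt vectors of length two. -/
abbrev W2 : Type u := TruncatedWittVector p 2 R

/-- The projection `W_2(R) → R`. -/
def resid : W2 p R →+* R where
  toFun x := x.coeff 0
  map_one' := by
    rw [← map_one (WittVector.truncate 2 : WittVector p R →+* _), WittVector.coeff_truncate]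
    exact WittVector.one_coeff_zero p R
  map_mul' x y := by
    obtain ⟨a, rfl⟩ := WittVector.truncate_surjective p 2 R x
    obtain ⟨b, rfl⟩ := WittVector.truncate_surjective p 2 R y
    rw [← map_mul, WittVector.coeff_truncate, WittVector.coeff_truncate,
      WittVector.coeff_truncate]
    exact WittVector.mul_coeff_zero a b
  map_zero' := TruncatedWittVector.coeff_zero p 2 R 0
  map_add' x y := by
    obtain ⟨a, rfl⟩ := WittVector.truncate_surjective p 2 R x
    obtain ⟨b, rfl⟩ := WittVector.truncate_surjective p 2 R y
    rw [← map_add, WittVector.coeff_truncate, WittVector.coeff_truncate,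
      WittVector.coeff_truncate]
    exact WittVector.add_coeff_zero a b

lemma resid_surjective : Function.Surjective (resid p R) := fun x =>
  ⟨TruncatedWittVector.mk p fun _ => x, TruncatedWittVector.coeff_mk (p := p) (fun _ : Fin 2 => x) 0⟩

lemma p_mul_eq_zero [CharP R p] (x : W2 p R) (hx : resid p R x = 0) : x * (p : W2 p R) = 0 := by
  obtain ⟨a, rfl⟩ := WittVector.truncate_surjective p 2 R x
  have h0 : a.coeff 0 = 0 := (WittVector.coeff_truncate a 0).symm.trans hx
  rw [← map_natCast (WittVector.truncate 2 : WittVector p R →+* _), ← map_mul]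
  apply TruncatedWittVector.ext
  intro i
  rw [WittVector.coeff_truncate, TruncatedWittVector.coeff_zero]
  fin_cases i
  · exact WittVector.mul_charP_coeff_zero a
  · refine (WittVector.mul_charP_coeff_succ a 0).trans ?_
    rw [h0, zero_pow (Fact.out : p.Prime).ne_zero]

/-- The map `R → W_2(R)` sending the residue of `x` to `p x`. -/
def mulP (r : R) : W2 p R := TruncatedWittVector.mk p (fun _ => r) * (p : W2 p R)

lemma mulP_resid [CharP R p] {r : R} (x : W2 p R) (hx : resid p R x = r) :
    mulP p R r = x * (p : W2 p R) := by
  rw [mulP, ← sub_eq_zero, ← sub_mul]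
  apply p_mul_eq_zero
  rw [map_sub, hx, sub_eq_zero]
  exact TruncatedWittVector.coeff_mk (p := p) (fun _ : Fin 2 => r) 0

/-- The map `V/p → V` induced by multiplication by `p`. -/
def timesP [CharP R p] (V : ModuleCat.{u} (W2 p R)) :
    ((ModuleCat.restrictScalars (resid p R)).obj (ModuleCat.of R R)) ⊗[W2 p R] V →ₗ[W2 p R] V :=
  TensorProduct.lift
    { toFun := fun r => mulP p R r • LinearMap.id
      map_add' := fun r s => by
        obtain ⟨x, hx⟩ := resid_surjective p R r
        obtain ⟨y, hy⟩ := resid_surjective p R s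
        refine (congrArg (· • LinearMap.id) (?_ : _ = mulP p R r + mulP p R s)).trans
          (add_smul _ _ _)
        rw [mulP_resid p R x hx, mulP_resid p R y hy, ← add_mul]
        exact mulP_resid p R (x + y) (by rw [map_add, hx, hy]; rfl)
      map_smul' := fun c r => by
        obtain ⟨x, hx⟩ := resid_surjective p R r
        refine (congrArg (· • LinearMap.id) (?_ : _ = c * mulP p R r)).trans (mul_smul _ _ _)
        rw [mulP_resid p R x hx, ← mul_assoc]
        exact mulP_resid p R (c * x) (by rw [map_mul, hx]; rfl) }

instance : (ModuleCat.extendScalars.{u, u, u} (resid p R)).Additive :=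
  (ModuleCat.extendRestrictScalarsAdj (resid p R)).left_adjoint_additive

/-- `V ↦ V/p = R ⊗ V`, from complexes over `W_2(R)` to complexes over `R`. -/
def qUp : Ch (W2 p R) ⥤ Ch R :=
  (ModuleCat.extendScalars.{u, u, u} (resid p R)).mapHomologicalComplex _

/-- Complexes over `R` considered as complexes over `W_2(R)`. -/
def qLow : Ch R ⥤ Ch (W2 p R) :=
  (ModuleCat.restrictScalars.{u, u, u} (resid p R)).mapHomologicalComplex _

/-- The quotient map `V → V/p`. -/
def toQuot : 𝟭 (Ch (W2 p R)) ⟶ qUp p R ⋙ qLow p R where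
  app V :=
    { f := fun n => (ModuleCat.extendRestrictScalarsAdj (resid p R)).unit.app (V.X n)
      comm' := fun n m _ =>
        ((ModuleCat.extendRestrictScalarsAdj (resid p R)).unit.naturality (V.d n m)).symm }
  naturality V W f := by
    apply HomologicalComplex.hom_ext
    intro n
    exact (ModuleCat.extendRestrictScalarsAdj (resid p R)).unit.naturality (f.f n)

lemma toQuot_surj (V : Ch (W2 p R)) (n : ℤ) :
    Function.Surjective (((toQuot p R).app V).f n).hom := by
  intro z
  refine TensorProduct.induction_on
    (motive := fun z => ∃ v, (((toQuot p R).app V).f n).hom v = z) z ?_ ?_ ?_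
  · exact ⟨0, map_zero _⟩
  · intro r v
    obtain ⟨s, rfl⟩ := resid_surjective p R r
    refine ⟨s • v, ?_⟩
    let o : (ModuleCat.restrictScalars (resid p R)).obj (ModuleCat.of R R) := (1 : R)
    refine (TensorProduct.smul_tmul (R := W2 p R) s o v).symm.trans ?_
    exact congrArg (fun t : (ModuleCat.restrictScalars (resid p R)).obj (ModuleCat.of R R) =>
      t ⊗ₜ[W2 p R] v) (mul_one (resid p R s))
  · rintro _ _ ⟨v, rfl⟩ ⟨w, rfl⟩
    exact ⟨v + w, map_add _ _ _⟩

lemma qLow_kill [CharP R p] (W : Ch R) (n : ℤ) (w : ((qLow p R).obj W).X n) :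
    (p : W2 p R) • w = 0 := by
  change resid p R (p : W2 p R) • (show W.X n from w) = 0
  rw [map_natCast, CharP.cast_eq_zero, zero_smul]

lemma toQuot_isPQuot [CharP R p] (V : Ch (W2 p R)) : IsPQuot p ((toQuot p R).app V) where
  surj := toQuot_surj p R V
  ker n v hv := by
    have e : timesP p R (V.X n) ((((toQuot p R).app V).f n).hom v) = (p : W2 p R) • v := by
      refine (TensorProduct.lift.tmul _ _).trans ?_
      change mulP p R 1 • v = _
      rw [mulP_resid p R 1 (map_one _), one_mul]
    rw [← e, hv]
    exact map_zero (timesP p R (V.X n))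

end Witt

/-! ### The splittings -/

namespace MulResolutionData

/-- The functor `V ↦ C(V)` on complexes of `S`-modules. -/
def cyc {p : ℕ} (ν : MulResolutionData.{u} p) (S : Type u) [CommRing S] : Ch S ⥤ Ch S where
  obj V := (ν.C V).K
  map f := (ν.CMap (TensHom.ofMap p f)).f
  map_id V := by rw [TensHom.ofMap_id, CMap_id]; rfl
  map_comp f g := by rw [TensHom.ofMap_comp, CMap_comp]; rfl

section Splittings
variable {p : ℕ} [Fact p.Prime] (ν : MulResolutionData.{u} p) (R : Type u) [CommRing R]

/-- The functor `W ↦ C(W)` from complexes over `R` to complexes over `W_2(R)`.  As `W_2(R) → R` is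
surjective, tensor products over `R` and over `W_2(R)` coincide for `R`-modules. -/
def cycR : Ch R ⥤ Ch (W2 p R) := qLow p R ⋙ ν.cyc (W2 p R)

/-- `V/p` as a complex over `W_2(R)`. -/
abbrev modp (V : Ch (W2 p R)) : Ch (W2 p R) := (qLow p R).obj ((qUp p R).obj V)

/-- The map `q : C(V) → C(V/p)` induced by the quotient map. -/
def qMap (V : Ch (W2 p R)) : ν.C V ⟶ ν.C (modp R V) :=
  ν.CMap (TensHom.ofMap p ((toQuot p R).app V))

lemma qMap_natural {V V' : Ch (W2 p R)} (f : V ⟶ V') :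
    ν.CMap (TensHom.ofMap p f) ≫ ν.qMap R V' =
      ν.qMap R V ≫ ν.CMap (TensHom.ofMap p ((qLow p R).map ((qUp p R).map f))) := by
  rw [qMap, qMap, ← CMap_comp, ← CMap_comp, ← TensHom.ofMap_comp, ← TensHom.ofMap_comp]
  exact congrArg (fun g => ν.CMap (TensHom.ofMap p g)) ((toQuot p R).naturality f)

/-- The degree `i` term of `C^r(V) ⊆ C(V)`: the kernel of the composition of `q : C(V) → C(V/p)` and
the projection `C(V/p) → C̄^l(V/p) = C(V/p) / τ^F_{≥ 1} C(V/p)`. -/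
def crSub (V : Ch (W2 p R)) (i : ℤ) : Submodule (W2 p R) ((ν.C V).K.X i) :=
  ((ν.C (modp R V)).geSub 1 i).comap ((ν.qMap R V).f.f i).hom

lemma crSub_d (V : Ch (W2 p R)) (i j : ℤ) :
    ν.crSub R V i ≤ (ν.crSub R V j).comap ((ν.C V).K.d i j).hom := by
  intro x hx
  have e : ((ν.qMap R V).f.f j).hom (((ν.C V).K.d i j).hom x) =
      ((ν.C (modp R V)).K.d i j).hom (((ν.qMap R V).f.f i).hom x) :=
    congrArg (fun g => g.hom x) ((ν.qMap R V).f.comm i j).symm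
  rw [crSub, Submodule.mem_comap, Submodule.mem_comap, e]
  exact (ν.C (modp R V)).geSub_d 1 i j hx

lemma crSub_map {V V' : Ch (W2 p R)} (f : V ⟶ V') (i : ℤ) :
    ν.crSub R V i ≤ (ν.crSub R V' i).comap (((ν.cyc (W2 p R)).map f).f i).hom := by
  intro x hx
  have e := congrArg (fun g => (g.f.f i).hom x) (ν.qMap_natural R f)
  refine (congrArg (· ∈ (ν.C (modp R V')).geSub 1 i) e).mpr ?_
  exact FiltCh.geSub_map (ν.CMap (TensHom.ofMap p ((qLow p R).map ((qUp p R).map f)))) 1 i hx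

/-- The functor `V ↦ C^r(V)`. -/
def cr : Ch (W2 p R) ⥤ Ch (W2 p R) where
  obj V := subCh (ν.C V).K (ν.crSub R V) (ν.crSub_d R V)
  map f := subChMap ((ν.cyc (W2 p R)).map f) (ν.crSub_map R f)
  map_id V := by
    apply HomologicalComplex.hom_ext
    intro n
    apply ModuleCat.hom_ext
    refine LinearMap.ext fun x => Subtype.ext ?_
    exact congrArg (fun g => (g.f n).hom x.1) ((ν.cyc (W2 p R)).map_id V)
  map_comp f g := by
    apply HomologicalComplex.hom_ext
    intro n
    apply ModuleCat.hom_ext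
    refine LinearMap.ext fun x => Subtype.ext ?_
    exact congrArg (fun g => (g.f n).hom x.1) ((ν.cyc (W2 p R)).map_comp f g)

variable [CharP R p]

/-- The map `p : C(V/p) → C(V)` induced by multiplication by `p`, `V^{⊗ p}/p → V^{⊗ p}`. -/
def pMap (V : Ch (W2 p R)) : ν.C (modp R V) ⟶ ν.C V :=
  ν.CMap (toQuot_isPQuot p R V).pHom

lemma pMap_natural {V V' : Ch (W2 p R)} (f : V ⟶ V') :
    ν.CMap (TensHom.ofMap p ((qLow p R).map ((qUp p R).map f))) ≫ ν.pMap R V' =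
      ν.pMap R V ≫ ν.CMap (TensHom.ofMap p f) := by
  rw [pMap, pMap, ← CMap_comp, ← CMap_comp]
  exact congrArg (fun g => ν.CMap g) ((toQuot_isPQuot p R V).pHom_natural
    (toQuot_isPQuot p R V') f _ ((toQuot p R).naturality f).symm)

lemma pMap_qMap (V : Ch (W2 p R)) : (ν.pMap R V ≫ ν.qMap R V).f = 0 :=
  ν.CMap_comp_zero _ _ ((toQuot_isPQuot p R V).pHom_comp_ofMap (qLow_kill p R _)
    (Fact.out : p.Prime).pos)

/-- The degree `i` term of `p (C̄^r(V/p)) ⊆ C(V)`, where `C̄^r(V/p)` is the kernel of the projection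
`C(V/p) → τ^F_{≤ 0} C(V/p)`. -/
def clSub (V : Ch (W2 p R)) (i : ℤ) : Submodule (W2 p R) ((ν.C V).K.X i) :=
  ((ν.C (modp R V)).leSub 0 i).map ((ν.pMap R V).f.f i).hom

lemma clSub_d (V : Ch (W2 p R)) (i j : ℤ) :
    ν.clSub R V i ≤ (ν.clSub R V j).comap ((ν.C V).K.d i j).hom := by
  rintro _ ⟨x, hx, rfl⟩
  have e : ((ν.pMap R V).f.f j).hom (((ν.C (modp R V)).K.d i j).hom x) =
      ((ν.C V).K.d i j).hom (((ν.pMap R V).f.f i).hom x) :=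
    congrArg (fun g => g.hom x) ((ν.pMap R V).f.comm i j).symm
  rw [clSub, Submodule.mem_comap, ← e]
  exact ⟨_, (ν.C (modp R V)).leSub_d 0 i j hx, rfl⟩

lemma clSub_map {V V' : Ch (W2 p R)} (f : V ⟶ V') (i : ℤ) :
    ν.clSub R V i ≤ (ν.clSub R V' i).comap (((ν.cyc (W2 p R)).map f).f i).hom := by
  rintro _ ⟨x, hx, rfl⟩
  have e := congrArg (fun g => (g.f.f i).hom x) (ν.pMap_natural R f)
  exact ⟨_, FiltCh.leSub_map (ν.CMap (TensHom.ofMap p ((qLow p R).map ((qUp p R).map f)))) 0 i hx,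
    e⟩

/-- The functor `V ↦ C^l(V) = C(V) / p (C̄^r(V/p))`. -/
def cl : Ch (W2 p R) ⥤ Ch (W2 p R) where
  obj V := quotCh (ν.C V).K (ν.clSub R V) (ν.clSub_d R V)
  map f := quotChMap ((ν.cyc (W2 p R)).map f) (ν.clSub_map R f)
  map_id V := by
    apply HomologicalComplex.hom_ext
    intro n
    apply ModuleCat.hom_ext
    apply Submodule.linearMap_qext
    refine LinearMap.ext fun x => ?_
    exact congrArg (fun g => (ν.clSub R V n).mkQ ((g.f n).hom x)) ((ν.cyc (W2 p R)).map_id V)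
  map_comp {_ _ V''} f g := by
    apply HomologicalComplex.hom_ext
    intro n
    apply ModuleCat.hom_ext
    apply Submodule.linearMap_qext
    refine LinearMap.ext fun x => ?_
    exact congrArg (fun g => (ν.clSub R V'' n).mkQ ((g.f n).hom x)) ((ν.cyc (W2 p R)).map_comp f g)

/-- The projection `C^l(V) → C(V/p)` induced by `q : C(V) → C(V/p)`. -/
def clTo : ν.cl R ⟶ qUp p R ⋙ ν.cycR R where
  app V :=
    { f := fun n => ModuleCat.ofHom ((ν.clSub R V n).liftQ ((ν.qMap R V).f.f n).hom (by
        rintro _ ⟨x, _, rfl⟩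
        exact congrArg (fun g => (g.f n).hom x) (ν.pMap_qMap R V)))
      comm' := fun n m _ => by
        apply ModuleCat.hom_ext
        apply Submodule.linearMap_qext
        refine LinearMap.ext fun x => ?_
        exact congrArg (fun g => g.hom x) ((ν.qMap R V).f.comm n m) }
  naturality V V' f := by
    apply HomologicalComplex.hom_ext
    intro n
    apply ModuleCat.hom_ext
    apply Submodule.linearMap_qext
    refine LinearMap.ext fun x => ?_
    exact congrArg (fun g => (g.f.f n).hom x) (ν.qMap_natural R f)

/-- The embedding `C(V/p) → C^r(V)` induced by `p : C(V/p) → C(V)`. -/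
def toCr : qUp p R ⋙ ν.cycR R ⟶ ν.cr R where
  app V :=
    { f := fun n => ModuleCat.ofHom (((ν.pMap R V).f.f n).hom.codRestrict (ν.crSub R V n)
        fun x => by
          have e := congrArg (fun g => (g.f n).hom x) (ν.pMap_qMap R V)
          exact (congrArg (· ∈ (ν.C (modp R V)).geSub 1 n) e).mpr (zero_mem _))
      comm' := fun n m _ => by
        apply ModuleCat.hom_ext
        refine LinearMap.ext fun x => Subtype.ext ?_
        exact congrArg (fun g => g.hom x) ((ν.pMap R V).f.comm n m) }
  naturality V V' f := by
    apply HomologicalComplex.hom_ext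
    intro n
    apply ModuleCat.hom_ext
    refine LinearMap.ext fun x => Subtype.ext ?_
    exact congrArg (fun g => (g.f.f n).hom x) (ν.pMap_natural R f)

end Splittings

end MulResolutionData

/-! ### Perfect complexes -/

/-- Bounded complexes of finitely generated projective modules. -/
def isPf (S : Type u) [CommRing S] : ObjectProperty (Ch S) := fun K =>
  (∀ n, Module.Finite S (K.X n) ∧ Module.Projective S (K.X n)) ∧
    ∃ N : ℤ, ∀ n, N < |n| → Subsingleton (K.X n)

/-- The category `C^{pf}(S)` of bounded complexes of finitely generated projective `S`-modules and
maps of complexes. -/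
abbrev Cpf (S : Type u) [CommRing S] := (isPf S).FullSubcategory

/-- The functor `q^* : C^{pf}(W_2(R)) → C^{pf}(R)`, `V ↦ V/p`. -/
def qPull (p : ℕ) [Fact p.Prime] (R : Type u) [CommRing R] : Cpf (W2 p R) ⥤ Cpf R :=
  (isPf R).lift ((isPf (W2 p R)).ι ⋙ qUp p R) fun V => by
    let : Algebra (W2 p R) R := (resid p R).toAlgebra
    obtain ⟨h, N, hN⟩ := V.property
    refine ⟨fun n => ?_, N, fun n hn => ?_⟩
    · obtain ⟨h1, h2⟩ := h n
      exact ⟨Module.Finite.base_change (W2 p R) R (V.obj.X n),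
        inferInstanceAs (Module.Projective R (R ⊗[W2 p R] V.obj.X n))⟩
    · have := hN n hn
      exact inferInstanceAs (Subsingleton (R ⊗[W2 p R] V.obj.X n))

namespace MulResolutionData

section
variable {p : ℕ} [Fact p.Prime] (ν : MulResolutionData.{u} p) (R : Type u) [CommRing R] [CharP R p]

/-- The functor `C : C^{pf}(R) → C(W_2(R))`. -/
def pfC : Cpf R ⥤ Ch (W2 p R) := (isPf R).ι ⋙ ν.cycR R

/-- The functor `C^l : C^{pf}(W_2(R)) → C(W_2(R))`. -/
def pfCl : Cpf (W2 p R) ⥤ Ch (W2 p R) := (isPf (W2 p R)).ι ⋙ ν.cl R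

/-- The functor `C^r : C^{pf}(W_2(R)) → C(W_2(R))`. -/
def pfCr : Cpf (W2 p R) ⥤ Ch (W2 p R) := (isPf (W2 p R)).ι ⋙ ν.cr R

/-- The structure map `l : C^l(V) → C(V/p)` of the left splitting. -/
def pfL : ν.pfCl R ⟶ qPull p R ⋙ ν.pfC R :=
  Functor.whiskerLeft (isPf (W2 p R)).ι (ν.clTo R)

/-- The structure map `r : C(V/p) → C^r(V)` of the right splitting. -/
def pfR : qPull p R ⋙ ν.pfC R ⟶ ν.pfCr R :=
  Functor.whiskerLeft (isPf (W2 p R)).ι (ν.toCr R)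

end

end MulResolutionData

end CyclicPowers

end

/-! Both splittings are functorial for all maps f : V/p → V'/p of complexes, including those that do
not lift to maps of complexes V → V'. As the terms of V are projective, f lifts to a graded map a,
and d a − a d is divisible by p, say equal to p b (`exists_isLift`). The tensor power a^{⊗p} fails
to commute with the differential by p times the sum over the slots t of the insertions of b among
copies of a. Since P̄ is an acyclic DG ring, it has an element u of degree one with du = 1, and
multiplication by u contracts P̄ ⊗ I. Subtracting from a^{⊗p} the multiple by p of the sum over t of
(b inserted in slot t) ⊗ (multiplication by the t-th translate of u), with suitable signs, gives an
honest chain map `powX` (`powX_dX`). The translates make it equivariant (`IsFiltEquiv.sum_contr`),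
and since p² = 0 in W_2(R) these maps compose strictly (`powX_comp`).

Two lifts of f differ by p c, and the chain maps they induce differ by p (dH + Hd), where H is built
in the same way from insertions of c and preserves the filtration (`powX_eq_of_congr`). Such a
difference vanishes on each splitting. For C^l, it is the image under p of an element of C̄^r(V'/p),
which has been divided out (`SmulHtpy.sub_mem`). For C^r, an element represented by y has p y and p
dy one filtration step higher than a general element of C(V), so dH(p y) + H(p dy) is zero in
τ^F_{≤1} (`SmulHtpy.eq_of_mem`). The maps on C^l and C^r therefore depend on f only, are compatible
with composition, and agree with the given functors when f comes from a map V → V'. They also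
commute with the structure maps, since the correction term is a multiple of p.

It remains to see that every perfect complex over R is the reduction of one over W_2(R). Over a
field there are bases in which the differential sends basis vectors to basis vectors or to zero
(`exists_adapted_basis`), and the same formula defines a lift (`qPull_essSurj`). The rest is formal:
a functor extended in this manner along an essentially surjective functor factors through it
(`exists_factorization`). -/

noncomputable section

namespace CyclicPowers

/-! ### Homogeneous maps, Koszul signs, and maps of tensor powers -/

section GradedMaps
variable {p : ℕ} {S : Type u} [CommRing S] {V W U : Ch S}

/-- A linear map of total modules that is homogeneous of degree `k`. -/
def HasDeg (k : ℤ) (f : Tot V →ₗ[S] Tot W) : Prop :=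
  ∀ n (v : V.X n), ∃ w, inc W (n + k) w = f (inc V n v)

lemma HasDeg.comp {k l m : ℤ} {g : Tot W →ₗ[S] Tot U} {f : Tot V →ₗ[S] Tot W}
    (hg : HasDeg l g) (hf : HasDeg k f) (h : k + l = m) : HasDeg m (g ∘ₗ f) := by
  intro n v
  obtain ⟨w, hw⟩ := hf n v
  rw [LinearMap.comp_apply, ← hw]
  exact inc_congr (by omega) (hg (n + k) w)

lemma HasDeg.add {k : ℤ} {f g : Tot V →ₗ[S] Tot W} (hf : HasDeg k f) (hg : HasDeg k g) :
    HasDeg k (f + g) := by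
  intro n v
  obtain ⟨x, hx⟩ := hf n v
  obtain ⟨y, hy⟩ := hg n v
  exact ⟨x + y, by rw [map_add, hx, hy, LinearMap.add_apply]⟩

lemma HasDeg.zero (k : ℤ) : HasDeg k (0 : Tot V →ₗ[S] Tot W) := fun _ _ => ⟨0, by simp⟩

lemma hasDeg_mapTot (f : V ⟶ W) : HasDeg 0 (mapTot f) :=
  fun n v => inc_congr (add_zero n) ⟨_, (mapTot_inc f n v).symm⟩

lemma hasDeg_sgnTot : HasDeg 0 (sgnTot V) := fun n v =>
  inc_congr (add_zero n) (sgnTot_inc_mem n v)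

lemma HasDeg.comp_zero {k : ℤ} {g : Tot W →ₗ[S] Tot U} {f : Tot V →ₗ[S] Tot W}
    (hg : HasDeg k g) (hf : HasDeg 0 f) : HasDeg k (g ∘ₗ f) := hg.comp hf (by omega)

lemma HasDeg.zero_comp {k : ℤ} {g : Tot W →ₗ[S] Tot U} {f : Tot V →ₗ[S] Tot W}
    (hg : HasDeg 0 g) (hf : HasDeg k f) : HasDeg k (g ∘ₗ f) := hg.comp hf (by omega)

lemma tot_apply_ext {M : Type*} [AddCommMonoid M] [Module S M] {f g : Tot V →ₗ[S] M}
    (h : ∀ n (v : V.X n), f (inc V n v) = g (inc V n v)) (x : Tot V) : f x = g x :=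
  congrArg (fun f => f x) (tot_ext V h)

section
variable {a : Tot V →ₗ[S] Tot W}

lemma HasDeg.sgn_even (ha : HasDeg 0 a) (x : Tot V) : sgnTot W (a x) = a (sgnTot V x) := by
  refine tot_apply_ext (f := sgnTot W ∘ₗ a) (g := a ∘ₗ sgnTot V) (fun n v => ?_) x
  obtain ⟨w, hw⟩ := inc_congr (add_zero n).symm (ha n v)
  by_cases h : Even n <;> simp [h, ← hw]

lemma HasDeg.even_even (ha : HasDeg 0 a) (x : Tot V) : evenTot W (a x) = a (evenTot V x) := by
  refine tot_apply_ext (f := evenTot W ∘ₗ a) (g := a ∘ₗ evenTot V) (fun n v => ?_) x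
  obtain ⟨w, hw⟩ := inc_congr (add_zero n).symm (ha n v)
  by_cases h : Even n <;> simp [h, ← hw]

lemma HasDeg.odd_even (ha : HasDeg 0 a) (x : Tot V) : oddTot W (a x) = a (oddTot V x) := by
  refine tot_apply_ext (f := oddTot W ∘ₗ a) (g := a ∘ₗ oddTot V) (fun n v => ?_) x
  obtain ⟨w, hw⟩ := inc_congr (add_zero n).symm (ha n v)
  by_cases h : Even n <;> simp [h, ← hw]

/-- A map of degree −1 reverses parity. This gives the sign here and exchanges the even and odd
projections in the next two lemmas. -/
lemma HasDeg.sgn_odd (ha : HasDeg (-1) a) (x : Tot V) : sgnTot W (a x) = - a (sgnTot V x) := by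
  refine tot_apply_ext (f := sgnTot W ∘ₗ a) (g := - (a ∘ₗ sgnTot V)) (fun n v => ?_) x
  obtain ⟨w, hw⟩ := ha n v
  by_cases h : Even n <;> simp [h, ← hw, Int.even_add]

lemma HasDeg.even_odd (ha : HasDeg (-1) a) (x : Tot V) : evenTot W (a x) = a (oddTot V x) := by
  refine tot_apply_ext (f := evenTot W ∘ₗ a) (g := a ∘ₗ oddTot V) (fun n v => ?_) x
  obtain ⟨w, hw⟩ := ha n v
  by_cases h : Even n <;> simp [h, ← hw, Int.even_add]

lemma HasDeg.odd_odd (ha : HasDeg (-1) a) (x : Tot V) : oddTot W (a x) = a (evenTot V x) := by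
  refine tot_apply_ext (f := oddTot W ∘ₗ a) (g := a ∘ₗ evenTot V) (fun n v => ?_) x
  obtain ⟨w, hw⟩ := ha n v
  by_cases h : Even n <;> simp [h, ← hw, Int.even_add]

end

@[simp] lemma sgnTot_sgnTot_apply (x : Tot V) : sgnTot V (sgnTot V x) = x :=
  congrArg (fun f => f x) (sgnTot_sgnTot V)

lemma sgnTot_evenTot_apply (x : Tot V) : sgnTot V (evenTot V x) = evenTot V x :=
  congrArg (fun f => f x) (sgnTot_evenTot V)

lemma sgnTot_oddTot_apply (x : Tot V) : sgnTot V (oddTot V x) = - oddTot V x :=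
  congrArg (fun f => f x) (sgnTot_oddTot V)

lemma sgnTot_dTot_apply (x : Tot V) : sgnTot V (dTot V x) = - dTot V (sgnTot V x) :=
  congrArg (fun f => f x) (sgnTot_dTot V)

/-! #### Multilinearity of `f_0 ⊗ ⋯ ⊗ f_{p-1}` -/

lemma mapTens_eq_smul (c : S) (f g : Fin p → Tot V →ₗ[S] Tot W) (s : Fin p) (hs : f s = c • g s)
    (h : ∀ t, t ≠ s → f t = g t) : mapTens p f = c • mapTens p g := by
  apply tens_ext
  intro v
  rw [mapTens_pure, LinearMap.smul_apply, mapTens_pure]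
  have : (fun t => f t (v t)) = Function.update (fun t => g t (v t)) s (c • (g s (v s))) := by
    funext t
    by_cases ht : t = s
    · subst ht; simp [hs]
    · simp [ht, h t ht]
  rw [this, MultilinearMap.map_update_smul, Function.update_eq_self]

lemma mapTens_eq_add (f g g' : Fin p → Tot V →ₗ[S] Tot W) (s : Fin p) (hs : f s = g s + g' s)
    (h : ∀ t, t ≠ s → f t = g t) (h' : ∀ t, t ≠ s → f t = g' t) :
    mapTens p f = mapTens p g + mapTens p g' := by
  apply tens_ext
  intro v
  rw [mapTens_pure, LinearMap.add_apply, mapTens_pure, mapTens_pure]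
  have e : (fun t => f t (v t)) =
      Function.update (fun t => f t (v t)) s (g s (v s) + g' s (v s)) := by
    rw [← LinearMap.add_apply, ← hs, Function.update_eq_self]
  rw [e, MultilinearMap.map_update_add]
  congr 2
  · funext t
    by_cases ht : t = s
    · subst ht; simp
    · simp [ht, h t ht]
  · funext t
    by_cases ht : t = s
    · subst ht; simp
    · simp [ht, ← h' t ht]

/-- By multilinearity the scalar in front can be moved into any slot, so the slots may be replaced
one after another. It serves to compute with identities that hold only up to p-torsion. -/
lemma smul_mapTens_congr (c : S) (f g : Fin p → Tot V →ₗ[S] Tot W) (h : ∀ t, c • f t = c • g t) :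
    c • mapTens p f = c • mapTens p g := by
  have key : ∀ s : Finset (Fin p), c • mapTens p (s.piecewise g f) = c • mapTens p f := by
    intro s
    induction s using Finset.induction_on with
    | empty => simp
    | insert j s hj ih =>
      rw [Finset.piecewise_insert, ← ih]
      rw [← mapTens_eq_smul c (Function.update (s.piecewise g f) j (c • g j)) _ j (by simp)
        (fun t ht => by simp [ht])]
      refine mapTens_eq_smul c _ _ j ?_ fun t ht => by simp [ht]
      rw [Function.update_self, Finset.piecewise_eq_of_notMem _ _ _ hj, h]
  have := key Finset.univ
  rw [Finset.piecewise_univ] at this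
  exact this.symm

/-- A first-order expansion: terms with `c • g` in two or more slots carry a factor c² = 0. -/
lemma mapTens_add_smul (c : S) (hc : c * c = 0) (f g : Fin p → Tot V →ₗ[S] Tot W) :
    mapTens p (fun s => f s + c • g s) =
      mapTens p f + c • ∑ t, mapTens p (fun s => if s = t then g s else f s) := by
  have key : ∀ r : Finset (Fin p), mapTens p (r.piecewise (fun s => f s + c • g s) f) =
      mapTens p f + c • ∑ t ∈ r, mapTens p (fun s => if s = t then g s else f s) := by
    intro r
    induction r using Finset.induction_on with
    | empty => simp
    | insert j r hj ih =>
      rw [Finset.piecewise_insert, Finset.sum_insert hj, smul_add, add_left_comm, ← ih]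
      rw [mapTens_eq_add _ (Function.update (r.piecewise (fun s => f s + c • g s) f) j (c • g j))
        (r.piecewise (fun s => f s + c • g s) f) j]
      · congr 1
        rw [mapTens_eq_smul c _ (Function.update (r.piecewise (fun s => f s + c • g s) f) j (g j)) j
          (by simp) (fun t ht => by simp [ht])]
        -- The slots in `r` still contain `f + c • g`; behind the outer factor `c` this may be
        -- replaced by `f`.
        refine smul_mapTens_congr c _ _ fun t => ?_
        by_cases ht : t = j
        · subst ht; simp
        · by_cases htr : t ∈ r
          · simp [ht, htr, smul_smul, hc]
          · simp [ht, htr]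
      · simp [Finset.piecewise_eq_of_notMem _ _ _ hj, add_comm]
      · intro t ht; simp [ht]
      · intro t ht; simp [ht]
  have := key Finset.univ
  rwa [Finset.piecewise_univ] at this

lemma mapTens_deg (f : Fin p → Tot V →ₗ[S] Tot W) (k : Fin p → ℤ) (h : ∀ t, HasDeg (k t) (f t))
    (j : ℤ) : degTens p V j ≤ (degTens p W (j + ∑ t, k t)).comap (mapTens p f) := by
  refine Submodule.span_le.2 ?_
  rintro _ ⟨l, v, rfl, rfl⟩
  rw [SetLike.mem_coe, Submodule.mem_comap, mapTens_pure]
  exact pure_mem_degTens (fun t => l t + k t) (by rw [Finset.sum_add_distrib]) _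
    fun t => h t (l t) (v t)

/-! #### Inserting an odd or an even map in one slot -/

/-- `a ⊗ ⋯ ⊗ b ⊗ ⋯ ⊗ a` with the map `b` of odd degree in the `t`-th slot, with Koszul signs. -/
def oddIns (t : Fin p) (a b : Tot V →ₗ[S] Tot W) : TensPow p V →ₗ[S] TensPow p W :=
  mapTens p fun s => if s < t then a ∘ₗ sgnTot V else if s = t then b else a

/-- `a ⊗ ⋯ ⊗ c ⊗ ⋯ ⊗ a` with `c` in the `t`-th slot, without signs. -/
def evenIns (t : Fin p) (a c : Tot V →ₗ[S] Tot W) : TensPow p V →ₗ[S] TensPow p W :=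
  mapTens p fun s => if s = t then c else a

lemma dTens_eq : dTens p V = ∑ t, oddIns t LinearMap.id (dTot V) := by
  simp only [dTens, oddIns, LinearMap.id_comp]

variable {a b c : Tot V →ₗ[S] Tot W}

lemma mapTens_congr {f g : Fin p → Tot V →ₗ[S] Tot W} (h : ∀ s x, f s x = g s x) :
    mapTens p f = mapTens p g :=
  congrArg (mapTens p) (funext fun s => LinearMap.ext (h s))

/-- Rotation carries slot t to slot `finRotate p t`, and the Koszul signs match because b is odd. A
single insertion is not equivariant; the family indexed by t is permuted by the generator. For a the
identity and b the differential this is the computation behind `dTens_rotTens`. -/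
lemma oddIns_rotTens (ha : HasDeg 0 a) (hb : HasDeg (-1) b) (t : Fin p) :
    oddIns (finRotate p t) a b ∘ₗ rotTens p V = rotTens p W ∘ₗ oddIns t a b := by
  rw [oddIns, oddIns, rotTens, rotTens, ← LinearMap.comp_assoc, mapTens_rot, LinearMap.comp_assoc,
    LinearMap.comp_assoc]
  congr 1
  rw [LinearMap.comp_add, LinearMap.add_comp]
  simp only [mapTens_comp, Equiv.apply_eq_iff_eq]
  by_cases ht : (t : ℕ) + 1 = p
  -- The inserted slot is the one that rotates to the front. Since b changes its parity, the even
  -- summand on one side matches the odd summand on the other.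
  · rw [add_comm]
    congr 1
    · refine mapTens_congr fun s x => ?_
      by_cases hs : (s : ℕ) + 1 = p
      · obtain rfl : s = t := Fin.ext (by omega)
        simp [-finRotate_apply, hs, hb.even_odd]
      · have h1 : s < t := Fin.lt_def.2 (by have := s.2; omega)
        have h2 : ¬ finRotate p s < finRotate p t := by
          rw [Fin.lt_def, val_finRotate, val_finRotate]; simp [-finRotate_apply, ht]
        simp [-finRotate_apply, hs, h1, h2, h1.ne]
    · refine mapTens_congr fun s x => ?_
      by_cases hs : (s : ℕ) + 1 = p
      · obtain rfl : s = t := Fin.ext (by omega)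
        simp [-finRotate_apply, hs, hb.odd_odd]
      · have h1 : s < t := Fin.lt_def.2 (by have := s.2; omega)
        have h2 : ¬ finRotate p s < finRotate p t := by
          rw [Fin.lt_def, val_finRotate, val_finRotate]; simp [-finRotate_apply, ht]
        simp [-finRotate_apply, hs, h1, h2, h1.ne, ha.sgn_even]
  · congr 1
    · refine mapTens_congr fun s x => ?_
      by_cases hs : (s : ℕ) + 1 = p
      · have h1 : ¬ s < t := by rw [Fin.lt_def]; have := t.2; omega
        have h0 : s ≠ t := by rintro rfl; exact ht hs
        have h2 : finRotate p s < finRotate p t := by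
          rw [Fin.lt_def, val_finRotate, val_finRotate]; simp [-finRotate_apply, ht, hs]
        simp [-finRotate_apply, hs, h1, h2, h0, sgnTot_evenTot_apply, ha.even_even]
      · have h2 : finRotate p s < finRotate p t ↔ s < t := by
          rw [Fin.lt_def, val_finRotate, val_finRotate, Fin.lt_def]; simp [-finRotate_apply, ht, hs]
        simp [-finRotate_apply, hs, h2]
    · have htp : ∃ l : Fin p, (l : ℕ) + 1 = p := ⟨⟨p - 1, by have := t.2; omega⟩, by
        have := t.2; simp only; omega⟩
      obtain ⟨l, hl⟩ := htp
      have h1 : ¬ l < t := by rw [Fin.lt_def]; have := t.2; omega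
      have h0 : l ≠ t := by rintro rfl; exact ht hl
      have h2 : finRotate p l < finRotate p t := by
        rw [Fin.lt_def, val_finRotate, val_finRotate]; simp [-finRotate_apply, ht, hl]
      have h3 : ∀ s : Fin p, s ≠ l → (s : ℕ) + 1 ≠ p := fun s hs h =>
        hs (Fin.ext (by omega))
      have h4 : ∀ s : Fin p, s ≠ l → (finRotate p s < finRotate p t ↔ s < t) := by
        intro s hs
        rw [Fin.lt_def, val_finRotate, val_finRotate, Fin.lt_def]; simp [-finRotate_apply, ht, h3 s hs]
      -- Both sides are minus the same tensor. On the left the sign comes from the last slot `l`,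
      -- where the sign operator acts on an odd vector; on the right it comes from slot `t`, where
      -- the sign operator passes the odd map `b`.
      rw [mapTens_neg _ (fun s => if s = l then a ∘ₗ oddTot V else
        if s < t then a else if s = t then b ∘ₗ sgnTot V else a ∘ₗ sgnTot V) l,
        eq_comm, mapTens_neg _ (fun s => if s = l then a ∘ₗ oddTot V else
        if s < t then a else if s = t then b ∘ₗ sgnTot V else a ∘ₗ sgnTot V) t]
      · refine LinearMap.ext fun x => ?_
        simp [-finRotate_apply, ht, h0.symm, hb.sgn_odd]
      · intro s hs
        refine LinearMap.ext fun x => ?_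
        by_cases hsl : s = l
        · subst hsl; simp [-finRotate_apply, hl, h1, h0, ha.odd_even]
        · by_cases hst : s < t
          · simp [-finRotate_apply, h3 s hsl, hsl, hst, ha.sgn_even]
          · simp [-finRotate_apply, h3 s hsl, hsl, hst, hs, ha.sgn_even]
      · refine LinearMap.ext fun x => ?_
        simp [-finRotate_apply, hl, h2, sgnTot_oddTot_apply]
      · intro s hs
        refine LinearMap.ext fun x => ?_
        by_cases hst : s < t
        · simp [-finRotate_apply, h3 s hs, hs, hst, h4 s hs]
        · by_cases hst' : s = t
          · subst hst'; simp [-finRotate_apply, ht, hs]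
          · simp [-finRotate_apply, h3 s hs, hs, hst, hst', h4 s hs]

lemma mapTens_rotTens (f : Fin p → Tot V →ₗ[S] Tot W) (hf : ∀ s, HasDeg 0 (f s)) :
    mapTens p f ∘ₗ rotTens p V = rotTens p W ∘ₗ mapTens p fun s => f (finRotate p s) := by
  rw [rotTens, rotTens, ← LinearMap.comp_assoc, mapTens_rot, LinearMap.comp_assoc,
    LinearMap.comp_assoc, LinearMap.comp_add, LinearMap.add_comp]
  simp only [mapTens_comp]
  congr 2
  · refine mapTens_congr fun s x => ?_
    split_ifs
    · exact ((hf _).even_even x).symm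
    · rfl
  · refine mapTens_congr fun s x => ?_
    split_ifs
    · exact ((hf _).odd_even x).symm
    · exact ((hf _).sgn_even x).symm

lemma evenIns_rotTens (ha : HasDeg 0 a) (hc : HasDeg 0 c) (t : Fin p) :
    evenIns (finRotate p t) a c ∘ₗ rotTens p V = rotTens p W ∘ₗ evenIns t a c := by
  rw [evenIns, evenIns, mapTens_rotTens _ fun s => by split_ifs <;> assumption]
  simp only [Equiv.apply_eq_iff_eq]

lemma mapTens_sgnTens (f : Fin p → Tot V →ₗ[S] Tot W) (hf : ∀ s, HasDeg 0 (f s)) :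
    mapTens p f ∘ₗ sgnTens p V = sgnTens p W ∘ₗ mapTens p f := by
  rw [sgnTens, sgnTens, mapTens_comp, mapTens_comp]
  exact mapTens_congr fun s x => ((hf s).sgn_even x).symm

lemma evenIns_sgnTens (ha : HasDeg 0 a) (hc : HasDeg 0 c) (t : Fin p) :
    evenIns t a c ∘ₗ sgnTens p V = sgnTens p W ∘ₗ evenIns t a c :=
  mapTens_sgnTens _ fun s => by split_ifs <;> assumption

lemma oddIns_sgnTens (ha : HasDeg 0 a) (hb : HasDeg (-1) b) (t : Fin p) :
    oddIns t a b ∘ₗ sgnTens p V = - (sgnTens p W ∘ₗ oddIns t a b) := by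
  rw [oddIns, sgnTens, sgnTens, mapTens_comp, mapTens_comp]
  refine mapTens_neg _ _ t ?_ fun s hs => ?_
  · refine LinearMap.ext fun x => ?_
    simp [hb.sgn_odd]
  · refine LinearMap.ext fun x => ?_
    by_cases h : s < t <;> simp [h, hs, ha.sgn_even]

lemma oddIns_deg (ha : HasDeg 0 a) (hb : HasDeg (-1) b) (t : Fin p) (j : ℤ) :
    degTens p V j ≤ (degTens p W (j - 1)).comap (oddIns t a b) := by
  have := mapTens_deg (V := V) (W := W)
    (fun s => if s < t then a ∘ₗ sgnTot V else if s = t then b else a)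
    (fun s => if s = t then -1 else 0) (fun s => by
      rcases lt_trichotomy s t with h | h | h
      · simpa [h, h.ne] using ha.comp_zero hasDeg_sgnTot
      · simpa [h] using hb
      · simpa [h.not_gt, h.ne'] using ha) j
  rw [Finset.sum_ite_eq' Finset.univ t, if_pos (Finset.mem_univ t), ← sub_eq_add_neg] at this
  exact this

lemma mapTens_deg_zero (f : Fin p → Tot V →ₗ[S] Tot W) (hf : ∀ s, HasDeg 0 (f s)) (j : ℤ) :
    degTens p V j ≤ (degTens p W j).comap (mapTens p f) := by
  have := mapTens_deg f (fun _ => 0) hf j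
  rwa [Finset.sum_const_zero, add_zero] at this

lemma evenIns_deg (ha : HasDeg 0 a) (hc : HasDeg 0 c) (t : Fin p) (j : ℤ) :
    degTens p V j ≤ (degTens p W j).comap (evenIns t a c) :=
  mapTens_deg_zero _ (fun s => by split_ifs <;> assumption) j

lemma oddIns_add (t : Fin p) (a b b' : Tot V →ₗ[S] Tot W) :
    oddIns t a (b + b') = oddIns t a b + oddIns t a b' := by
  refine mapTens_eq_add _ _ _ t (by simp) ?_ ?_ <;> intro s hs <;> simp [hs]

lemma oddIns_smul (t : Fin p) (k : S) (a b : Tot V →ₗ[S] Tot W) :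
    oddIns t a (k • b) = k • oddIns t a b := by
  refine mapTens_eq_smul k _ _ t (by simp) ?_; intro s hs; simp [hs]

lemma oddIns_neg (t : Fin p) (a b : Tot V →ₗ[S] Tot W) :
    oddIns t a (-b) = - oddIns t a b := by
  refine mapTens_neg _ _ t (by simp) ?_; intro s hs; simp [hs]

lemma smul_oddIns_congr (k : S) {a a' b b' : Tot V →ₗ[S] Tot W} (ha : k • a = k • a')
    (hb : k • b = k • b') (t : Fin p) : k • oddIns t a b = k • oddIns t a' b' := by
  refine smul_mapTens_congr k _ _ fun s => ?_
  split_ifs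
  · rw [← LinearMap.smul_comp, ha, LinearMap.smul_comp]
  · exact hb
  · exact ha

lemma oddIns_comp_mapTens {g h : Tot W →ₗ[S] Tot U} (ha : HasDeg 0 a) (t : Fin p) :
    (oddIns t g h ∘ₗ mapTens p fun _ => a) = oddIns t (g ∘ₗ a) (h ∘ₗ a) := by
  rw [oddIns, oddIns, mapTens_comp]
  refine mapTens_congr fun s x => ?_
  split_ifs <;> simp [ha.sgn_even]

lemma mapTens_comp_oddIns {g : Tot W →ₗ[S] Tot U} (t : Fin p) :
    (mapTens p fun _ => g) ∘ₗ oddIns t a b = oddIns t (g ∘ₗ a) (g ∘ₗ b) := by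
  rw [oddIns, oddIns, mapTens_comp]
  refine mapTens_congr fun s x => ?_
  split_ifs <;> simp

/-- The commutator of `d` and `a ⊗ ⋯ ⊗ a`. -/
lemma dTens_mapTens_sub (ha : HasDeg 0 a) :
    (dTens p W ∘ₗ mapTens p fun _ => a) - (mapTens p fun _ => a) ∘ₗ dTens p V =
      ∑ t, oddIns t a (dTot W ∘ₗ a - a ∘ₗ dTot V) := by
  rw [dTens_eq, dTens_eq, comp_sum_aux, sum_comp_aux, ← Finset.sum_sub_distrib]
  refine Finset.sum_congr rfl fun t _ => ?_
  rw [oddIns_comp_mapTens ha, mapTens_comp_oddIns, sub_eq_add_neg (dTot W ∘ₗ a), oddIns_add,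
    oddIns_neg, sub_eq_add_neg]
  rfl

/-- If `b` anticommutes and `a` commutes with `d` up to `k`-torsion, then so does the insertion of
`b` in the tensor power of `a`. -/
lemma smul_dTens_oddIns (k : S) (ha : HasDeg 0 a) (hb : HasDeg (-1) b)
    (hda : k • (dTot W ∘ₗ a) = k • (a ∘ₗ dTot V))
    (hdb : k • (dTot W ∘ₗ b) = - k • (b ∘ₗ dTot V)) (t : Fin p) :
    k • (dTens p W ∘ₗ oddIns t a b) = - k • (oddIns t a b ∘ₗ dTens p V) := by
  rw [dTens_eq, dTens_eq, comp_sum_aux, sum_comp_aux, Finset.smul_sum, Finset.smul_sum]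
  refine Finset.sum_congr rfl fun r _ => ?_
  have hda' : ∀ x, k • dTot W (a x) = k • a (dTot V x) := fun x => congrArg (fun f => f x) hda
  have hdb' : ∀ x, k • dTot W (b x) = - k • b (dTot V x) := fun x => congrArg (fun f => f x) hdb
  simp only [oddIns, mapTens_comp]
  rw [neg_smul, ← smul_neg]
  -- Here d stands in slot r and b in slot t. For r ≠ t the minus sign arises from interchanging two
  -- odd maps, and it can be located in the smaller of the two slots. For r = t it is the hypothesis
  -- on b.
  rcases lt_trichotomy r t with h | h | h
  · rw [← mapTens_neg (fun s => if s < r then a else if s = r then a ∘ₗ dTot V ∘ₗ sgnTot V else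
      if s < t then a ∘ₗ sgnTot V else if s = t then b else a) _ r]
    · refine smul_mapTens_congr k _ _ fun s => LinearMap.ext fun x => ?_
      rcases lt_trichotomy s r with hs | hs | hs
      · simp [hs, hs.trans h, ha.sgn_even]
      · subst hs; simp [h, hda']
      · rcases lt_trichotomy s t with hs' | hs' | hs'
        · simp [hs.not_gt, hs.ne', hs']
        · subst hs'; simp [hs.not_gt, hs.ne']
        · simp [hs.not_gt, hs.ne', hs'.not_gt, hs'.ne']
    · refine LinearMap.ext fun x => ?_
      simp [h, sgnTot_dTot_apply]
    · intro s hs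
      refine LinearMap.ext fun x => ?_
      rcases lt_trichotomy s r with hs' | hs' | hs'
      · simp [hs', hs'.trans h]
      · exact absurd hs' hs
      · rcases lt_trichotomy s t with h' | h' | h'
        · simp [hs'.not_gt, hs, h']
        · subst h'; simp [hs'.not_gt, hs]
        · simp [hs'.not_gt, hs, h'.not_gt, h'.ne']
  · subst h
    rw [← mapTens_neg (fun s => if s < r then a else if s = r then - b ∘ₗ dTot V else a) _ r]
    · refine smul_mapTens_congr k _ _ fun s => LinearMap.ext fun x => ?_
      rcases lt_trichotomy s r with hs | hs | hs
      · simp [hs, ha.sgn_even]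
      · subst hs; simp [hdb']
      · simp [hs.not_gt, hs.ne']
    · simp
    · intro s hs
      refine LinearMap.ext fun x => ?_
      rcases lt_trichotomy s r with hs' | hs' | hs'
      · simp [hs']
      · exact absurd hs' hs
      · simp [hs'.not_gt, hs]
  · rw [← mapTens_neg (fun s => if s < t then a else if s = t then - b ∘ₗ sgnTot V else
      if s < r then a ∘ₗ sgnTot V else if s = r then a ∘ₗ dTot V else a) _ t]
    · refine smul_mapTens_congr k _ _ fun s => LinearMap.ext fun x => ?_
      rcases lt_trichotomy s t with hs | hs | hs
      · simp [hs, hs.trans h, ha.sgn_even]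
      · subst hs; simp [h, hb.sgn_odd]
      · rcases lt_trichotomy s r with hs' | hs' | hs'
        · simp [hs.not_gt, hs.ne', hs', ha.sgn_even]
        · subst hs'; simp [hs.not_gt, hs.ne', hda']
        · simp [hs.not_gt, hs.ne', hs'.not_gt, hs'.ne']
    · refine LinearMap.ext fun x => ?_
      simp [h]
    · intro s hs
      refine LinearMap.ext fun x => ?_
      rcases lt_trichotomy s t with hs' | hs' | hs'
      · simp [hs', hs'.trans h]
      · exact absurd hs' hs
      · rcases lt_trichotomy s r with h' | h' | h'
        · simp [hs'.not_gt, hs, h']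
        · subst h'; simp [hs'.not_gt, hs]
        · simp [hs'.not_gt, hs, h'.not_gt, h'.ne']

/-- The commutator of `d` with an insertion of an even map, up to `k`-torsion. -/
lemma smul_dTens_evenIns (k : S) (ha : HasDeg 0 a) (hc : HasDeg 0 c)
    (hda : k • (dTot W ∘ₗ a) = k • (a ∘ₗ dTot V)) (t : Fin p) :
    k • (dTens p W ∘ₗ evenIns t a c - evenIns t a c ∘ₗ dTens p V) =
      k • oddIns t a (dTot W ∘ₗ c - c ∘ₗ dTot V) := by
  have hda' : ∀ x, k • dTot W (a x) = k • a (dTot V x) := fun x => congrArg (fun f => f x) hda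
  rw [dTens_eq, dTens_eq, comp_sum_aux, sum_comp_aux, ← Finset.sum_sub_distrib, Finset.smul_sum]
  -- In a slot r ≠ t the differential meets `a`, with which it commutes after multiplication by `k`,
  -- so only slot t contributes.
  rw [Finset.sum_eq_single_of_mem t (Finset.mem_univ t)]
  · rw [sub_eq_add_neg (dTot W ∘ₗ c), oddIns_add, oddIns_neg, ← sub_eq_add_neg]
    simp only [oddIns, evenIns, mapTens_comp]
    congr 2
    · refine mapTens_congr fun s x => ?_
      rcases lt_trichotomy s t with h | h | h
      · simp [h, h.ne, ha.sgn_even]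
      · simp [h]
      · simp [h.not_gt, h.ne']
    · refine mapTens_congr fun s x => ?_
      rcases lt_trichotomy s t with h | h | h
      · simp [h, h.ne]
      · simp [h]
      · simp [h.not_gt, h.ne']
  · intro r _ hr
    rw [smul_sub, sub_eq_zero]
    simp only [oddIns, evenIns, mapTens_comp]
    refine smul_mapTens_congr k _ _ fun s => LinearMap.ext fun x => ?_
    rcases lt_trichotomy s r with h | h | h
    · by_cases hs : s = t
      · simp [hs, hc.sgn_even, hs ▸ h]
      · simp [h, hs, ha.sgn_even]
    · subst h
      simp [hr, hda']
    · by_cases hs : s = t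
      · subst hs; simp [h.not_gt, h.ne']
      · simp [h.not_gt, h.ne', hs]

end GradedMaps

/-! ### Representatives in filtered truncations, and homotopies multiplied by a scalar -/

namespace FiltCh
variable {S : Type u} [CommRing S] (E : FiltCh S)

lemma F_congr {j k n : ℤ} (h : j = k) {x : E.K.X n} (hx : x ∈ E.F j n) : x ∈ E.F k n := h ▸ hx

lemma leSub_le (n i : ℤ) : E.leSub n i ≤ E.F (n - i) i := by
  refine sup_le (E.anti _ _ _ (by omega)) ?_
  rintro _ ⟨x, hx, rfl⟩
  exact E.d_mem _ _ _ hx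

/-- For j ≤ n − i the kernel of E_i → τ^F_{≤n} E_i lies inside F^j, so membership in the image of
F^j can be tested on any representative. -/
lemma mem_of_mk_mem {n j i : ℤ} (h : j ≤ n - i) {y : E.K.X i}
    (hy : (E.leSub n i).mkQ y ∈ (E.F j i).map (E.leSub n i).mkQ) : y ∈ E.F j i := by
  have : y ∈ ((E.F j i).map (E.leSub n i).mkQ).comap (E.leSub n i).mkQ := hy
  rw [Submodule.comap_map_mkQ] at this
  exact sup_le ((E.leSub_le n i).trans (E.anti _ _ _ h)) le_rfl this

/-- The class of an element of `E_i` in the quotient of which `(τ^F_{[0,1]} E)_i` is a subgroup. -/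
abbrev cls (i : ℤ) : E.K.X i →ₗ[S] ((FiltCh.le S 1).obj E).K.X i := (E.leSub 1 i).mkQ

/-- The class in `τ^F_{≤ 1} E` underlying an element of `τ^F_{[0,1]} E`. -/
abbrev val (i : ℤ) : ((trunc01 S).obj E).K.X i →ₗ[S] ((FiltCh.le S 1).obj E).K.X i :=
  (((FiltCh.le S 1).obj E).geSub 0 i).subtype

lemma val_injective (i : ℤ) : Function.Injective (E.val i) := Subtype.val_injective

lemma exists_rep {i : ℤ} (x : ((trunc01 S).obj E).K.X i) : ∃ y, E.val i x = E.cls i y := by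
  obtain ⟨y, hy⟩ := Submodule.mkQ_surjective (E.leSub 1 i) (E.val i x)
  exact ⟨y, hy.symm⟩

lemma mem_of_rep {i : ℤ} {x : ((trunc01 S).obj E).K.X i} {y : E.K.X i}
    (h : E.val i x = E.cls i y) :
    y ∈ E.F (0 - i) i ∧ (E.K.d i (i - 1)).hom y ∈ E.F (0 + 1 - i) (i - 1) := by
  have h1 : E.cls i y ∈ ((FiltCh.le S 1).obj E).geSub 0 i := h ▸ x.2
  exact ⟨E.mem_of_mk_mem (n := 1) (by omega) h1.2, E.mem_of_mk_mem (n := 1) (by omega) h1.1⟩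

/-- The two bounds, 1 − i in degree i and 2 − i in degree i − 1, are exactly the largest ones for
which `mem_of_mk_mem` applies to τ^F_{≤1}. -/
lemma mem_of_mem_geSub {i : ℤ} {x : ((trunc01 S).obj E).K.X i}
    (hx : x ∈ ((trunc01 S).obj E).geSub 1 i) {y : E.K.X i} (h : E.val i x = E.cls i y) :
    y ∈ E.F (1 - i) i ∧ (E.K.d i (i - 1)).hom y ∈ E.F (1 + 1 - i) (i - 1) := by
  have h2 : E.cls i y ∈ ((FiltCh.le S 1).obj E).F (1 - i) i := h ▸ hx.2
  have h1 : (((FiltCh.le S 1).obj E).K.d i (i - 1)).hom (E.val i x) ∈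
    ((FiltCh.le S 1).obj E).F (1 + 1 - i) (i - 1) := hx.1
  rw [h] at h1
  exact ⟨E.mem_of_mk_mem (n := 1) (by omega) h2, E.mem_of_mk_mem (n := 1) (by omega) h1⟩

lemma exists_of_mem {i : ℤ} {y : E.K.X i} (h : y ∈ E.F (0 - i) i)
    (h' : (E.K.d i (i - 1)).hom y ∈ E.F (0 + 1 - i) (i - 1)) :
    ∃ x : ((trunc01 S).obj E).K.X i, E.val i x = E.cls i y :=
  ⟨⟨E.cls i y, ⟨_, h', rfl⟩, ⟨_, h, rfl⟩⟩, rfl⟩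

/-- Both z and y lie far enough in the filtration to define elements of τ^F_{[0,1]} E, because d
preserves the filtration. The bounds are those of the kernel of the projection to τ^F_{≤0}; this
recognises elements of C̄^r. -/
lemma exists_mem_leSub {i : ℤ} {z : E.K.X (i + 1)} (hz : z ∈ E.F (0 - i) (i + 1)) {y : E.K.X i}
    (hy : y ∈ E.F (0 + 1 - i) i) :
    ∃ x ∈ ((trunc01 S).obj E).leSub 0 i, E.val i x = E.cls i ((E.K.d (i + 1) i).hom z + y) := by
  obtain ⟨z', hz'⟩ := E.exists_of_mem (i := i + 1) (E.anti _ _ _ (by omega) hz)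
    (E.F_congr (by omega) (E.d_mem _ _ _ hz))
  obtain ⟨y', hy'⟩ := E.exists_of_mem (E.anti _ _ _ (by omega) hy) (E.d_mem _ _ _ hy)
  refine ⟨(((trunc01 S).obj E).K.d (i + 1) i).hom z' + y', add_mem (Submodule.mem_sup_right
    ⟨z', ?_, rfl⟩) (Submodule.mem_sup_left ?_), ?_⟩
  · change E.val (i + 1) z' ∈ ((FiltCh.le S 1).obj E).F (0 - i) (i + 1)
    rw [hz']
    exact ⟨z, hz, rfl⟩
  · change E.val i y' ∈ ((FiltCh.le S 1).obj E).F (0 + 1 - i) i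
    rw [hy']
    exact ⟨y, hy, rfl⟩
  · rw [map_add, hy', map_add]
    congr 1
    change (((FiltCh.le S 1).obj E).K.d (i + 1) i).hom (E.val (i + 1) z') = _
    rw [hz']
    rfl

lemma cls_eq_zero {i : ℤ} {z : E.K.X (i + 1)} (hz : z ∈ E.F (1 - i) (i + 1)) {y : E.K.X i}
    (hy : y ∈ E.F (1 + 1 - i) i) : E.cls i ((E.K.d (i + 1) i).hom z + y) = 0 :=
  (Submodule.Quotient.mk_eq_zero _).2 (add_mem (Submodule.mem_sup_right ⟨z, hz, rfl⟩)
    (Submodule.mem_sup_left hy))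

lemma val_map {E E' : FiltCh S} (φ : E ⟶ E') {i : ℤ} {x : ((trunc01 S).obj E).K.X i} {y : E.K.X i}
    (h : E.val i x = E.cls i y) :
    E'.val i ((((trunc01 S).map φ).f.f i).hom x) = E'.cls i ((φ.f.f i).hom y) := by
  change (((FiltCh.le S 1).map φ).f.f i).hom (E.val i x) = _
  rw [h]
  rfl

/-- A filtered homotopy from `φ` to `φ'`, multiplied by `c`. -/
structure SmulHtpy (c : S) {E E' : FiltCh S} (φ φ' : E ⟶ E') where
  /-- the homotopy -/
  h : ∀ n m, n + 1 = m → (E.K.X n →ₗ[S] E'.K.X m)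
  mem : ∀ n m e i y, y ∈ E.F i n → h n m e y ∈ E'.F i m
  eq : ∀ i y, (φ'.f.f i).hom y = (φ.f.f i).hom y +
    c • ((E'.K.d (i + 1) i).hom (h i (i + 1) rfl y) +
      h (i - 1) i (by omega) ((E.K.d i (i - 1)).hom y))

/-- The mechanism for C^l. For a representative y, the elements h y and h dy satisfy the bounds of
`exists_mem_leSub`. Since c = π q, the difference c (d h y + h dy) is π applied to the class of q (d
h y + h dy), which lies in the kernel of the projection to τ^F_{≤0}. -/
lemma SmulHtpy.sub_mem {c : S} {E E' Q : FiltCh S} {φ φ' : E ⟶ E'} (H : SmulHtpy c φ φ')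
    (q : E' ⟶ Q) (π : Q ⟶ E') (hc : ∀ i y, (π.f.f i).hom ((q.f.f i).hom y) = c • y) {i : ℤ}
    (x : ((trunc01 S).obj E).K.X i) :
    (((trunc01 S).map φ').f.f i).hom x - (((trunc01 S).map φ).f.f i).hom x ∈
      (((trunc01 S).obj Q).leSub 0 i).map (((trunc01 S).map π).f.f i).hom := by
  obtain ⟨y, hy⟩ := E.exists_rep x
  obtain ⟨h1, h2⟩ := E.mem_of_rep hy
  obtain ⟨w, hw, hw'⟩ := Q.exists_mem_leSub (i := i) (q.mem _ _ (H.mem i (i + 1) rfl _ y h1))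
    (q.mem _ _ (H.mem (i - 1) i (by omega) _ _ h2))
  refine ⟨w, hw, E'.val_injective i ?_⟩
  rw [map_sub, val_map φ hy, val_map φ' hy, val_map π hw', H.eq, ← map_sub, add_sub_cancel_left,
    ← hc, map_add (q.f.f i).hom]
  congr 3
  exact congrArg (fun f => f.hom (H.h i (i + 1) rfl y)) (q.f.comm (i + 1) i)

/-- The mechanism for C^r. The scalar is moved inside the homotopy: the difference is d h (c y) + h
(c dy). As c = π q and q y lies in τ^F_{≥1}, both c y and c dy are deep enough in the filtration for
this sum to die in τ^F_{≤1}. -/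
lemma SmulHtpy.eq_of_mem {c : S} {E E' Q : FiltCh S} {φ φ' : E ⟶ E'} (H : SmulHtpy c φ φ')
    (q : E ⟶ Q) (π : Q ⟶ E) (hc : ∀ i y, (π.f.f i).hom ((q.f.f i).hom y) = c • y) {i : ℤ}
    (x : ((trunc01 S).obj E).K.X i)
    (hx : (((trunc01 S).map q).f.f i).hom x ∈ ((trunc01 S).obj Q).geSub 1 i) :
    (((trunc01 S).map φ').f.f i).hom x = (((trunc01 S).map φ).f.f i).hom x := by
  obtain ⟨y, hy⟩ := E.exists_rep x
  obtain ⟨h1, h2⟩ := Q.mem_of_mem_geSub hx (val_map q hy)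
  have e : (Q.K.d i (i - 1)).hom ((q.f.f i).hom y) =
      (q.f.f (i - 1)).hom ((E.K.d i (i - 1)).hom y) :=
    congrArg (fun f => f.hom y) (q.f.comm i (i - 1))
  have h1' := π.mem _ _ h1
  rw [e] at h2
  have h2' := π.mem _ _ h2
  -- The filtration bounds on the reductions become bounds on `c • y` and `c • dy` upstairs.
  rw [Submodule.mem_comap, hc] at h1' h2'
  apply E'.val_injective i
  rw [val_map φ hy, val_map φ' hy, H.eq, map_add, add_eq_left, smul_add, ← map_smul, ← map_smul,
    ← map_smul]
  exact E'.cls_eq_zero (H.mem _ _ _ _ _ h1') (H.mem _ _ _ _ _ h2')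

end FiltCh

/-! ### Contracting an acyclic DG ring by multiplication -/

namespace EquivariantDGRing
variable {p : ℕ} (D : EquivariantDGRing.{u} p)

/-- Left multiplication. -/
def mulLin (u : D.A) : D.A →ₗ[ℤ] D.A := (AddMonoidHom.mulLeft u).toIntLinearMap

lemma d_one : D.d 1 = 0 := by
  have h := D.leibniz 0 1 1 (SetLike.GradedOne.one_mem)
  simpa using h

/-- The differential lowers degree by one, so it intertwines the projections. Only the degree one
part of an element with differential 1 matters, hence that element can be taken homogeneous. -/
lemma d_proj (y : D.A) : D.d (GradedRing.proj D.gr 1 y) = GradedRing.proj D.gr 0 (D.d y) := by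
  induction y using DirectSum.Decomposition.inductionOn D.gr with
  | zero => simp
  | @homogeneous i m =>
    have hd := D.d_mem i m m.2
    by_cases h : i = 1
    · subst h
      rw [sub_self] at hd
      rw [GradedRing.proj_apply, GradedRing.proj_apply, DirectSum.decompose_of_mem_same _ m.2,
        DirectSum.decompose_of_mem_same _ hd]
    · rw [GradedRing.proj_apply, GradedRing.proj_apply, DirectSum.decompose_of_mem_ne _ m.2 h,
        DirectSum.decompose_of_mem_ne _ hd (by omega), map_zero]
  | add a b ha hb => simp only [map_add, ha, hb]

lemma exists_d_eq_one (h : ∀ x, D.d x = 0 → ∃ y, D.d y = x) : ∃ u ∈ D.gr 1, D.d u = 1 := by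
  obtain ⟨y, hy⟩ := h 1 D.d_one
  refine ⟨GradedRing.proj D.gr 1 y, ?_, ?_⟩
  · rw [GradedRing.proj_apply]; exact SetLike.coe_mem _
  · rw [D.d_proj, hy, GradedRing.proj_apply,
      DirectSum.decompose_of_mem_same _ SetLike.GradedOne.one_mem]

lemma mulLin_mem {u : D.A} (hu : u ∈ D.gr 1) {i : ℤ} {x : D.A} (hx : x ∈ D.gr i) :
    D.mulLin u x ∈ D.gr (i + 1) := by
  rw [add_comm]
  exact SetLike.GradedMul.mul_mem hu hx

/-- By the Leibniz rule, d(ux) = x − u dx. This is where the DG ring structure enters: it turns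
acyclicity into a contraction given by one element. -/
lemma dLin_mulLin {u : D.A} (hu : u ∈ D.gr 1) (h : D.d u = 1) (x : D.A) :
    D.dLin (D.mulLin u x) = x - D.mulLin u (D.dLin x) := by
  have := D.leibniz 1 u x hu
  rw [h, one_mul, Int.negOnePow_one, Units.neg_smul, one_smul, ← sub_eq_add_neg] at this
  exact this

lemma sgn_mulLin {u : D.A} (hu : u ∈ D.gr 1) (x : D.A) :
    D.sgn (D.mulLin u x) = - D.mulLin u (D.sgn x) := by
  refine congrArg (fun f => f x) (D.hom_ext (f := D.sgn ∘ₗ D.mulLin u)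
    (g := - (D.mulLin u ∘ₗ D.sgn)) fun i x hx => ?_)
  simp only [LinearMap.comp_apply, LinearMap.neg_apply]
  rw [D.sgn_of_mem hx, D.sgn_of_mem (D.mulLin_mem hu hx), Int.negOnePow_add, Int.negOnePow_one,
    Units.smul_def, Units.smul_def, map_zsmul, mul_neg, mul_one, Units.val_neg, neg_smul]

end EquivariantDGRing

/-! ### Contractions of P̄ ⊗ I permuted by the group, and equivariant filtered maps -/

namespace MulResolutionData
variable {p : ℕ} (ν : MulResolutionData.{u} p)

/-- A degree one element of `P̄` with differential `1`. -/
def unitHtpy : ν.P.A := (ν.P.exists_d_eq_one ν.P_acyclic).choose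

lemma unitHtpy_mem : ν.unitHtpy ∈ ν.P.gr 1 := (ν.P.exists_d_eq_one ν.P_acyclic).choose_spec.1

lemma d_unitHtpy : ν.P.d ν.unitHtpy = 1 := (ν.P.exists_d_eq_one ν.P_acyclic).choose_spec.2

/-- The translates of `unitHtpy` by the elements of the group. -/
def unitHtpyAt (t : Fin p) : ν.P.A := Multiplicative.ofAdd ((t : ℕ) : ZMod p) • ν.unitHtpy

lemma unitHtpyAt_mem (t : Fin p) : ν.unitHtpyAt t ∈ ν.P.gr 1 := ν.P.smul_mem _ _ _ ν.unitHtpy_mem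

lemma d_unitHtpyAt (t : Fin p) : ν.P.d (ν.unitHtpyAt t) = 1 := by
  rw [unitHtpyAt, ν.P.d_smul, d_unitHtpy, smul_one]

lemma gen_unitHtpyAt (t : Fin p) : ν.P.gen (ν.unitHtpyAt t) = ν.unitHtpyAt (finRotate p t) := by
  change Multiplicative.ofAdd (1 : ZMod p) • ν.unitHtpyAt t = _
  rw [unitHtpyAt, unitHtpyAt, smul_smul, ← ofAdd_add, val_finRotate]
  congr 2
  split_ifs with h
  -- Rotation wraps the last index round to 0, in agreement with p = 0 in `ZMod p`.
  · have : (((t : ℕ) + 1 : ℕ) : ZMod p) = 0 := by rw [h, ZMod.natCast_self]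
    rw [Nat.cast_zero, ← this]
    push_cast
    ring
  · push_cast
    ring

/-- The contracting homotopies of `P̄ ⊗ I` given by multiplication by `unitHtpyAt t`. -/
def contrB (t : Fin p) : ν.B →ₗ[ℤ] ν.B := ν.mapB (ν.P.mulLin (ν.unitHtpyAt t)) LinearMap.id

lemma sub_tmulB (x x' : ν.P.A) (y : ν.I.A) :
    ν.tmulB (x - x') y = ν.tmulB x y - ν.tmulB x' y := TensorProduct.sub_tmul x x' y

/-- The differential of P̄ contributes the identity because u has differential 1. The part coming
from I cancels, since u is odd and multiplication by it anticommutes with the sign operator. -/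
lemma dB_contrB (t : Fin p) : ν.dB ∘ₗ ν.contrB t = LinearMap.id - ν.contrB t ∘ₗ ν.dB := by
  apply ν.B_ext
  intro x y
  simp only [LinearMap.comp_apply, LinearMap.sub_apply, LinearMap.id_apply, contrB, dB,
    LinearMap.add_apply, mapB_tmulB, map_add,
    ν.P.dLin_mulLin (ν.unitHtpyAt_mem t) (ν.d_unitHtpyAt t), ν.P.sgn_mulLin (ν.unitHtpyAt_mem t),
    tmulB_neg, sub_tmulB]
  abel

/-- The group acts on P̄ by ring automorphisms, so the generator takes multiplication by one
translate of u to multiplication by the next, with the same indexing as for the slots in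
`oddIns_rotTens`. -/
lemma genB_contrB (t : Fin p) :
    ν.contrB (finRotate p t) ∘ₗ ν.genB = ν.genB ∘ₗ ν.contrB t := by
  apply ν.B_ext
  intro x y
  simp only [LinearMap.comp_apply, LinearMap.id_apply, contrB, genB, mapB_tmulB]
  congr 1
  rw [← gen_unitHtpyAt]
  exact (smul_mul' _ _ _).symm

lemma contrB_mem (t : Fin p) (m : ℤ) : ν.degB m ≤ (ν.degB (m + 1)).comap (ν.contrB t) := by
  refine Submodule.span_le.2 ?_
  rintro _ ⟨a, b, rfl, x, hx, y, hy, rfl⟩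
  rw [SetLike.mem_coe, Submodule.mem_comap, contrB, mapB_tmulB]
  exact Submodule.subset_span
    ⟨a + 1, b, by ring, _, ν.P.mulLin_mem (ν.unitHtpyAt_mem t) hx, y, hy, rfl⟩

variable {S : Type u} [CommRing S] {V W U : Ch S}

section Act

lemma act_add (f f' : TensPow p V →ₗ[S] TensPow p W) (g : ν.B →ₗ[ℤ] ν.B) :
    ν.act (f + f') g = ν.act f g + ν.act f' g := ν.X_ext fun _ _ => TensorProduct.add_tmul _ _ _

lemma act_smul (k : S) (f : TensPow p V →ₗ[S] TensPow p W) (g : ν.B →ₗ[ℤ] ν.B) :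
    ν.act (k • f) g = k • ν.act f g := ν.X_ext fun _ _ => rfl

lemma act_neg (f : TensPow p V →ₗ[S] TensPow p W) (g : ν.B →ₗ[ℤ] ν.B) :
    ν.act (-f) g = - ν.act f g := ν.X_ext fun _ _ => TensorProduct.neg_tmul _ _

lemma act_sub_right (f : TensPow p V →ₗ[S] TensPow p W) (g g' : ν.B →ₗ[ℤ] ν.B) :
    ν.act f (g - g') = ν.act f g - ν.act f g' := ν.X_ext fun _ _ => TensorProduct.tmul_sub _ _ _

lemma act_sum {ι : Type*} (r : Finset ι) (f : ι → TensPow p V →ₗ[S] TensPow p W)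
    (g : ν.B →ₗ[ℤ] ν.B) : ν.act (∑ t ∈ r, f t) g = ∑ t ∈ r, ν.act (f t) g := by
  classical
  induction r using Finset.induction_on with
  | empty => exact ν.X_ext fun e b => TensorProduct.zero_tmul _ _
  | insert j r hj ih => rw [Finset.sum_insert hj, Finset.sum_insert hj, act_add, ih]

lemma act_degX {k l : ℤ} {f : TensPow p V →ₗ[S] TensPow p W} {g : ν.B →ₗ[ℤ] ν.B}
    (hf : ∀ j, degTens p V j ≤ (degTens p W (j + k)).comap f)
    (hg : ∀ m, ν.degB m ≤ (ν.degB (m + l)).comap g) {n m : ℤ} (h : n + (k + l) = m) :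
    ν.degX V n ≤ (ν.degX W m).comap (ν.act f g) := by
  refine Submodule.span_le.2 ?_
  rintro _ ⟨j, i, rfl, e, he, b, hb, rfl⟩
  exact Submodule.subset_span ⟨j + k, i + l, by omega, _, hf j he, _, hg i hb, rfl⟩

/-- F^i bounds the degree in V^{⊗p} from above, so only k ≤ 0 is needed; the degree l on P̄ ⊗ I may
be positive. A contraction can thus raise the total degree without leaving F^i. -/
lemma act_filX {k l : ℤ} (hk : k ≤ 0) {f : TensPow p V →ₗ[S] TensPow p W} {g : ν.B →ₗ[ℤ] ν.B}
    (hf : ∀ j, degTens p V j ≤ (degTens p W (j + k)).comap f)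
    (hg : ∀ m, ν.degB m ≤ (ν.degB (m + l)).comap g) {n m : ℤ} (h : n + (k + l) = m) (i : ℤ) :
    ν.filX V i n ≤ (ν.filX W i m).comap (ν.act f g) := by
  refine Submodule.span_le.2 ?_
  rintro _ ⟨j, r, rfl, hj, e, he, b, hb, rfl⟩
  exact Submodule.subset_span
    ⟨j + k, r + l, by omega, by omega, _, hf j he, _, hg r hb, rfl⟩

end Act

/-- A linear map `V^{⊗ p} ⊗ P̄ ⊗ I → W^{⊗ p} ⊗ P̄ ⊗ I` that is equivariant, homogeneous of degree
`k`, and respects the filtration. -/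
structure IsFiltEquiv (k : ℤ) (T : ν.X V →ₗ[S] ν.X W) : Prop where
  gen : T ∘ₗ ν.genX V = ν.genX W ∘ₗ T
  deg : ∀ n m, n + k = m → ν.degX V n ≤ (ν.degX W m).comap T
  fil : ∀ i n m, n + k = m → ν.filX V i n ≤ (ν.filX W i m).comap T

namespace IsFiltEquiv
variable {ν}

lemma add {k : ℤ} {T T' : ν.X V →ₗ[S] ν.X W} (h : ν.IsFiltEquiv k T) (h' : ν.IsFiltEquiv k T') :
    ν.IsFiltEquiv k (T + T') where
  gen := by rw [LinearMap.add_comp, LinearMap.comp_add, h.gen, h'.gen]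
  deg n m e x hx := (ν.degX W m).add_mem (h.deg n m e hx) (h'.deg n m e hx)
  fil i n m e x hx := (ν.filX W i m).add_mem (h.fil i n m e hx) (h'.fil i n m e hx)

lemma smul {k : ℤ} {T : ν.X V →ₗ[S] ν.X W} (h : ν.IsFiltEquiv k T) (c : S) :
    ν.IsFiltEquiv k (c • T) where
  gen := by rw [LinearMap.smul_comp, LinearMap.comp_smul, h.gen]
  deg n m e x hx := (ν.degX W m).smul_mem c (h.deg n m e hx)
  fil i n m e x hx := (ν.filX W i m).smul_mem c (h.fil i n m e hx)

lemma mapX (f : TensHom p V W) : ν.IsFiltEquiv 0 (ν.mapX f) where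
  gen := ν.mapX_genX f
  deg n m e := ν.act_degX (k := 0) (l := 0) (fun j => by rw [add_zero]; exact f.deg j)
    (fun m => by rw [add_zero]; exact le_rfl) e
  fil i n m e := ν.act_filX (k := 0) (l := 0) le_rfl (fun j => by rw [add_zero]; exact f.deg j)
    (fun m => by rw [add_zero]; exact le_rfl) e i

lemma mapTens {a : Tot V →ₗ[S] Tot W} (ha : HasDeg 0 a) :
    ν.IsFiltEquiv 0 (ν.act (mapTens p fun _ => a) LinearMap.id) where
  gen := by
    rw [genX, genX, act_comp, act_comp, mapTens_rotTens _ fun _ => ha]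
    rfl
  deg n m e := ν.act_degX (k := 0) (l := 0)
    (fun j => by rw [add_zero]; exact mapTens_deg_zero _ (fun _ => ha) j)
    (fun m => by rw [add_zero]; exact le_rfl) e
  fil i n m e := ν.act_filX (k := 0) (l := 0) le_rfl
    (fun j => by rw [add_zero]; exact mapTens_deg_zero _ (fun _ => ha) j)
    (fun m => by rw [add_zero]; exact le_rfl) e i

/-- Neither tensor factor is equivariant by itself: the generator shifts the index t in both.
Summing over all t absorbs the shift by reindexing. The odd insertions are used with k = −1, the
even ones with k = 0. -/
lemma sum_contr {k l : ℤ} (hk : k ≤ 0) (L : Fin p → TensPow p V →ₗ[S] TensPow p W)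
    (hrot : ∀ t, L (finRotate p t) ∘ₗ rotTens p V = rotTens p W ∘ₗ L t)
    (hdeg : ∀ t j, degTens p V j ≤ (degTens p W (j + k)).comap (L t)) (hl : k + 1 = l) :
    ν.IsFiltEquiv l (∑ t, ν.act (sgnTens p W ∘ₗ L t) (ν.contrB t)) where
  gen := by
    rw [genX, genX, sum_comp_aux, comp_sum_aux,
      ← Equiv.sum_comp (finRotate p)]
    refine Finset.sum_congr rfl fun t _ => ?_
    rw [act_comp, act_comp, genB_contrB, LinearMap.comp_assoc, hrot, ← LinearMap.comp_assoc,
      ← LinearMap.comp_assoc, sgnTens_rotTens]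
  deg n m e x hx := by
    rw [Submodule.mem_comap, LinearMap.sum_apply]
    exact sum_mem fun t _ => ν.act_degX (n := n) (m := m) (k := k) (l := 1) (f := sgnTens p W ∘ₗ L t)
      (fun j y hy => sgnTens_deg (V := W) _ (hdeg t j hy)) (ν.contrB_mem t) (by omega) hx
  fil i n m e x hx := by
    rw [Submodule.mem_comap, LinearMap.sum_apply]
    exact sum_mem fun t _ => ν.act_filX (n := n) (m := m) (k := k) (l := 1) 
      (f := sgnTens p W ∘ₗ L t) hk
      (fun j y hy => sgnTens_deg (V := W) _ (hdeg t j hy)) (ν.contrB_mem t) (by omega) i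
      hx

lemma mem_invX {k : ℤ} {T : ν.X V →ₗ[S] ν.X W} (h : ν.IsFiltEquiv k T) (n m : ℤ) (e : n + k = m) :
    ∀ x ∈ ν.invX V n, T x ∈ ν.invX W m := by
  rintro x ⟨hx, hx'⟩
  refine ⟨h.deg n m e hx, ?_⟩
  rw [SetLike.mem_coe, LinearMap.mem_ker, LinearMap.sub_apply, sub_eq_zero] at hx' ⊢
  have := congrArg (fun f => f x) h.gen
  simp only [LinearMap.comp_apply, hx', LinearMap.id_apply] at this
  exact this.symm

end IsFiltEquiv

/-- The map of Tate complexes induced by a map of `V^{⊗ p} ⊗ P̄ ⊗ I`. -/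
def tateMapX {T : ν.X V →ₗ[S] ν.X W} (h : ν.IsFiltEquiv 0 T) (hd : T ∘ₗ ν.dX V = ν.dX W ∘ₗ T) :
    ν.tateObj V ⟶ ν.tateObj W where
  f :=
    { f := fun n => ModuleCat.ofHom (T.restrict (h.mem_invX n n (add_zero n)))
      comm' := fun n m e => by
        change _ ≫ (ν.tateCh W).d n m = (ν.tateCh V).d n m ≫ _
        rw [ν.tateCh_d V n m e, ν.tateCh_d W n m e]
        apply ModuleCat.hom_ext
        refine LinearMap.ext fun x => Subtype.ext ?_
        exact congrArg (fun f => f x.1) hd.symm }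
  mem i n x hx := h.fil i n n (add_zero n) hx

lemma tateMapX_comp {T : ν.X V →ₗ[S] ν.X W} (h : ν.IsFiltEquiv 0 T)
    (hd : T ∘ₗ ν.dX V = ν.dX W ∘ₗ T) {T' : ν.X W →ₗ[S] ν.X U} (h' : ν.IsFiltEquiv 0 T')
    (hd' : T' ∘ₗ ν.dX W = ν.dX U ∘ₗ T') {T'' : ν.X V →ₗ[S] ν.X U} (h'' : ν.IsFiltEquiv 0 T'')
    (hd'' : T'' ∘ₗ ν.dX V = ν.dX U ∘ₗ T'') (e : T' ∘ₗ T = T'') :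
    ν.tateMapX h hd ≫ ν.tateMapX h' hd' = ν.tateMapX h'' hd'' := by
  subst e; rfl

lemma tateMap_eq {T : ν.X V →ₗ[S] ν.X W} (h : ν.IsFiltEquiv 0 T)
    (hd : T ∘ₗ ν.dX V = ν.dX W ∘ₗ T) (f : TensHom p V W) (e : T = ν.mapX f) :
    ν.tateMapX h hd = ν.tateMap f := by
  subst e; rfl

/-- A homotopy on `V^{⊗ p} ⊗ P̄ ⊗ I` induces one on Tate complexes. -/
def tateHtpy {T T' : ν.X V →ₗ[S] ν.X W} (h : ν.IsFiltEquiv 0 T) (hd : T ∘ₗ ν.dX V = ν.dX W ∘ₗ T)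
    (h' : ν.IsFiltEquiv 0 T') (hd' : T' ∘ₗ ν.dX V = ν.dX W ∘ₗ T') {H : ν.X V →ₗ[S] ν.X W}
    (hH : ν.IsFiltEquiv 1 H) (c : S) (e : T' = T + c • (ν.dX W ∘ₗ H + H ∘ₗ ν.dX V)) :
    FiltCh.SmulHtpy c (ν.tateMapX h hd) (ν.tateMapX h' hd') where
  h n m e := H.restrict (hH.mem_invX n m e)
  mem n m e i y hy := hH.fil i n m e hy
  eq i y := by
    have e1 : (ν.tateObj W).K.d (i + 1) i = _ := ν.tateCh_d W (i + 1) i rfl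
    have e2 : (ν.tateObj V).K.d i (i - 1) = _ := ν.tateCh_d V i (i - 1) (by omega)
    rw [e1, e2]
    exact Subtype.ext (congrArg (fun f => f y.1) e)

end MulResolutionData

/-! ### Graded maps commuting with the differentials up to a multiple of c -/

section
variable {S : Type u} [CommRing S]

lemma neg_smul_aux {A B : Type*} [AddCommMonoid A] [AddCommGroup B] [Module S A] [Module S B]
    (c : S) (f : A →ₗ[S] B) : (-c) • f = -(c • f) := neg_smul c f

lemma smul_sub_aux {A B : Type*} [AddCommMonoid A] [AddCommGroup B] [Module S A] [Module S B]
    (c : S) (f g : A →ₗ[S] B) : c • (f - g) = c • f - c • g := smul_sub c f g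

variable {V W U : Ch S}

/-- A graded map `a` that commutes with the differentials up to `c b`. -/
structure IsChainUpTo (c : S) (a b : Tot V →ₗ[S] Tot W) : Prop where
  deg : HasDeg 0 a
  deg_htpy : HasDeg (-1) b
  comm : dTot W ∘ₗ a - a ∘ₗ dTot V = c • b

namespace IsChainUpTo
variable {c : S} {a b : Tot V →ₗ[S] Tot W}

/-- The defect is a derivation: d a' a − a' a d = (d a' − a' d) a + a' (d a − a d). -/
lemma comp {a' b' : Tot W →ₗ[S] Tot U} (h' : IsChainUpTo c a' b') (h : IsChainUpTo c a b) :
    IsChainUpTo c (a' ∘ₗ a) (b' ∘ₗ a + a' ∘ₗ b) where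
  deg := h'.deg.comp_zero h.deg
  deg_htpy := (h'.deg_htpy.comp_zero h.deg).add (h'.deg.zero_comp h.deg_htpy)
  comm := by
    rw [smul_add, ← LinearMap.smul_comp, ← LinearMap.comp_smul, ← h'.comm, ← h.comm]
    ext x
    simp

lemma mapTot (c : S) (f : V ⟶ W) : IsChainUpTo c (mapTot f) 0 where
  deg := hasDeg_mapTot f
  deg_htpy := HasDeg.zero _
  comm := by rw [mapTot_dTot, sub_self, smul_zero]

lemma smul_comm (h : IsChainUpTo c a b) (hc : c * c = 0) :
    c • (dTot W ∘ₗ a) = c • (a ∘ₗ dTot V) := by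
  rw [← sub_eq_zero, ← smul_sub_aux, h.comm, smul_smul, hc, zero_smul]

/-- With c b = d a − a d and d² = 0, both sides equal −d a d. Nothing is claimed about b itself,
which is determined only up to c-torsion. -/
lemma smul_anticomm (h : IsChainUpTo c a b) :
    c • (dTot W ∘ₗ b) = - c • (b ∘ₗ dTot V) := by
  rw [neg_smul_aux, ← LinearMap.comp_smul, ← LinearMap.smul_comp, ← h.comm, LinearMap.comp_sub,
    LinearMap.sub_comp, ← LinearMap.comp_assoc, dTot_dTot, LinearMap.zero_comp,
    LinearMap.comp_assoc, LinearMap.comp_assoc (dTot V) (dTot V) a, dTot_dTot, LinearMap.comp_zero,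
    zero_sub, sub_zero]

end IsChainUpTo

end

/-! ### The corrected tensor power of a graded map and its homotopies -/

namespace MulResolutionData
variable {p : ℕ} (ν : MulResolutionData.{u} p) {S : Type u} [CommRing S] {V W U : Ch S}

lemma dX_act (f : TensPow p V →ₗ[S] TensPow p W) (hf : f ∘ₗ sgnTens p V = sgnTens p W ∘ₗ f) :
    ν.dX W ∘ₗ ν.act f LinearMap.id = ν.act f LinearMap.id ∘ₗ ν.dX V +
      ν.act (dTens p W ∘ₗ f - f ∘ₗ dTens p V) LinearMap.id := by
  rw [dX, dX, LinearMap.add_comp, LinearMap.comp_add]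
  simp only [act_comp, hf, LinearMap.id_comp, LinearMap.comp_id, sub_eq_add_neg, act_add, act_neg]
  abel

/-- The sign operator in front of L is the Koszul sign of the odd contraction. The contraction turns
its commutator with the differential of P̄ ⊗ I into the identity, leaving L ⊗ 1 and an error made
from the commutator of L with d. -/
lemma dX_contr_even (L : TensPow p V →ₗ[S] TensPow p W)
    (hL : L ∘ₗ sgnTens p V = sgnTens p W ∘ₗ L) (t : Fin p) :
    ν.dX W ∘ₗ ν.act (sgnTens p W ∘ₗ L) (ν.contrB t) +
        ν.act (sgnTens p W ∘ₗ L) (ν.contrB t) ∘ₗ ν.dX V =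
      ν.act L LinearMap.id -
        ν.act (sgnTens p W ∘ₗ (dTens p W ∘ₗ L - L ∘ₗ dTens p V)) (ν.contrB t) := by
  have e : dTens p W ∘ₗ sgnTens p W = - (sgnTens p W ∘ₗ dTens p W) := by
    rw [sgnTens_dTens, neg_neg]
  rw [dX, dX, LinearMap.add_comp, LinearMap.comp_add]
  simp only [act_comp, LinearMap.comp_assoc, hL, LinearMap.id_comp, LinearMap.comp_id]
  simp only [← LinearMap.comp_assoc, sgnTens_sgnTens, LinearMap.id_comp, e, dB_contrB,
    act_sub_right, LinearMap.neg_comp, act_neg, LinearMap.comp_sub]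
  simp only [sub_eq_add_neg, act_add, act_neg]
  abel

/-- The same computation with L odd: the operator now has even total degree, so a commutator
replaces the anticommutator, and the error involves d L + L d. -/
lemma dX_contr_odd (L : TensPow p V →ₗ[S] TensPow p W)
    (hL : L ∘ₗ sgnTens p V = - (sgnTens p W ∘ₗ L)) (t : Fin p) :
    ν.dX W ∘ₗ ν.act (sgnTens p W ∘ₗ L) (ν.contrB t) =
      ν.act (sgnTens p W ∘ₗ L) (ν.contrB t) ∘ₗ ν.dX V + ν.act L LinearMap.id -
        ν.act (sgnTens p W ∘ₗ (dTens p W ∘ₗ L + L ∘ₗ dTens p V)) (ν.contrB t) := by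
  have e : dTens p W ∘ₗ sgnTens p W = - (sgnTens p W ∘ₗ dTens p W) := by
    rw [sgnTens_dTens, neg_neg]
  rw [dX, dX, LinearMap.add_comp, LinearMap.comp_add]
  simp only [act_comp, LinearMap.comp_assoc, hL, LinearMap.id_comp, LinearMap.comp_id,
    LinearMap.comp_neg]
  simp only [← LinearMap.comp_assoc, sgnTens_sgnTens, LinearMap.id_comp, e, dB_contrB,
    LinearMap.comp_add, act_sub_right, LinearMap.neg_comp, act_neg, act_add]
  abel

/-- The correction term in `powX`. -/
def corrX (a b : Tot V →ₗ[S] Tot W) : ν.X V →ₗ[S] ν.X W :=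
  ∑ t, ν.act (sgnTens p W ∘ₗ oddIns t a b) (ν.contrB t)

/-- The map of `V^{⊗ p} ⊗ P̄ ⊗ I` induced by a graded map `a` that commutes with the differentials
up to `p b`: a correction of `a^{⊗ p}` that commutes with the differentials. -/
def powX (a b : Tot V →ₗ[S] Tot W) : ν.X V →ₗ[S] ν.X W :=
  ν.act (mapTens p fun _ => a) LinearMap.id + (-(p : S)) • ν.corrX a b

variable {a b a' b' : Tot V →ₗ[S] Tot W}

lemma powX_isFiltEquiv (h : IsChainUpTo (p : S) a b) : ν.IsFiltEquiv 0 (ν.powX a b) :=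
  (IsFiltEquiv.mapTens h.deg).add <| IsFiltEquiv.smul (IsFiltEquiv.sum_contr (k := -1) (by omega) _
    (fun t => oddIns_rotTens h.deg h.deg_htpy t) (fun t j => oddIns_deg h.deg h.deg_htpy t j)
    (by omega)) _

/-- The defect of a^{⊗p} is p times the sum of the insertions of b, tensored with the identity.
After multiplication by p, the commutator of d with `corrX` is the same sum: its error term contains
p (d L + L d), which vanishes because the insertion L of b anticommutes with d up to p-torsion. -/
lemma powX_dX (hp : (p : S) * (p : S) = 0) (h : IsChainUpTo (p : S) a b) :
    ν.powX a b ∘ₗ ν.dX V = ν.dX W ∘ₗ ν.powX a b := by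
  have e1 := ν.dX_act _ (mapTens_sgnTens (p := p) (fun _ => a) fun _ => h.deg)
  rw [dTens_mapTens_sub h.deg, h.comm] at e1
  have e2 : (p : S) • (ν.dX W ∘ₗ ν.corrX a b) =
      (p : S) • (ν.corrX a b ∘ₗ ν.dX V) + (p : S) • ∑ t, ν.act (oddIns t a b) LinearMap.id := by
    rw [corrX, comp_sum_aux, sum_comp_aux, Finset.smul_sum, Finset.smul_sum, Finset.smul_sum,
      ← Finset.sum_add_distrib]
    refine Finset.sum_congr rfl fun t _ => ?_
    rw [ν.dX_contr_odd _ (oddIns_sgnTens h.deg h.deg_htpy t), smul_sub_aux, smul_add, sub_eq_self,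
      ← act_smul, ← LinearMap.comp_smul, smul_add,
      smul_dTens_oddIns _ h.deg h.deg_htpy (h.smul_comm hp) h.smul_anticomm, neg_smul_aux,
      neg_add_cancel, LinearMap.comp_zero]
    exact ν.X_ext fun e b => TensorProduct.zero_tmul _ _
  rw [powX, LinearMap.add_comp, LinearMap.comp_add, LinearMap.smul_comp, LinearMap.comp_smul,
    neg_smul_aux, neg_smul_aux, e2, e1]
  simp only [oddIns_smul, ← Finset.smul_sum, act_smul, act_sum]
  abel

/-- The product of the two correction terms has the coefficient p² = 0, and the cross terms add up
to the correction for the composite. The equality is strict rather than up to homotopy. -/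
lemma powX_comp (hp : (p : S) * (p : S) = 0) {g h : Tot W →ₗ[S] Tot U} (ha : HasDeg 0 a)
    (hg : HasDeg 0 g) : ν.powX g h ∘ₗ ν.powX a b = ν.powX (g ∘ₗ a) (h ∘ₗ a + g ∘ₗ b) := by
  have e1 : ν.corrX g h ∘ₗ ν.act (mapTens p fun _ => a) LinearMap.id =
      ν.corrX (g ∘ₗ a) (h ∘ₗ a) := by
    rw [corrX, corrX, sum_comp_aux]
    refine Finset.sum_congr rfl fun t _ => ?_
    rw [act_comp, LinearMap.comp_assoc, oddIns_comp_mapTens ha, LinearMap.comp_id]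
  have e2 : ν.act (mapTens p fun _ => g) LinearMap.id ∘ₗ ν.corrX a b =
      ν.corrX (g ∘ₗ a) (g ∘ₗ b) := by
    rw [corrX, corrX, comp_sum_aux]
    refine Finset.sum_congr rfl fun t _ => ?_
    rw [act_comp, ← LinearMap.comp_assoc, mapTens_sgnTens _ fun _ => hg, LinearMap.comp_assoc,
      mapTens_comp_oddIns, LinearMap.id_comp]
  have e3 : ν.corrX (g ∘ₗ a) (h ∘ₗ a + g ∘ₗ b) =
      ν.corrX (g ∘ₗ a) (h ∘ₗ a) + ν.corrX (g ∘ₗ a) (g ∘ₗ b) := by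
    simp only [corrX, oddIns_add, LinearMap.comp_add, act_add, Finset.sum_add_distrib]
  rw [powX, powX, powX, e3, LinearMap.add_comp, LinearMap.comp_add, LinearMap.comp_add,
    LinearMap.smul_comp, LinearMap.comp_smul, LinearMap.smul_comp, LinearMap.comp_smul, e1, e2,
    act_comp, mapTens_comp, smul_smul, neg_mul_neg, hp, zero_smul, add_zero, smul_add,
    LinearMap.id_comp, add_assoc, add_comm ((-(p : S)) • ν.corrX (g ∘ₗ a) (g ∘ₗ b))]

lemma powX_mapTot (f : V ⟶ W) : ν.powX (mapTot f) 0 = ν.mapX (TensHom.ofMap p f) := by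
  have : ν.corrX (mapTot f) 0 = 0 := by
    refine Finset.sum_eq_zero fun t _ => ?_
    have e : oddIns t (mapTot f) (0 : Tot V →ₗ[S] Tot W) = 0 := by
      simpa using oddIns_smul t (0 : S) (mapTot f) (0 : Tot V →ₗ[S] Tot W)
    rw [e, LinearMap.comp_zero]
    exact ν.X_ext fun e b => TensorProduct.zero_tmul _ _
  rw [powX, this, smul_zero, add_zero]
  rfl

/-- The homotopy between the maps induced by two graded maps that are congruent modulo `p`. -/
def htpyX (a c : Tot V →ₗ[S] Tot W) : ν.X V →ₗ[S] ν.X W :=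
  ∑ t, ν.act (sgnTens p W ∘ₗ evenIns t a c) (ν.contrB t)

lemma htpyX_isFiltEquiv {c : Tot V →ₗ[S] Tot W} (ha : HasDeg 0 a) (hc : HasDeg 0 c) :
    ν.IsFiltEquiv 1 (ν.htpyX a c) :=
  IsFiltEquiv.sum_contr (k := 0) le_rfl _ (fun t => evenIns_rotTens ha hc t)
    (fun t j => by rw [add_zero]; exact evenIns_deg ha hc t j) (by omega)

/-- To first order, a'^{⊗p} differs from a^{⊗p} by p times the sum of the insertions of c. That sum
tensored with 1 is the leading term of the anticommutator of d with `htpyX`; the remaining term of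
the anticommutator accounts for the change in the correction. -/
lemma powX_eq_of_congr (hp : (p : S) * (p : S) = 0) {c : Tot V →ₗ[S] Tot W}
    (h : IsChainUpTo (p : S) a b) (h' : IsChainUpTo (p : S) a' b') (hc : HasDeg 0 c)
    (e : a' = a + (p : S) • c) :
    ν.powX a' b' = ν.powX a b + (p : S) • (ν.dX W ∘ₗ ν.htpyX a c + ν.htpyX a c ∘ₗ ν.dX V) := by
  have e0 : (p : S) • a' = (p : S) • a := by rw [e, smul_add, smul_smul, hp, zero_smul, add_zero]
  -- Up to p-torsion b' is determined by a', and `corrX` enters only with the coefficient p.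
  have hb : (p : S) • b' = (p : S) • (b + (dTot W ∘ₗ c - c ∘ₗ dTot V)) := by
    rw [← h'.comm, smul_add, ← h.comm, e, LinearMap.comp_add, LinearMap.add_comp,
      LinearMap.comp_smul, LinearMap.smul_comp, smul_sub_aux]
    abel
  have e1 : (p : S) • (ν.dX W ∘ₗ ν.htpyX a c + ν.htpyX a c ∘ₗ ν.dX V) =
      (p : S) • ∑ t, ν.act (evenIns t a c) LinearMap.id -
        (p : S) • ν.corrX a (dTot W ∘ₗ c - c ∘ₗ dTot V) := by
    rw [htpyX, corrX, comp_sum_aux, sum_comp_aux, ← Finset.sum_add_distrib, ← smul_sub_aux,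
      ← Finset.sum_sub_distrib, Finset.smul_sum, Finset.smul_sum]
    refine Finset.sum_congr rfl fun t _ => ?_
    rw [ν.dX_contr_even _ (evenIns_sgnTens h.deg hc t), smul_sub_aux, smul_sub_aux]
    congr 1
    rw [← act_smul, ← LinearMap.comp_smul, smul_dTens_evenIns _ h.deg hc (h.smul_comm hp), LinearMap.comp_smul,
      act_smul]
  have e2 : (p : S) • ν.corrX a' b' =
      (p : S) • ν.corrX a b + (p : S) • ν.corrX a (dTot W ∘ₗ c - c ∘ₗ dTot V) := by
    simp only [corrX, Finset.smul_sum, ← Finset.sum_add_distrib]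
    refine Finset.sum_congr rfl fun t _ => ?_
    rw [← act_smul, ← LinearMap.comp_smul, smul_oddIns_congr _ e0 hb, oddIns_add, smul_add,
      LinearMap.comp_add, act_add]
    simp only [LinearMap.comp_smul, act_smul]
  rw [e1, powX, powX, neg_smul_aux, neg_smul_aux, e2, e, mapTens_add_smul _ hp, act_add, act_smul, act_sum]
  simp only [evenIns]
  abel

/-! #### Compatibility with reduction modulo `p` -/

section Reduction
variable {W' V' : Ch S} {η : V ⟶ V'} {η' : W ⟶ W'}

/-- The correction is a multiple of p and the target is killed by p, so after reduction only a^{⊗p}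
remains, and it reduces to the tensor power of g. -/
lemma mapX_powX [Fact p.Prime] (h' : IsPQuot p η')
    (hW : ∀ n (w : W'.X n), (p : S) • w = 0) (g : V' ⟶ W')
    (e : mapTot η' ∘ₗ a = mapTot g ∘ₗ mapTot η) :
    ν.mapX (TensHom.ofMap p η') ∘ₗ ν.powX a b =
      ν.mapX (TensHom.ofMap p g) ∘ₗ ν.mapX (TensHom.ofMap p η) := by
  have e0 : (p : S) • (TensHom.ofMap p η').toLin = 0 := by
    have := congrArg (fun f => f ∘ₗ (TensHom.ofMap p η').toLin)
      (h'.pHom_comp_ofMap hW (Fact.out : p.Prime).pos)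
    simp only [LinearMap.comp_assoc, h'.pLin_comp, LinearMap.comp_smul, LinearMap.comp_id,
      LinearMap.zero_comp] at this
    exact this
  have e1 : (p : S) • ν.mapX (TensHom.ofMap p η') = 0 := by
    rw [mapX, ← act_smul, e0]
    exact ν.X_ext fun e b => TensorProduct.zero_tmul _ _
  rw [powX, LinearMap.comp_add, LinearMap.comp_smul, neg_smul_aux, ← LinearMap.smul_comp, e1,
    LinearMap.zero_comp, neg_zero, add_zero, mapX, mapX, mapX, act_comp, act_comp]
  congr 1
  rw [TensHom.ofMap_toLin, TensHom.ofMap_toLin, TensHom.ofMap_toLin, mapTens_comp, mapTens_comp, e]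

/-- Dually, the image of multiplication by p is itself killed by p, so the correction vanishes on
it. -/
lemma powX_mapX (hp : (p : S) * (p : S) = 0) (h : IsPQuot p η) (h' : IsPQuot p η') (g : V' ⟶ W')
    (e : mapTot η' ∘ₗ a = mapTot g ∘ₗ mapTot η) :
    ν.powX a b ∘ₗ ν.mapX h.pHom = ν.mapX h'.pHom ∘ₗ ν.mapX (TensHom.ofMap p g) := by
  have e1 : h.pLin ∘ₗ (TensHom.ofMap p η).toLin = (p : S) • LinearMap.id := h.pLin_comp
  have e2 : (mapTens p fun _ => a) ∘ₗ h.pLin = h'.pLin ∘ₗ (TensHom.ofMap p g).toLin := by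
    refine h.cancel ?_
    have e3 : (TensHom.ofMap p g).toLin ∘ₗ (TensHom.ofMap p η).toLin =
        (TensHom.ofMap p η').toLin ∘ₗ mapTens p fun _ => a := by
      rw [TensHom.ofMap_toLin, TensHom.ofMap_toLin, TensHom.ofMap_toLin, mapTens_comp,
        mapTens_comp, e]
    rw [LinearMap.comp_assoc, LinearMap.comp_assoc, e1, e3, ← LinearMap.comp_assoc,
      h'.pLin_comp, LinearMap.comp_smul, LinearMap.smul_comp]
    rfl
  -- Precomposed with the surjection η^{⊗p}, this map is multiplication by p² = 0.
  have e4 : (p : S) • h.pLin = 0 := by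
    refine h.cancel ?_
    rw [LinearMap.smul_comp, e1, smul_smul, hp, zero_smul, LinearMap.zero_comp]
  have e5 : (p : S) • ν.mapX h.pHom = 0 := by
    rw [mapX, ← act_smul, IsPQuot.pHom_toLin, e4]
    exact ν.X_ext fun e b => TensorProduct.zero_tmul _ _
  rw [powX, LinearMap.add_comp, LinearMap.smul_comp, neg_smul_aux, ← LinearMap.comp_smul, e5,
    LinearMap.comp_zero, neg_zero, add_zero, mapX, mapX, mapX, act_comp, act_comp,
    IsPQuot.pHom_toLin, IsPQuot.pHom_toLin, e2]

end Reduction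

end MulResolutionData

/-! ### Divisibility by p over W_2(R) for a perfect R -/

section Witt
variable (p : ℕ) [Fact p.Prime] (R : Type u) [CommRing R] [CharP R p]

lemma p_mul_p : (p : W2 p R) * (p : W2 p R) = 0 :=
  p_mul_eq_zero p R p (by rw [map_natCast, CharP.cast_eq_zero])

/-- In characteristic p, multiplication by p sends (r, s) to (0, r^p). Perfectness of R is used
here: every second coordinate must be a p-th power. -/
lemma exists_eq_p_mul [PerfectRing R p] (x : W2 p R) (hx : resid p R x = 0) :
    ∃ y : W2 p R, x = y * (p : W2 p R) := by
  obtain ⟨a, rfl⟩ := WittVector.truncate_surjective p 2 R x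
  have h0 : a.coeff 0 = 0 := (WittVector.coeff_truncate a 0).symm.trans hx
  obtain ⟨r, hr⟩ := surjective_frobenius R p (a.coeff 1)
  refine ⟨WittVector.truncate 2 (WittVector.mk p fun _ => r), ?_⟩
  rw [← map_natCast (WittVector.truncate 2 : WittVector p R →+* _), ← map_mul]
  apply TruncatedWittVector.ext
  intro i
  rw [WittVector.coeff_truncate, WittVector.coeff_truncate]
  fin_cases i
  · exact h0.trans (WittVector.mul_charP_coeff_zero _).symm
  · refine Eq.trans ?_ (WittVector.mul_charP_coeff_succ _ 0).symm
    rw [WittVector.coeff_mk, ← frobenius_def]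
    exact hr.symm

variable {p R} in
/-- The quotient map `V → V/p`. -/
abbrev redMap (V : Ch (W2 p R)) : V ⟶ (qLow p R).obj ((qUp p R).obj V) := (toQuot p R).app V

/-- The kernel of V_n → R ⊗ V_n is p V_n because the quotient map V_n → V_n/p V_n factors through R
⊗ V_n. -/
lemma exists_p_smul_eq [PerfectRing R p] (V : Ch (W2 p R)) (n : ℤ) (v : V.X n)
    (hv : ((redMap V).f n).hom v = 0) : ∃ w : V.X n, (p : W2 p R) • w = v := by
  let N : Submodule (W2 p R) (V.X n) :=
    LinearMap.range ((p : W2 p R) • (LinearMap.id : V.X n →ₗ[W2 p R] V.X n))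
  have key : ∀ x : W2 p R, resid p R x = 0 → x • N.mkQ = 0 := by
    intro x hx
    obtain ⟨y, rfl⟩ := exists_eq_p_mul p R x hx
    refine LinearMap.ext fun w => (Submodule.Quotient.mk_eq_zero N).2 ⟨y • w, ?_⟩
    simp [smul_smul]
  have key' : ∀ x y : W2 p R, resid p R x = resid p R y → x • N.mkQ = y • N.mkQ := by
    intro x y hxy
    rw [← sub_eq_zero]
    exact (sub_smul _ _ _).symm.trans (key _ (by rw [map_sub, hxy, sub_self]))
  let s : R → W2 p R := fun r => TruncatedWittVector.mk p fun _ => r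
  have hs : ∀ r, resid p R (s r) = r :=
    fun r => TruncatedWittVector.coeff_mk (p := p) (fun _ : Fin 2 => r) 0
  -- This is r ⊗ v ↦ the class of s(r) v. The section `s` is only a map of sets, but two lifts of r
  -- act equally on V_n/p V_n, which gives additivity and linearity.
  let φ : ((ModuleCat.restrictScalars (resid p R)).obj (ModuleCat.of R R)) ⊗[W2 p R] (V.X n)
      →ₗ[W2 p R] V.X n ⧸ N := TensorProduct.lift
    { toFun := fun r => s r • N.mkQ
      map_add' := fun r r' => (key' _ (s r + s r')
        ((hs _).trans (((map_add _ _ _).trans (congrArg₂ (· + ·) (hs r) (hs r'))).symm))).trans (add_smul _ _ _)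
      map_smul' := fun c r => (key' _ (c * s r)
        ((hs _).trans (((map_mul _ _ _).trans (congrArg (resid p R c * ·) (hs r))).symm))).trans (mul_smul _ _ _) }
  have e : φ (((redMap V).f n).hom v) = N.mkQ v := by
    refine (TensorProduct.lift.tmul _ _).trans ?_
    change (s 1 • N.mkQ) v = N.mkQ v
    rw [key' (s 1) 1 (by rw [hs, map_one]), one_smul]
  rw [hv] at e
  obtain ⟨w, hw⟩ := (Submodule.Quotient.mk_eq_zero N).1 (e.symm.trans (map_zero φ))
  exact ⟨w, hw⟩

end Witt

/-- Pointwise divisibility of f becomes divisibility by a linear map: f is lifted along the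
surjection of N onto cN. -/
lemma exists_eq_smul {S M N : Type*} [CommRing S] [AddCommGroup M] [Module S M]
    [Module.Projective S M] [AddCommGroup N] [Module S N] (c : S) (f : M →ₗ[S] N)
    (h : ∀ x, ∃ y, c • y = f x) : ∃ g : M →ₗ[S] N, f = c • g := by
  let m : N →ₗ[S] N := c • LinearMap.id
  obtain ⟨g, hg⟩ := Module.projective_lifting_property m.rangeRestrict
    (f.codRestrict (LinearMap.range m) fun x => by
      obtain ⟨y, hy⟩ := h x
      exact ⟨y, hy⟩) m.surjective_rangeRestrict
  exact ⟨g, LinearMap.ext fun x => congrArg (fun f => (f x).1) hg.symm⟩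

/-! ### Graded lifts of maps of reduced complexes -/

section Lift
variable {p : ℕ} [Fact p.Prime] {R : Type u} [CommRing R]

/-- The pair `a, b` consists of a graded map lifting a map `f : V/p → V'/p` of complexes and of a
witness that it commutes with the differentials modulo `p`. -/
structure IsLift {V V' : Ch (W2 p R)} (f : (qUp p R).obj V ⟶ (qUp p R).obj V')
    (a b : Tot V →ₗ[W2 p R] Tot V') : Prop where
  chain : IsChainUpTo (p : W2 p R) a b
  red : mapTot (redMap V') ∘ₗ a =
    mapTot ((qLow p R).map f) ∘ₗ mapTot (redMap V)

lemma IsLift.ofMap {V V' : Ch (W2 p R)} (φ : V ⟶ V') :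
    IsLift ((qUp p R).map φ) (mapTot φ) 0 where
  chain := IsChainUpTo.mapTot _ φ
  red := by
    rw [← mapTot_comp, ← mapTot_comp]
    exact congrArg mapTot ((toQuot p R).naturality φ)

lemma IsLift.comp {V V' V'' : Ch (W2 p R)} {f : (qUp p R).obj V ⟶ (qUp p R).obj V'}
    {f' : (qUp p R).obj V' ⟶ (qUp p R).obj V''} {a b : Tot V →ₗ[W2 p R] Tot V'}
    {a' b' : Tot V' →ₗ[W2 p R] Tot V''} (h : IsLift f a b) (h' : IsLift f' a' b') :
    IsLift (f ≫ f') (a' ∘ₗ a) (b' ∘ₗ a + a' ∘ₗ b) where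
  chain := h'.chain.comp h.chain
  red := by
    rw [← LinearMap.comp_assoc, h'.red, LinearMap.comp_assoc, h.red, ← LinearMap.comp_assoc,
      ← mapTot_comp, Functor.map_comp]

variable [CharP R p] [PerfectRing R p]

/-- Projectivity is used twice in each degree: to lift f to a, and to divide d a − a d by p. The
latter is zero modulo p because f is a map of complexes. -/
lemma exists_isLift {V V' : Ch (W2 p R)} [∀ n, Module.Projective (W2 p R) (V.X n)]
    (f : (qUp p R).obj V ⟶ (qUp p R).obj V') : ∃ a b, IsLift f a b := by
  choose a ha using fun n => Module.projective_lifting_property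
    ((redMap V').f n).hom
    ((((qLow p R).map f).f n).hom ∘ₗ ((redMap V).f n).hom) (toQuot_surj p R V' n)
  have ha' : ∀ n x, ((redMap V').f n).hom (a n x) =
      (((qLow p R).map f).f n).hom (((redMap V).f n).hom x) :=
    fun n x => congrArg (fun g => g x) (ha n)
  choose b hb using fun n => exists_eq_smul (p : W2 p R)
    ((V'.d n (n - 1)).hom ∘ₗ a n - a (n - 1) ∘ₗ (V.d n (n - 1)).hom) fun x => by
      apply exists_p_smul_eq p R V' (n - 1)
      rw [LinearMap.sub_apply, map_sub, LinearMap.comp_apply, LinearMap.comp_apply, ha', sub_eq_zero]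
      have e1 : ∀ y, ((redMap V').f (n - 1)).hom ((V'.d n (n - 1)).hom y) =
          (((qLow p R).obj ((qUp p R).obj V')).d n (n - 1)).hom
            (((redMap V').f n).hom y) :=
        fun y => congrArg (fun g => g.hom y) ((redMap V').comm n (n - 1)).symm
      have e2 : ∀ y, ((redMap V).f (n - 1)).hom ((V.d n (n - 1)).hom y) =
          (((qLow p R).obj ((qUp p R).obj V)).d n (n - 1)).hom
            (((redMap V).f n).hom y) :=
        fun y => congrArg (fun g => g.hom y) ((redMap V).comm n (n - 1)).symm
      rw [e1, e2, ha']
      exact congrArg (fun g => g.hom (((redMap V).f n).hom x)) (((qLow p R).map f).comm n (n - 1))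
  have hb' : ∀ n x, (V'.d n (n - 1)).hom (a n x) - a (n - 1) ((V.d n (n - 1)).hom x) =
      (p : W2 p R) • b n x := fun n x => congrArg (fun g => g x) (hb n)
  refine ⟨DirectSum.toModule _ ℤ _ fun n => inc V' n ∘ₗ a n,
    DirectSum.toModule _ ℤ _ fun n => inc V' (n - 1) ∘ₗ b n, ⟨fun n v => ?_, fun n v => ?_, ?_⟩, ?_⟩
  · exact inc_congr (add_zero n) ⟨a n v, by simp [DirectSum.toModule_lof]⟩
  · exact ⟨b n v, by simp [DirectSum.toModule_lof]; rfl⟩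
  · refine tot_ext _ fun n v => ?_
    simp only [LinearMap.sub_apply, LinearMap.comp_apply, LinearMap.smul_apply, dTot_inc,
      DirectSum.toModule_lof]
    rw [← map_sub, ← map_smul, hb']
  · refine tot_ext _ fun n v => ?_
    simp only [LinearMap.comp_apply, mapTot_inc, DirectSum.toModule_lof, ha']

/-- The difference of two lifts reduces to zero, hence is pointwise divisible by p; projectivity
makes the quotient c linear. -/
lemma IsLift.exists_sub {V V' : Ch (W2 p R)} [∀ n, Module.Projective (W2 p R) (V.X n)]
    {f : (qUp p R).obj V ⟶ (qUp p R).obj V'} {a b a' b' : Tot V →ₗ[W2 p R] Tot V'}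
    (h : IsLift f a b) (h' : IsLift f a' b') :
    ∃ c, HasDeg 0 c ∧ a' = a + (p : W2 p R) • c := by
  -- Only the individual V_n are assumed projective, so the difference is projected to its component
  -- in degree n before dividing by p; the second clause says that nothing is lost by projecting.
  have hd : ∀ n (v : V.X n), ∃ w, (p : W2 p R) • w =
      (DirectSum.component (W2 p R) ℤ (fun n => V'.X n) n ∘ₗ (a' - a) ∘ₗ inc V n) v ∧
      inc V' n ((p : W2 p R) • w) = a' (inc V n v) - a (inc V n v) := by
    intro n v
    obtain ⟨w, hw⟩ := inc_congr (add_zero n).symm (h.chain.deg n v)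
    obtain ⟨w', hw'⟩ := inc_congr (add_zero n).symm (h'.chain.deg n v)
    have e : (DirectSum.component (W2 p R) ℤ (fun n => V'.X n) n ∘ₗ (a' - a) ∘ₗ inc V n) v =
        w' - w := by
      rw [LinearMap.comp_apply, LinearMap.comp_apply, LinearMap.sub_apply, ← hw, ← hw', ← map_sub,
        DirectSum.component.lof_self]
    have e1 : mapTot (redMap V') (a (inc V n v)) =
        mapTot (redMap V') (a' (inc V n v)) :=
      congrArg (fun g => g (inc V n v)) (h.red.trans h'.red.symm)
    rw [← hw, ← hw', mapTot_inc, mapTot_inc] at e1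
    have e2 := congrArg (DirectSum.component (W2 p R) ℤ
      (fun n => ((qLow p R).obj ((qUp p R).obj V')).X n) n) e1
    have e3 : ((redMap V').f n).hom w = ((redMap V').f n).hom w' := by
      rwa [DirectSum.component.lof_self, DirectSum.component.lof_self] at e2
    obtain ⟨y, hy⟩ := exists_p_smul_eq p R V' n (w' - w) (by rw [map_sub, e3, sub_self])
    exact ⟨y, by rw [e, hy], by rw [hy, map_sub, hw, hw']⟩
  choose c hc using fun n => exists_eq_smul (p : W2 p R)
    (DirectSum.component (W2 p R) ℤ (fun n => V'.X n) n ∘ₗ (a' - a) ∘ₗ inc V n)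
    fun v => (hd n v).imp fun w hw => hw.1
  refine ⟨DirectSum.toModule _ ℤ _ fun n => inc V' n ∘ₗ c n,
    fun n v => inc_congr (add_zero n) ⟨c n v, by simp [DirectSum.toModule_lof]⟩,
    tot_ext _ fun n v => ?_⟩
  obtain ⟨w, hw, hw'⟩ := hd n v
  have e : (p : W2 p R) • c n v = (p : W2 p R) • w :=
    (congrArg (fun g => g v) (hc n)).symm.trans hw.symm
  simp only [LinearMap.add_apply, LinearMap.comp_apply, LinearMap.smul_apply,
    DirectSum.toModule_lof]
  rw [← map_smul, e, hw', add_sub_cancel]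

end Lift

/-! ### Maps of C^l and C^r induced by lifts, and their independence of the lift -/

namespace MulResolutionData

section
variable {p : ℕ} [Fact p.Prime] (ν : MulResolutionData.{u} p) {R : Type u} [CommRing R]

lemma cr_hom_ext {V K : Ch (W2 p R)} {φ ψ : K ⟶ (ν.cr R).obj V}
    (h : ∀ n x, (ν.crSub R V n).subtype ((φ.f n).hom x) =
      (ν.crSub R V n).subtype ((ψ.f n).hom x)) : φ = ψ := by
  apply HomologicalComplex.hom_ext
  intro n
  apply ModuleCat.hom_ext
  exact LinearMap.ext fun x => Subtype.ext (h n x)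

end

section
variable {p : ℕ} [Fact p.Prime] (ν : MulResolutionData.{u} p) {R : Type u} [CommRing R] [CharP R p]
  {V V' V'' : Ch (W2 p R)} {f : (qUp p R).obj V ⟶ (qUp p R).obj V'}
  {f' : (qUp p R).obj V' ⟶ (qUp p R).obj V''}
  {a b a₁ b₁ : Tot V →ₗ[W2 p R] Tot V'} {a' b' : Tot V' →ₗ[W2 p R] Tot V''}

/-- The map of Tate complexes induced by a lift of a map modulo `p`. -/
def liftTate (h : IsLift f a b) : ν.tateObj V ⟶ ν.tateObj V' :=
  ν.tateMapX (ν.powX_isFiltEquiv h.chain) (ν.powX_dX (p_mul_p p R) h.chain)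

/-- The map `C(V) → C(V')` induced by a lift of a map modulo `p`. -/
def liftC (h : IsLift f a b) : ν.C V ⟶ ν.C V' := (FiltCh.trunc01 _).map (ν.liftTate h)

lemma liftC_comp (h : IsLift f a b) (h' : IsLift f' a' b') :
    ν.liftC (h.comp h') = ν.liftC h ≫ ν.liftC h' := by
  refine Eq.trans ?_ ((FiltCh.trunc01 _).map_comp _ _)
  refine congrArg (fun g => (FiltCh.trunc01 _).map g) (ν.tateMapX_comp _ _ _ _ _ _ ?_).symm
  exact ν.powX_comp (p_mul_p p R) h.chain.deg h'.chain.deg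

lemma liftC_ofMap (φ : V ⟶ V') : ν.liftC (IsLift.ofMap φ) = ν.CMap (TensHom.ofMap p φ) :=
  congrArg (fun g => (FiltCh.trunc01 _).map g) (ν.tateMap_eq _ _ _ (ν.powX_mapTot φ))

/-- Compatibility with q has two uses: it shows that `liftC` preserves C^r(V), and it gives
compatibility of `liftCl` with the structure map of C^l. -/
lemma liftC_qMap (h : IsLift f a b) :
    ν.liftC h ≫ ν.qMap R V' = ν.qMap R V ≫ ν.CMap (TensHom.ofMap p ((qLow p R).map f)) := by
  rw [qMap, qMap, ← CMap_comp, CMap, CMap, liftC]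
  refine ((FiltCh.trunc01 _).map_comp _ _).symm.trans ?_
  refine congrArg (fun g => (FiltCh.trunc01 _).map g) ?_
  refine (ν.tateMapX_comp _ _ (IsFiltEquiv.mapX _) (ν.mapX_dX _) (IsFiltEquiv.mapX _)
    (ν.mapX_dX ((TensHom.ofMap p ((toQuot p R).app V)).comp
      (TensHom.ofMap p ((qLow p R).map f)))) ?_)
  refine (ν.mapX_powX (toQuot_isPQuot p R V') (qLow_kill p R _) _ h.red).trans ?_
  exact ν.act_comp _ _ _ _

/-- Compatibility with p lets `liftC` descend to C^l(V) and gives compatibility of `liftCr` with the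
structure map of C^r. -/
lemma pMap_liftC (h : IsLift f a b) :
    ν.pMap R V ≫ ν.liftC h = ν.CMap (TensHom.ofMap p ((qLow p R).map f)) ≫ ν.pMap R V' := by
  rw [pMap, pMap, ← CMap_comp, CMap, CMap, liftC]
  refine ((FiltCh.trunc01 _).map_comp _ _).symm.trans ?_
  refine congrArg (fun g => (FiltCh.trunc01 _).map g) ?_
  refine (ν.tateMapX_comp (IsFiltEquiv.mapX _) (ν.mapX_dX _) _ _ (IsFiltEquiv.mapX _)
    (ν.mapX_dX ((TensHom.ofMap p ((qLow p R).map f)).comp (toQuot_isPQuot p R V').pHom)) ?_)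
  refine (ν.powX_mapX (p_mul_p p R) (toQuot_isPQuot p R V) (toQuot_isPQuot p R V') _ h.red).trans ?_
  exact ν.act_comp _ _ _ _

/-- This supplies the factorisation c = π q required by `SmulHtpy.sub_mem` and `SmulHtpy.eq_of_mem`,
with c = p. -/
lemma tate_pMap_qMap (i : ℤ) (y : (ν.tateObj V).K.X i) :
    ((ν.tateMap (toQuot_isPQuot p R V).pHom).f.f i).hom
      (((ν.tateMap (TensHom.ofMap p ((toQuot p R).app V))).f.f i).hom y) = (p : W2 p R) • y := by
  refine Subtype.ext ?_
  refine (congrArg (fun g => g y.1) (ν.act_comp (TensHom.ofMap p ((toQuot p R).app V)).toLin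
    LinearMap.id (toQuot_isPQuot p R V).pHom.toLin LinearMap.id)).trans ?_
  rw [IsPQuot.pHom_toLin, (toQuot_isPQuot p R V).pLin_comp, act_smul]
  refine congrArg (fun z : ν.X V => (p : W2 p R) • z) ?_
  exact congrArg (fun f => f y.1) (TensorProduct.AlgebraTensorModule.map_id (R := ℤ) (A := W2 p R))

/-- The map `C^l(V) → C^l(V')` induced by a lift of a map modulo `p`. -/
def liftCl (h : IsLift f a b) : (ν.cl R).obj V ⟶ (ν.cl R).obj V' :=
  quotChMap (ν.liftC h).f <| by
    rintro n _ ⟨x, hx, rfl⟩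
    have e := congrArg (fun g => (g.f.f n).hom x) (ν.pMap_liftC h)
    exact ⟨_, FiltCh.leSub_map (ν.CMap (TensHom.ofMap p ((qLow p R).map f))) 0 n hx, e.symm⟩

/-- The map `C^r(V) → C^r(V')` induced by a lift of a map modulo `p`. -/
def liftCr (h : IsLift f a b) : (ν.cr R).obj V ⟶ (ν.cr R).obj V' :=
  subChMap (ν.liftC h).f <| by
    intro n x hx
    have e := congrArg (fun g => (g.f.f n).hom x) (ν.liftC_qMap h)
    refine (congrArg (· ∈ (ν.C (modp R V')).geSub 1 n) e).mpr ?_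
    exact FiltCh.geSub_map (ν.CMap (TensHom.ofMap p ((qLow p R).map f))) 1 n hx

lemma cl_hom_ext {K : Ch (W2 p R)} {φ ψ : (ν.cl R).obj V ⟶ K}
    (h : ∀ n x, (φ.f n).hom ((ν.clSub R V n).mkQ x) = (ψ.f n).hom ((ν.clSub R V n).mkQ x)) :
    φ = ψ := by
  apply HomologicalComplex.hom_ext
  intro n
  apply ModuleCat.hom_ext
  apply Submodule.linearMap_qext
  exact LinearMap.ext (h n)

lemma liftCl_comp (h : IsLift f a b) (h' : IsLift f' a' b') :
    ν.liftCl (h.comp h') = ν.liftCl h ≫ ν.liftCl h' :=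
  ν.cl_hom_ext fun n x => congrArg (fun g => (ν.clSub R V'' n).mkQ ((g.f.f n).hom x))
    (ν.liftC_comp h h')

lemma liftCr_comp (h : IsLift f a b) (h' : IsLift f' a' b') :
    ν.liftCr (h.comp h') = ν.liftCr h ≫ ν.liftCr h' :=
  ν.cr_hom_ext fun n x => congrArg (fun g => (g.f.f n).hom x.1) (ν.liftC_comp h h')

lemma liftCl_ofMap (φ : V ⟶ V') : ν.liftCl (IsLift.ofMap φ) = (ν.cl R).map φ :=
  ν.cl_hom_ext fun n x => congrArg (fun g => (ν.clSub R V' n).mkQ ((g.f.f n).hom x))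
    (ν.liftC_ofMap φ)

lemma liftCr_ofMap (φ : V ⟶ V') : ν.liftCr (IsLift.ofMap φ) = (ν.cr R).map φ :=
  ν.cr_hom_ext fun n x => congrArg (fun g => (g.f.f n).hom x.1) (ν.liftC_ofMap φ)

lemma liftCl_clTo (h : IsLift f a b) :
    ν.liftCl h ≫ (ν.clTo R).app V' = (ν.clTo R).app V ≫ (ν.cycR R).map f :=
  ν.cl_hom_ext fun n x => congrArg (fun g => (g.f.f n).hom x) (ν.liftC_qMap h)

lemma toCr_liftCr (h : IsLift f a b) :
    (ν.toCr R).app V ≫ ν.liftCr h = (ν.cycR R).map f ≫ (ν.toCr R).app V' :=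
  ν.cr_hom_ext fun n x => congrArg (fun g => (g.f.f n).hom x) (ν.pMap_liftC h)

variable [PerfectRing R p] [∀ n, Module.Projective (W2 p R) (V.X n)]

/-- The maps of Tate complexes induced by two lifts are homotopic by a multiple of `p`. -/
def liftTateHtpy (h : IsLift f a b) (h₁ : IsLift f a₁ b₁) :
    FiltCh.SmulHtpy (p : W2 p R) (ν.liftTate h) (ν.liftTate h₁) :=
  ν.tateHtpy _ _ _ _ (ν.htpyX_isFiltEquiv h.chain.deg (h.exists_sub h₁).choose_spec.1) _
    (ν.powX_eq_of_congr (p_mul_p p R) h.chain h₁.chain (h.exists_sub h₁).choose_spec.1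
      (h.exists_sub h₁).choose_spec.2)

/-- The factorisation of p through reduction is applied on the target V', whose subcomplex p
C̄^r(V'/p) is divided out. -/
lemma liftCl_eq (h : IsLift f a b) (h₁ : IsLift f a₁ b₁) : ν.liftCl h = ν.liftCl h₁ :=
  ν.cl_hom_ext fun n x => Eq.symm <| (Submodule.Quotient.eq (ν.clSub R V' n)).2 <|
    (ν.liftTateHtpy h h₁).sub_mem (ν.tateMap (TensHom.ofMap p ((toQuot p R).app V')))
      (ν.tateMap (toQuot_isPQuot p R V').pHom) (fun i y => ν.tate_pMap_qMap i y) x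

/-- Here the factorisation of p is applied on the source V, where membership in C^r(V) provides the
filtration bound. -/
lemma liftCr_eq (h : IsLift f a b) (h₁ : IsLift f a₁ b₁) : ν.liftCr h = ν.liftCr h₁ :=
  ν.cr_hom_ext fun _ x => Eq.symm <|
    (ν.liftTateHtpy h h₁).eq_of_mem (ν.tateMap (TensHom.ofMap p ((toQuot p R).app V)))
      (ν.tateMap (toQuot_isPQuot p R V).pHom) (fun i y => ν.tate_pMap_qMap i y) x.1 x.2

end

end MulResolutionData

/-! ### Lifting complexes of vector spaces to W_2(R) -/

section AdaptedBasis

/-- The differentials of a complex of vector spaces send every element of a suitable basis either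
to zero or to an element of the basis. -/
lemma exists_adapted_basis {R : Type u} [Field R] (W : Ch R) :
    ∃ (J : ℤ → Type u) (b : ∀ n, Module.Basis (J n) R (W.X n)), ∀ n m (x : J n),
      (W.d n m).hom (b n x) = 0 ∨ ∃ y, (W.d n m).hom (b n x) = b m y := by
  -- `q` is a basis of a complement of the cycles, on which d is injective.
  have hq : ∀ n, ∃ q : Set (W.X n), LinearIndepOn R id q ∧
      IsCompl (LinearMap.ker (W.d n (n - 1)).hom) (Submodule.span R q) := by
    intro n
    obtain ⟨Q, hQ⟩ := Submodule.exists_isCompl (LinearMap.ker (W.d n (n - 1)).hom)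
    obtain ⟨q, -, hq, hq'⟩ := exists_linearIndependent R (Q : Set (W.X n))
    exact ⟨q, hq', by rwa [hq, Submodule.span_eq]⟩
  choose q hq hqK using hq
  -- `t` is a basis of the cycles extending the images of the vectors of `q` one degree higher. The
  -- adapted basis is the union of `t` and `q`: d kills the former and sends the latter into `t` one
  -- degree lower.
  have ht : ∀ n, ∃ t : Set (W.X n), LinearIndepOn R id t ∧
      Submodule.span R t = LinearMap.ker (W.d n (n - 1)).hom ∧
      ∀ m, n + 1 = m → ∀ x ∈ q m, (W.d m n).hom x ∈ t := by
    intro n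
    have e : n + 1 - 1 = n := by omega
    have hK := hqK (n + 1)
    rw [e] at hK
    obtain ⟨t, htK, hst, hKt, ht⟩ := exists_linearIndepOn_id_extension
      (t := (LinearMap.ker (W.d n (n - 1)).hom : Set (W.X n)))
      ((hq (n + 1)).image (f := (W.d (n + 1) n).hom) hK.disjoint.symm) (by
        rintro _ ⟨x, -, rfl⟩
        exact congrArg (fun f => f.hom x) (W.d_comp_d (n + 1) n (n - 1)))
    refine ⟨t, ht, le_antisymm (Submodule.span_le.2 htK) hKt, ?_⟩
    rintro _ rfl x hx
    exact hst ⟨x, hx, rfl⟩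
  choose t ht htK hqt using ht
  have hli : ∀ n, LinearIndependent R fun x : ↥(t n ∪ q n) => (x : W.X n) := fun n =>
    (ht n).id_union (hq n) (by rw [htK]; exact (hqK n).disjoint)
  have hsp : ∀ n, ⊤ ≤ Submodule.span R (Set.range fun x : ↥(t n ∪ q n) => (x : W.X n)) := by
    intro n
    rw [Subtype.range_coe, Submodule.span_union, htK,
      (hqK n).sup_eq_top]
  have hmk : ∀ n (x : ↥(t n ∪ q n)), Module.Basis.mk (hli n) (hsp n) x = (x : W.X n) :=
    fun n x => Module.Basis.mk_apply _ _ x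
  refine ⟨fun n => ↥(t n ∪ q n), fun n => Module.Basis.mk (hli n) (hsp n), fun n m x => ?_⟩
  simp only [hmk]
  by_cases h : m + 1 = n
  · rcases x.2 with hx | hx
    · left
      obtain rfl : m = n - 1 := by omega
      have : (x : W.X n) ∈ LinearMap.ker (W.d n (n - 1)).hom := by
        rw [← htK]
        exact Submodule.subset_span hx
      exact this
    · right
      exact ⟨⟨_, Or.inl (hqt m n h x hx)⟩, rfl⟩
  · left
    have : W.d n m = 0 := W.shape n m h
    rw [this]
    rfl

end AdaptedBasis

section LiftComplex
variable (p : ℕ) [Fact p.Prime] {R : Type u} [Field R] {W : Ch R} {J : ℤ → Type u}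
  (b : ∀ n, Module.Basis (J n) R (W.X n))

open Classical in
/-- The image of a basis vector under the differential of the lifted complex. -/
def liftDiff (n m : ℤ) (x : J n) : J m →₀ W2 p R :=
  if h : ∃ y, (W.d n m).hom (b n x) = b m y then Finsupp.single h.choose 1 else 0

lemma liftDiff_eq_zero {n m : ℤ} {x : J n} (h : (W.d n m).hom (b n x) = 0) :
    liftDiff p b n m x = 0 := by
  refine dif_neg ?_
  rintro ⟨y, hy⟩
  exact (b m).ne_zero y (hy.symm.trans h)

lemma liftDiff_eq {n m : ℤ} {x : J n} {y : J m} (h : (W.d n m).hom (b n x) = b m y) :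
    liftDiff p b n m x = Finsupp.single y 1 := by
  have h' : ∃ y, (W.d n m).hom (b n x) = b m y := ⟨y, h⟩
  rw [liftDiff, dif_pos h', (b m).injective (h'.choose_spec.symm.trans h)]

/-- A lift to `W_2(R)` of a complex of `R`-vector spaces with an adapted basis. -/
def liftCh (hb : ∀ n m (x : J n), (W.d n m).hom (b n x) = 0 ∨
    ∃ y, (W.d n m).hom (b n x) = b m y) : Ch (W2 p R) where
  X n := ModuleCat.of _ (J n →₀ W2 p R)
  d n m := ModuleCat.ofHom (Finsupp.linearCombination (W2 p R) (liftDiff p b n m))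
  shape n m h := by
    apply ModuleCat.hom_ext
    refine Finsupp.lhom_ext' fun x => LinearMap.ext_ring ?_
    have : W.d n m = 0 := W.shape n m h
    have e : liftDiff p b n m x = 0 := liftDiff_eq_zero p b (by rw [this]; rfl)
    simp [e]
  d_comp_d' n m l _ _ := by
    apply ModuleCat.hom_ext
    refine Finsupp.lhom_ext' fun x => LinearMap.ext_ring ?_
    -- The identity d² = 0 survives the lift: if d sends x to a basis vector y, then d y = 0 over R,
    -- and the lifted differential of y is zero by construction.
    rcases hb n m x with h | ⟨y, h⟩
    · simp [liftDiff_eq_zero p b h]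
    · have : (W.d m l).hom (b m y) = 0 := by
        rw [← h]
        exact congrArg (fun f => f.hom (b n x)) (W.d_comp_d n m l)
      simp [liftDiff_eq p b h, liftDiff_eq_zero p b this]

variable (hb : ∀ n m (x : J n), (W.d n m).hom (b n x) = 0 ∨ ∃ y, (W.d n m).hom (b n x) = b m y)

/-- The basis of the reduction of the lifted complex. -/
def liftChBasis (n : ℤ) : Module.Basis (J n) R (((qUp p R).obj (liftCh p b hb)).X n) :=
  letI : Algebra (W2 p R) R := (resid p R).toAlgebra
  Module.Basis.baseChange R (Finsupp.basisSingleOne (ι := J n) (R := W2 p R))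

lemma liftChBasis_apply (n : ℤ) (x : J n) :
    liftChBasis p b hb n x = (show ((qUp p R).obj (liftCh p b hb)).X n from
      ((1 : R) : ((ModuleCat.restrictScalars (resid p R)).obj (ModuleCat.of R R)))
        ⊗ₜ[W2 p R] (Finsupp.single x (1 : W2 p R) : J n →₀ W2 p R)) := by
  let : Algebra (W2 p R) R := (resid p R).toAlgebra
  refine (Module.Basis.baseChange_apply R (Finsupp.basisSingleOne (ι := J n) (R := W2 p R)) x).trans ?_
  rw [Finsupp.coe_basisSingleOne]
  rfl

/-- The reduction of the lifted complex is the original complex. -/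
def liftChIso : (qUp p R).obj (liftCh p b hb) ≅ W :=
  HomologicalComplex.Hom.isoOfComponents
    (fun n => ((liftChBasis p b hb n).equiv (b n) (Equiv.refl _)).toModuleIso) <| by
    intro n m _
    apply ModuleCat.hom_ext
    refine (liftChBasis p b hb n).ext fun x => ?_
    have e1 : ((liftChBasis p b hb n).equiv (b n) (Equiv.refl _)) (liftChBasis p b hb n x) = b n x := by
      simp
    have e2 : (((qUp p R).obj (liftCh p b hb)).d n m).hom (liftChBasis p b hb n x) =
        (show ((qUp p R).obj (liftCh p b hb)).X m from
          ((1 : R) : ((ModuleCat.restrictScalars (resid p R)).obj (ModuleCat.of R R)))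
          ⊗ₜ[W2 p R] (liftDiff p b n m x)) := by
      rw [liftChBasis_apply]
      refine (ModuleCat.ExtendScalars.map_tmul (resid p R) ((liftCh p b hb).d n m) _ _).trans ?_
      refine congrArg (fun z : J m →₀ W2 p R => (show ((qUp p R).obj (liftCh p b hb)).X m from
          ((1 : R) : ((ModuleCat.restrictScalars (resid p R)).obj (ModuleCat.of R R)))
          ⊗ₜ[W2 p R] z)) ?_
      exact (Finsupp.linearCombination_single _ _ _).trans (one_smul _ _)
    change (W.d n m).hom (((liftChBasis p b hb n).equiv (b n) (Equiv.refl _))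
        (liftChBasis p b hb n x)) =
      ((liftChBasis p b hb m).equiv (b m) (Equiv.refl _))
        ((((qUp p R).obj (liftCh p b hb)).d n m).hom (liftChBasis p b hb n x))
    rw [e1, e2]
    rcases hb n m x with h | ⟨y, h⟩
    · rw [h, liftDiff_eq_zero p b h]
      refine (map_zero ((liftChBasis p b hb m).equiv (b m) (Equiv.refl _))).symm.trans ?_
      exact congrArg _ (TensorProduct.tmul_zero _ _).symm
    · rw [h, liftDiff_eq p b h, ← liftChBasis_apply]
      simp

end LiftComplex

/-- R being a field, an adapted basis exists, and its index sets give a free lift. Finite generation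
and boundedness are read off from these index sets. -/
instance qPull_essSurj (p : ℕ) [Fact p.Prime] (R : Type u) [Field R] :
    (qPull p R).EssSurj where
  mem_essImage W := by
    obtain ⟨J, b, hb⟩ := exists_adapted_basis W.obj
    obtain ⟨hW, N, hN⟩ := W.property
    have hfin : ∀ n, Finite (J n) := fun n => by
      have := (hW n).1
      exact Module.Finite.finite_basis (b n)
    refine ⟨⟨liftCh p b hb, fun n => ⟨?_, ?_⟩, N, fun n hn => ?_⟩,
      ⟨(isPf R).isoMk (liftChIso p b hb)⟩⟩
    · exact inferInstanceAs (Module.Finite (W2 p R) (J n →₀ W2 p R))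
    · exact inferInstanceAs (Module.Projective (W2 p R) (J n →₀ W2 p R))
    · have := hN n hn
      have : IsEmpty (J n) := ⟨fun x => (b n).ne_zero x (Subsingleton.elim _ _)⟩
      exact inferInstanceAs (Subsingleton (J n →₀ W2 p R))

/-! ### Factoring a functor through an essentially surjective functor -/

section Factorization
variable {A B E : Type*} [Category A] [Category B] [Category E] (Q : A ⥤ B) [Q.EssSurj] (K : A ⥤ E)

/-- A functor `K` that extends to the maps between the images of objects under an essentially
surjective functor `Q` factors through `Q`. -/
lemma exists_factorization (Θ : ∀ {X Y : A}, (Q.obj X ⟶ Q.obj Y) → (K.obj X ⟶ K.obj Y))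
    (hmap : ∀ {X Y : A} (φ : X ⟶ Y), Θ (Q.map φ) = K.map φ)
    (hcomp : ∀ {X Y Z : A} (f : Q.obj X ⟶ Q.obj Y) (g : Q.obj Y ⟶ Q.obj Z),
      Θ (f ≫ g) = Θ f ≫ Θ g) :
    ∃ (F : B ⥤ E) (e : Q ⋙ F ≅ K), ∀ {X Y : A} (f : Q.obj X ⟶ Q.obj Y),
      F.map f ≫ e.hom.app Y = e.hom.app X ≫ Θ f := by
  have hid : ∀ X : A, Θ (𝟙 (Q.obj X)) = 𝟙 (K.obj X) := fun X => by
    rw [← Q.map_id, hmap, K.map_id]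
  let F : B ⥤ E :=
    { obj := fun W => K.obj (Q.objPreimage W)
      -- The map f is conjugated by the chosen isomorphisms into one between objects in the image of
      -- `Q`, where Θ is defined.
      map := fun {W W'} f => Θ ((Q.objObjPreimageIso W).hom ≫ f ≫ (Q.objObjPreimageIso W').inv)
      map_id := fun W => by simp [hid]
      map_comp := fun f g => by rw [← hcomp]; simp }
  have hF : ∀ {W W'} (f : W ⟶ W'), F.map f =
    Θ ((Q.objObjPreimageIso W).hom ≫ f ≫ (Q.objObjPreimageIso W').inv) := fun _ => rfl
  -- The chosen preimage of `Q.obj X` need not be X; e is Θ of the comparison isomorphism, which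
  -- itself need not come from A.
  refine ⟨F, NatIso.ofComponents (fun X => ⟨Θ (Q.objObjPreimageIso (Q.obj X)).hom,
    Θ (Q.objObjPreimageIso (Q.obj X)).inv, by rw [← hcomp, Iso.hom_inv_id, hid]; rfl,
    by rw [← hcomp, Iso.inv_hom_id, hid]⟩) fun φ => ?_, fun f => ?_⟩
  · dsimp only [Functor.comp_map]
    rw [hF, ← hmap, ← hcomp, ← hcomp]
    simp
  · dsimp only [NatIso.ofComponents_hom_app]
    rw [hF, ← hcomp, ← hcomp]
    simp

variable (C : B ⥤ E) {K} {F : B ⥤ E} (e : Q ⋙ F ≅ K)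
  (Θ : ∀ {X Y : A}, (Q.obj X ⟶ Q.obj Y) → (K.obj X ⟶ K.obj Y))

/-- The hypothesis on L is naturality for all maps between objects `Q.obj X`, stronger than
naturality on A. This makes the transport along the chosen isomorphisms natural on B and independent
of the choices. -/
lemma exists_factorization_to 
    (hF : ∀ {X Y : A} (f : Q.obj X ⟶ Q.obj Y), F.map f ≫ e.hom.app Y = e.hom.app X ≫ Θ f)
    (L : K ⟶ Q ⋙ C)
    (hL : ∀ {X Y : A} (f : Q.obj X ⟶ Q.obj Y), Θ f ≫ L.app Y = L.app X ≫ C.map f) :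
    ∃ l : F ⟶ C, e.hom ≫ L = Functor.whiskerLeft Q l := by
  have key : ∀ {X Y : A} (f : Q.obj X ⟶ Q.obj Y),
      F.map f ≫ e.hom.app Y ≫ L.app Y = e.hom.app X ≫ L.app X ≫ C.map f := fun f => by
    rw [← Category.assoc, hF, Category.assoc, hL]
  let θ := fun W => Q.objObjPreimageIso W
  refine ⟨⟨fun W => F.map (θ W).inv ≫ e.hom.app _ ≫ L.app _ ≫ C.map (θ W).hom,
    fun W W' f => ?_⟩, ?_⟩
  · have := key ((θ W).hom ≫ f ≫ (θ W').inv)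
    have h2 : F.map f ≫ F.map (θ W').inv =
        F.map (θ W).inv ≫ F.map ((θ W).hom ≫ f ≫ (θ W').inv) := by
      rw [← F.map_comp, ← F.map_comp, Iso.inv_hom_id_assoc]
    rw [← Category.assoc, h2, Category.assoc]
    have h3 := congrArg (· ≫ C.map (θ W').hom) this
    simp only [Category.assoc, ← C.map_comp, Iso.inv_hom_id, Category.comp_id] at h3
    rw [h3]
    simp
  · ext X
    dsimp only [NatTrans.comp_app, Functor.whiskerLeft_app]
    have := key (θ (Q.obj X)).inv
    have h3 := congrArg (· ≫ C.map (θ (Q.obj X)).hom) this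
    simp only [Category.assoc, ← C.map_comp, Iso.inv_hom_id, C.map_id] at h3
    exact (congrArg (e.hom.app X ≫ ·) (Category.comp_id (L.app X)).symm).trans h3.symm

/-- The analogue for transformations into K; the inverse of e first brings the values of `r₀` into
F. -/
lemma exists_factorization_from 
    (hF : ∀ {X Y : A} (f : Q.obj X ⟶ Q.obj Y), F.map f ≫ e.hom.app Y = e.hom.app X ≫ Θ f)
    (r₀ : Q ⋙ C ⟶ K)
    (hr : ∀ {X Y : A} (f : Q.obj X ⟶ Q.obj Y), r₀.app X ≫ Θ f = C.map f ≫ r₀.app Y) :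
    ∃ r : C ⟶ F, Functor.whiskerLeft Q r ≫ e.hom = r₀ := by
  have hF' : ∀ {X Y : A} (f : Q.obj X ⟶ Q.obj Y),
      e.inv.app X ≫ F.map f = Θ f ≫ e.inv.app Y := fun {X Y} f => by
    have h1 := congrArg (fun g => e.inv.app X ≫ g ≫ e.inv.app Y) (hF f)
    simpa using h1
  have key : ∀ {X Y : A} (f : Q.obj X ⟶ Q.obj Y),
      r₀.app X ≫ e.inv.app X ≫ F.map f = C.map f ≫ r₀.app Y ≫ e.inv.app Y := fun f => by
    rw [hF', ← Category.assoc, hr, Category.assoc]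
  let θ := fun W => Q.objObjPreimageIso W
  refine ⟨⟨fun W => C.map (θ W).inv ≫ r₀.app _ ≫ e.inv.app _ ≫ F.map (θ W).hom,
    fun W W' f => ?_⟩, ?_⟩
  · have := key ((θ W).hom ≫ f ≫ (θ W').inv)
    have h2 : C.map f ≫ C.map (θ W').inv =
        C.map (θ W).inv ≫ C.map ((θ W).hom ≫ f ≫ (θ W').inv) := by
      rw [← C.map_comp, ← C.map_comp, Iso.inv_hom_id_assoc]
    have h3 := congrArg (· ≫ F.map (θ W').hom) this
    simp only [Category.assoc] at h3
    rw [← Category.assoc, h2, Category.assoc, ← h3, ← F.map_comp]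
    simp
  · ext X
    dsimp only [NatTrans.comp_app, Functor.whiskerLeft_app]
    have := key (θ (Q.obj X)).hom
    rw [this, ← Category.assoc (C.map _), ← C.map_comp, Iso.inv_hom_id, C.map_id, Category.id_comp,
      Category.assoc]
    simp

end Factorization

/-! ### Functoriality on perfect complexes and the conclusion -/

namespace MulResolutionData

section
variable {p : ℕ} [Fact p.Prime] (ν : MulResolutionData.{u} p) {R : Type u} [CommRing R] [CharP R p]
  [PerfectRing R p]

lemma exists_isLift_of_pf {V V' : Cpf (W2 p R)} (f : (qPull p R).obj V ⟶ (qPull p R).obj V') :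
    ∃ ab : (Tot V.obj →ₗ[W2 p R] Tot V'.obj) × (Tot V.obj →ₗ[W2 p R] Tot V'.obj),
      IsLift (V := V.obj) (V' := V'.obj) f.hom ab.1 ab.2 := by
  have : ∀ n, Module.Projective (W2 p R) (V.obj.X n) := fun n => (V.property.1 n).2
  obtain ⟨a, b, h⟩ := exists_isLift (V := V.obj) (V' := V'.obj) f.hom
  exact ⟨(a, b), h⟩

/-- The map `C^l(V) → C^l(V')` induced by a map `V/p → V'/p`. -/
def pfClMap {V V' : Cpf (W2 p R)} (f : (qPull p R).obj V ⟶ (qPull p R).obj V') :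
    (ν.cl R).obj V.obj ⟶ (ν.cl R).obj V'.obj :=
  ν.liftCl (exists_isLift_of_pf f).choose_spec

/-- The map `C^r(V) → C^r(V')` induced by a map `V/p → V'/p`. -/
def pfCrMap {V V' : Cpf (W2 p R)} (f : (qPull p R).obj V ⟶ (qPull p R).obj V') :
    (ν.cr R).obj V.obj ⟶ (ν.cr R).obj V'.obj :=
  ν.liftCr (exists_isLift_of_pf f).choose_spec

/-- Any lift computes the map, so identities between such maps may be checked on the most convenient
lift. -/
lemma pfClMap_eq {V V' : Cpf (W2 p R)} (f : (qPull p R).obj V ⟶ (qPull p R).obj V')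
    {a b : Tot V.obj →ₗ[W2 p R] Tot V'.obj} (h : IsLift (V := V.obj) (V' := V'.obj) f.hom a b) :
    ν.pfClMap f = ν.liftCl h :=
  have : ∀ n, Module.Projective (W2 p R) (V.obj.X n) := fun n => (V.property.1 n).2
  ν.liftCl_eq (V := V.obj) (V' := V'.obj) (exists_isLift_of_pf f).choose_spec h

lemma pfCrMap_eq {V V' : Cpf (W2 p R)} (f : (qPull p R).obj V ⟶ (qPull p R).obj V')
    {a b : Tot V.obj →ₗ[W2 p R] Tot V'.obj} (h : IsLift (V := V.obj) (V' := V'.obj) f.hom a b) :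
    ν.pfCrMap f = ν.liftCr h :=
  have : ∀ n, Module.Projective (W2 p R) (V.obj.X n) := fun n => (V.property.1 n).2
  ν.liftCr_eq (V := V.obj) (V' := V'.obj) (exists_isLift_of_pf f).choose_spec h

end

section

variable {p : ℕ} [Fact p.Prime] (ν : MulResolutionData.{u} p) (R : Type u) [Field R] [CharP R p]
  [PerfectRing R p]

attribute [local irreducible] cl cr cycR clTo toCr

lemma exists_factorization_pfCl : ∃ (F : Cpf R ⥤ Ch (W2 p R)) (e : qPull p R ⋙ F ≅ ν.pfCl R)
    (l : F ⟶ ν.pfC R), e.hom ≫ ν.pfL R = Functor.whiskerLeft (qPull p R) l := by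
  obtain ⟨F, e, hF⟩ := exists_factorization (qPull p R) (ν.pfCl R)
    (fun f => ν.pfClMap f)
    (fun φ => (ν.pfClMap_eq _ (IsLift.ofMap φ.hom)).trans (ν.liftCl_ofMap φ.hom))
    -- The lift chosen for f ≫ g is replaced by the composite of the lifts chosen for f and for g.
    (fun f g => (ν.pfClMap_eq _ _).trans (ν.liftCl_comp _ _))
  obtain ⟨l, hl⟩ := exists_factorization_to _ (ν.pfC R) e _ hF (ν.pfL R)
    fun f => ν.liftCl_clTo (exists_isLift_of_pf f).choose_spec
  exact ⟨F, e, l, hl⟩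

lemma exists_factorization_pfCr : ∃ (F : Cpf R ⥤ Ch (W2 p R)) (e : qPull p R ⋙ F ≅ ν.pfCr R)
    (r : ν.pfC R ⟶ F), Functor.whiskerLeft (qPull p R) r ≫ e.hom = ν.pfR R := by
  obtain ⟨F, e, hF⟩ := exists_factorization (qPull p R) (ν.pfCr R)
    (fun f => ν.pfCrMap f)
    (fun φ => (ν.pfCrMap_eq _ (IsLift.ofMap φ.hom)).trans (ν.liftCr_ofMap φ.hom))
    (fun f g => (ν.pfCrMap_eq _ _).trans (ν.liftCr_comp _ _))
  obtain ⟨r, hr⟩ := exists_factorization_from _ (ν.pfC R) e _ hF (ν.pfR R)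
    fun f => ν.toCr_liftCr (exists_isLift_of_pf f).choose_spec
  exact ⟨F, e, r, hr⟩

end

end MulResolutionData

end CyclicPowers

end

theorem mainTheorem10 (p : ℕ) [Fact p.Prime] (R : Type u) [Field R] [CharP R p] [PerfectRing R p]
    (ν : CyclicPowers.MulResolutionData.{u} p) :
    (∃ (F : CyclicPowers.Cpf R ⥤ CyclicPowers.Ch (CyclicPowers.W2 p R))
        (e : CyclicPowers.qPull p R ⋙ F ≅ ν.pfCl R) (l : F ⟶ ν.pfC R),
        e.hom ≫ ν.pfL R = Functor.whiskerLeft (CyclicPowers.qPull p R) l) ∧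
      (∃ (F : CyclicPowers.Cpf R ⥤ CyclicPowers.Ch (CyclicPowers.W2 p R))
        (e : CyclicPowers.qPull p R ⋙ F ≅ ν.pfCr R) (r : ν.pfC R ⟶ F),
        Functor.whiskerLeft (CyclicPowers.qPull p R) r ≫ e.hom = ν.pfR R) :=
  ⟨ν.exists_factorization_pfCl R, ν.exists_factorization_pfCr R⟩
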